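/- Let $p$ be a prime and let $R=\bigoplus_{n\ge 0}[R]_n$ and $S=\bigoplus_{n\ge 0}[S]_n$ be noetherian, $F$-finite standard graded rings over the same field $k=[R]_0=[S]_0$ of characteristic $p$ (i.e. generated over $k$ by their elements of degree $1$), with homogeneous maximal ideals $\mathfrak m$ and $\mathfrak n$, and assume $\operatorname{depth} R\ge 2$ and $\operatorname{depth} S\ge 2$. Let $T=R\# S=\bigoplus_{n\ge 0}[R]_n\otimes_k[S]_n$ be the Segre product, with homogeneous maximal ideal $\mathfrak m_T$. For a graded ring $U$ with homogeneous maximal ideal $\mathfrak m_U$, the local cohomology modules $H^j_{\mathfrak m_U}(U)$ carry the Frobenius action $\rho$ induced by the Frobenius endomorphism of $U$. For a $U$-module $M$ with Frobenius action $\rho$ put $0^\rho_M=\{m\in M : \rho^e(m)=0 \text{ for some } e\ge 0\}$, and call $M$ generalized nilpotent if $M/0^\rho_M$ has finite length over $U$. If $M$ is $\mathbf Z$-graded with $\rho([M]_n)\subseteq [M]_{np}$, let $\operatorname{nilsupp} M=\{n\in\mathbf Z : [M]_n\not\subseteq 0^\rho_M\}$. Let $$g_U=\operatorname{gF-depth}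 U=\inf\{j\in\mathbf N : H^j_{\mathfrak m_U}(U)\text{ is not generalized nilpotent}\}\in\mathbf N\cup\{\infty\},$$ and call $U$ generalized weakly $F$-nilpotent if $H^j_{\mathfrak m_U}(U)$ is generalized nilpotent for all $j<\dim U$. Then $g_R$ and $g_S$ are finite, and $$g_T\ \ge\ g_R+g_S-1,$$ with equality if and only if $$\operatorname{nilsupp} H^{g_R}_{\mathfrak m}(R)\cap\operatorname{nilsupp} H^{g_S}_{\mathfrak n}(S)\not\subseteq\{0\}.$$ In particular, if $R$ and $S$ are generalized weakly $F$-nilpotent, then so is $T$. -/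

import Mathlib

open scoped TensorProduct

noncomputable section

namespace SegreF

universe u v w

/-! ### Modules with a Frobenius action

A Frobenius action on an `R`-module `M` is a semilinear map `ρ : M →ₛₗ[frobenius R p] M`, that is,
an additive map with `ρ (r • m) = r ^ p • ρ m`. -/

section FrobeniusActions

variable {p : ℕ} {R : Type u} [CommRing R] [ExpChar R p] {M : Type v} [AddCommGroup M] [Module R M]

theorem iterate_smul (ρ : M →ₛₗ[frobenius R p] M) (e : ℕ) (r : R) (m : M) :
    ρ^[e] (r • m) = r ^ p ^ e • ρ^[e] m := by
  induction e with
  | zero => simp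
  | succ e ih =>
    rw [Function.iterate_succ_apply', ih, map_smulₛₗ, Function.iterate_succ_apply', frobenius_def,
      ← pow_mul, ← pow_succ]

theorem iterate_eq_zero_of_le (ρ : M →ₛₗ[frobenius R p] M) {m : M} {e e' : ℕ} (h : e ≤ e')
    (hm : ρ^[e] m = 0) : ρ^[e'] m = 0 := by
  obtain ⟨d, rfl⟩ := Nat.exists_eq_add_of_le h
  rw [add_comm, Function.iterate_add_apply, hm, iterate_map_zero]

/-- The orbit closure of zero: the submodule of elements killed by some iterate of `ρ`. -/
def orbitClosureZero (ρ : M →ₛₗ[frobenius R p] M) : Submodule R M where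
  carrier := {m | ∃ e : ℕ, ρ^[e] m = 0}
  zero_mem' := ⟨0, rfl⟩
  add_mem' := by
    rintro a b ⟨e, he⟩ ⟨f, hf⟩
    refine ⟨max e f, ?_⟩
    rw [iterate_map_add, iterate_eq_zero_of_le ρ (le_max_left e f) he,
      iterate_eq_zero_of_le ρ (le_max_right e f) hf, add_zero]
  smul_mem' := by
    rintro r m ⟨e, he⟩
    exact ⟨e, by rw [iterate_smul, he, smul_zero]⟩

/-- `M` is generalized nilpotent if its quotient by the orbit closure of zero has finite length. -/
def IsGeneralizedNilpotent (ρ : M →ₛₗ[frobenius R p] M) : Prop :=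
  IsFiniteLength R (M ⧸ orbitClosureZero ρ)

/-- The nil-support: the set of degrees `n` in which `M` is not nilpotent. Here `ℳ n` is the degree
`n` part of `M`. -/
def nilSupport {k : Type w} [Semiring k] [Module k M] (ρ : M →ₛₗ[frobenius R p] M)
    (ℳ : ℤ → Submodule k M) : Set ℤ :=
  {n | ¬ ∀ m ∈ ℳ n, ∃ e : ℕ, ρ^[e] m = 0}

end FrobeniusActions

/-! ### Local cohomology through the Čech complex

For `x₁, …, xₙ ∈ R` the Čech complex has the term `∏ R_{x_{s(1)} ⋯ x_{s(j)}}` in cohomological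
degree `j`, where `s` ranges over the strictly increasing maps from `Fin j` to `Fin n`. Its `j`-th
cohomology is the local cohomology module of `R` with support in the ideal `(x₁, …, xₙ)`. -/

section Cech

variable {R : Type u} [CommRing R] {n : ℕ} (x : Fin n → R)

/-- The terms of the Čech complex. -/
abbrev CechCochain (j : ℕ) : Type u :=
  ∀ s : Fin j ↪o Fin n, Localization.Away (∏ i, x (s i))

/-- Omit the `i`-th index. -/
def face {j : ℕ} (s : Fin (j + 1) ↪o Fin n) (i : Fin (j + 1)) : Fin j ↪o Fin n :=
  (Fin.succAboveOrderEmb i).trans s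

theorem isUnit_face {j : ℕ} (s : Fin (j + 1) ↪o Fin n) (i : Fin (j + 1)) :
    IsUnit (Algebra.ofId R (Localization.Away (∏ l, x (s l))) (∏ l, x (face s i l))) := by
  have h : (∏ l, x (face s i l)) ∣ ∏ l, x (s l) := by
    rw [Fin.prod_univ_succAbove _ i]
    exact Dvd.intro_left _ rfl
  exact isUnit_of_dvd_unit (map_dvd (algebraMap R (Localization.Away (∏ l, x (s l)))) h)
    (IsLocalization.Away.algebraMap_isUnit _)

/-- The canonical map from the localization at the product with the `i`-th factor omitted to the
localization at the whole product. -/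
def cechRestrict {j : ℕ} (s : Fin (j + 1) ↪o Fin n) (i : Fin (j + 1)) :
    Localization.Away (∏ l, x (face s i l)) →ₐ[R] Localization.Away (∏ l, x (s l)) :=
  IsLocalization.Away.liftAlgHom (∏ l, x (face s i l)) (isUnit_face x s i)

/-- The Čech differential: the alternating sum of the canonical maps. -/
def cechD (j : ℕ) : CechCochain x j →ₗ[R] CechCochain x (j + 1) :=
  LinearMap.pi fun s => ∑ i : Fin (j + 1),
    (-1 : R) ^ (i : ℕ) • (cechRestrict x s i).toLinearMap ∘ₗ LinearMap.proj (face s i)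

theorem cechD_apply (j : ℕ) (c : CechCochain x j) (s : Fin (j + 1) ↪o Fin n) :
    cechD x j c s = ∑ i : Fin (j + 1), (-1 : R) ^ (i : ℕ) • cechRestrict x s i (c (face s i)) := by
  simp [cechD]

/-- The Čech cocycles. -/
abbrev cechCocycles (j : ℕ) : Submodule R (CechCochain x j) := LinearMap.ker (cechD x j)

/-- The Čech coboundaries. -/
def cechCoboundaries : ∀ j : ℕ, Submodule R (CechCochain x j)
  | 0 => ⊥
  | j + 1 => LinearMap.range (cechD x j)

/-- The `j`-th local cohomology of `R` with support in the ideal generated by the `x i`. -/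
abbrev LocalCohomology (j : ℕ) : Type u :=
  cechCocycles x j ⧸ (cechCoboundaries x j).submoduleOf (cechCocycles x j)

variable (p : ℕ)

theorem natCast_localization [CharP R p] (f : R) : (p : Localization.Away f) = 0 := by
  rw [← map_natCast (algebraMap R (Localization.Away f)) p, CharP.cast_eq_zero R p, map_zero]

variable [Fact p.Prime]

/-- The `p`-th power map, a ring homomorphism whenever `p = 0` (also on the zero ring). -/
def powHom {B : Type*} [CommRing B] (h : (p : B) = 0) : B →+* B where
  toFun b := b ^ p
  map_one' := one_pow p
  map_mul' a b := mul_pow a b p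
  map_zero' := zero_pow (Fact.out (p := p.Prime)).ne_zero
  map_add' a b := by
    obtain ⟨r, hr⟩ := exists_add_pow_prime_eq (Fact.out (p := p.Prime)) a b
    rw [hr, h, zero_mul, zero_mul, zero_mul, add_zero]

variable [CharP R p]

/-- The Frobenius endomorphism of each localization gives a Frobenius action on Čech cochains. -/
def cechFrobenius (j : ℕ) : CechCochain x j →ₛₗ[frobenius R p] CechCochain x j where
  toFun c s := c s ^ p
  map_add' c c' := by
    funext s
    exact map_add (powHom p (natCast_localization p (∏ i, x (s i)))) (c s) (c' s)
  map_smul' r c := by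
    funext s
    exact smul_pow r (c s) p

theorem cechD_frobenius (j : ℕ) (c : CechCochain x j) :
    cechD x j (cechFrobenius x p j c) = cechFrobenius x p (j + 1) (cechD x j c) := by
  funext s
  change _ = powHom p (natCast_localization p (∏ i, x (s i))) (cechD x j c s)
  rw [cechD_apply, cechD_apply, map_sum]
  refine Finset.sum_congr rfl fun i _ => ?_
  rw [Algebra.smul_def, Algebra.smul_def, map_mul, map_pow, map_neg, map_one, map_pow, map_neg,
    map_one]
  congr 1
  exact map_pow _ _ _

/-- The canonical Frobenius action on local cohomology: on a class it acts by raising each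
component of a representing cocycle to the `p`-th power. -/
def localCohomologyFrobenius (j : ℕ) :
    LocalCohomology x j →ₛₗ[frobenius R p] LocalCohomology x j :=
  Submodule.mapQ _ _
    (((cechFrobenius x p j).comp (cechCocycles x j).subtype).codRestrict (cechCocycles x j)
      fun c => by
        have hc : cechD x j c.1 = 0 := c.2
        change cechD x j (cechFrobenius x p j c.1) = 0
        rw [cechD_frobenius, hc, map_zero])
    (by
      rintro ⟨c, hc⟩ hb
      cases j with
      | zero =>
        have h0 : c = 0 := hb
        subst h0
        exact map_zero (cechFrobenius x p 0)
      | succ j =>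
        obtain ⟨b, hb'⟩ : c ∈ LinearMap.range (cechD x j) := hb
        exact ⟨cechFrobenius x p j b, by
          rw [cechD_frobenius, hb']
          rfl⟩)

/-- The generalized `F`-depth: the infimum of the `j` for which the `j`-th local cohomology is not
generalized nilpotent (`⊤` if there is none). -/
def gFDepth : ℕ∞ :=
  ⨅ (j : ℕ) (_ : ¬ IsGeneralizedNilpotent (localCohomologyFrobenius x p j)), (j : ℕ∞)

/-- `R` is generalized weakly `F`-nilpotent: every local cohomology module in a degree below
`dim R` is generalized nilpotent. -/
def IsGeneralizedWeaklyFNilpotent : Prop :=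
  ∀ j : ℕ, (j : WithBot ℕ∞) < ringKrullDim R →
    IsGeneralizedNilpotent (localCohomologyFrobenius x p j)

end Cech

/-! ### Graded rings -/

section Graded

variable {k : Type w} [Field k] {R : Type u} [CommRing R] [Algebra k R]

/-- A standard graded `k`-algebra: noetherian, with degree zero part `k`, generated in degree 1. -/
structure IsStandardGraded (𝒜 : ℕ → Submodule k R) [GradedAlgebra 𝒜] : Prop where
  isNoetherianRing : IsNoetherianRing R
  bijective_algebraMap : Function.Bijective (algebraMap k (𝒜 0))
  adjoin_eq_top : Algebra.adjoin k (𝒜 1 : Set R) = ⊤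

/-- A finite family of homogeneous elements that generates the homogeneous maximal ideal
`⨁_{n > 0} 𝒜 n`. -/
structure GeneratesMaximalIdeal (𝒜 : ℕ → Submodule k R) [GradedAlgebra 𝒜] {n : ℕ}
    (x : Fin n → R) : Prop where
  isHomogeneous : ∀ i, SetLike.IsHomogeneousElem 𝒜 (x i)
  span_eq : Ideal.span (Set.range x) = (HomogeneousIdeal.irrelevant 𝒜).toIdeal

/-- The depth of the graded ring: the supremum of the lengths of the regular sequences in the
homogeneous maximal ideal. -/
def gradedDepth (𝒜 : ℕ → Submodule k R) [GradedAlgebra 𝒜] : ℕ∞ :=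
  ⨆ (rs : List R) (_ : RingTheory.Sequence.IsRegular R rs ∧
    ∀ r ∈ rs, r ∈ (HomogeneousIdeal.irrelevant 𝒜).toIdeal), (rs.length : ℕ∞)

/-- The degree `d` part of the localization `R_f` for `f` homogeneous: it is spanned by the
fractions `a / b` with `a` homogeneous, `b` a power of `f`, and `deg a - deg b = d`. -/
def localizationDegree (𝒜 : ℕ → Submodule k R) (f : R) (d : ℤ) :
    Submodule k (Localization.Away f) :=
  Submodule.span k {z | ∃ (i l : ℕ) (a : R) (b : Submonoid.powers f),
    a ∈ 𝒜 i ∧ (b : R) ∈ 𝒜 l ∧ (i : ℤ) - l = d ∧ z = Localization.mk a b}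

/-- The degree `d` part of the Čech complex. -/
def cechDegree (𝒜 : ℕ → Submodule k R) {n : ℕ} (x : Fin n → R) (j : ℕ) (d : ℤ) :
    Submodule k (CechCochain x j) :=
  Submodule.pi Set.univ fun s => localizationDegree 𝒜 (∏ i, x (s i)) d

/-- The degree `d` part of local cohomology: the classes of the cocycles of degree `d`. -/
def localCohomologyDegree (𝒜 : ℕ → Submodule k R) {n : ℕ} (x : Fin n → R) (j : ℕ) (d : ℤ) :
    Submodule k (LocalCohomology x j) :=
  ((cechDegree 𝒜 x j d).comap ((cechCocycles x j).subtype.restrictScalars k)).map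
    (((cechCoboundaries x j).submoduleOf (cechCocycles x j)).mkQ.restrictScalars k)

/-- The nil-support of the `j`-th local cohomology module of a graded ring. -/
def nilSupportLocalCohomology (p : ℕ) [Fact p.Prime] [CharP R p] (𝒜 : ℕ → Submodule k R) {n : ℕ}
    (x : Fin n → R) (j : ℕ) : Set ℤ :=
  nilSupport (localCohomologyFrobenius x p j) (localCohomologyDegree 𝒜 x j)

end Graded

/-! ### Segre products -/

section Segre

variable {k : Type w} [Field k] {R : Type u} {S : Type v} [CommRing R] [CommRing S] [Algebra k R]
  [Algebra k S] (𝒜 : ℕ → Submodule k R) (ℬ : ℕ → Submodule k S)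

/-- `𝒜 n ⊗ ℬ n`, as a subspace of `R ⊗ S`. -/
def segrePiece (n : ℕ) : Submodule k (R ⊗[k] S) :=
  LinearMap.range (TensorProduct.map (𝒜 n).subtype (ℬ n).subtype)

theorem segrePiece_eq_span (n : ℕ) :
    segrePiece 𝒜 ℬ n = Submodule.span k {t | ∃ a ∈ 𝒜 n, ∃ b ∈ ℬ n, a ⊗ₜ[k] b = t} := by
  rw [segrePiece, TensorProduct.range_map]
  apply le_antisymm
  · rw [Submodule.map₂_le]
    rintro a ⟨a, rfl⟩ b ⟨b, rfl⟩
    exact Submodule.subset_span ⟨a, a.2, b, b.2, rfl⟩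
  · rw [Submodule.span_le]
    rintro _ ⟨a, ha, b, hb, rfl⟩
    exact Submodule.apply_mem_map₂ _ ⟨⟨a, ha⟩, rfl⟩ ⟨⟨b, hb⟩, rfl⟩

variable [GradedAlgebra 𝒜] [GradedAlgebra ℬ]

instance segrePiece_gradedMonoid : SetLike.GradedMonoid (segrePiece 𝒜 ℬ) where
  one_mem := by
    rw [segrePiece_eq_span]
    exact Submodule.subset_span ⟨1, SetLike.one_mem_graded 𝒜, 1, SetLike.one_mem_graded ℬ, rfl⟩
  mul_mem := by
    intro m n s t hs ht
    have h : segrePiece 𝒜 ℬ m * segrePiece 𝒜 ℬ n ≤ segrePiece 𝒜 ℬ (m + n) := by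
      simp only [segrePiece_eq_span]
      rw [Submodule.span_mul_span, Submodule.span_le]
      rintro _ ⟨_, ⟨a, ha, b, hb, rfl⟩, _, ⟨a', ha', b', hb', rfl⟩, rfl⟩
      exact Submodule.subset_span ⟨a * a', SetLike.mul_mem_graded ha ha', b * b',
        SetLike.mul_mem_graded hb hb', (Algebra.TensorProduct.tmul_mul_tmul _ _ _ _).symm⟩
    exact h (Submodule.mul_mem_mul hs ht)

/-- The Segre product `R # S = ⨁ₙ 𝒜 n ⊗ ℬ n`, as a subalgebra of `R ⊗ S`. -/
def segreProduct : Subalgebra k (R ⊗[k] S) :=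
  (DirectSum.coeAlgHom (segrePiece 𝒜 ℬ)).range

/-- The grading of the Segre product, with `𝒜 n ⊗ ℬ n` in degree `n`. -/
def segreGrading (n : ℕ) : Submodule k (segreProduct 𝒜 ℬ) :=
  (segrePiece 𝒜 ℬ n).comap (segreProduct 𝒜 ℬ).val.toLinearMap

instance segreGrading_gradedMonoid : SetLike.GradedMonoid (segreGrading 𝒜 ℬ) where
  one_mem := SetLike.one_mem_graded (segrePiece 𝒜 ℬ)
  mul_mem := fun _ _ _ _ hs ht => SetLike.mul_mem_graded (A := segrePiece 𝒜 ℬ) hs ht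

/-- The projection of `R ⊗ S` onto `𝒜 n ⊗ ℬ n`. -/
def segreProj (n : ℕ) : R ⊗[k] S →ₗ[k] R ⊗[k] S :=
  TensorProduct.map (GradedAlgebra.proj 𝒜 n) (GradedAlgebra.proj ℬ n)

theorem segreProj_of_mem {m : ℕ} (n : ℕ) {t : R ⊗[k] S} (ht : t ∈ segrePiece 𝒜 ℬ m) :
    segreProj 𝒜 ℬ n t = if m = n then t else 0 := by
  rw [segrePiece_eq_span] at ht
  induction ht using Submodule.span_induction with
  | mem t ht =>
    obtain ⟨a, ha, b, hb, rfl⟩ := ht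
    rw [segreProj, TensorProduct.map_tmul, GradedAlgebra.proj_apply, GradedAlgebra.proj_apply]
    split_ifs with h
    · subst h
      rw [DirectSum.decompose_of_mem_same _ ha, DirectSum.decompose_of_mem_same _ hb]
    · rw [DirectSum.decompose_of_mem_ne _ ha h, TensorProduct.zero_tmul]
  | zero => simp
  | add s t _ _ hs ht =>
    rw [map_add, hs, ht]
    split_ifs <;> simp
  | smul c t _ ht =>
    rw [map_smul, ht]
    split_ifs <;> simp

theorem segrePiece_le (n : ℕ) :
    segrePiece 𝒜 ℬ n ≤ Subalgebra.toSubmodule (segreProduct 𝒜 ℬ) := fun t ht =>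
  ⟨DirectSum.of (fun i => segrePiece 𝒜 ℬ i) n ⟨t, ht⟩, DirectSum.coeAlgHom_of _ n ⟨t, ht⟩⟩

theorem segreGrading_isInternal : DirectSum.IsInternal (segreGrading 𝒜 ℬ) := by
  constructor
  · intro t t' ht
    refine DFinsupp.ext fun n => ?_
    have key : ∀ u : DirectSum ℕ fun i => segreGrading 𝒜 ℬ i,
        segreProj 𝒜 ℬ n (DirectSum.coeAddMonoidHom (segreGrading 𝒜 ℬ) u : segreProduct 𝒜 ℬ) =
          ((u n : segreProduct 𝒜 ℬ) : R ⊗[k] S) := by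
      intro u
      induction u using DirectSum.induction_on with
      | zero => simp
      | of i v =>
        have hv : ((v : segreProduct 𝒜 ℬ) : R ⊗[k] S) ∈ segrePiece 𝒜 ℬ i := v.2
        rw [DirectSum.coeAddMonoidHom_of, segreProj_of_mem 𝒜 ℬ n hv]
        split_ifs with h
        · subst h
          rw [DirectSum.of_eq_same]
        · rw [DirectSum.of_eq_of_ne _ _ _ (Ne.symm h)]
          rfl
      | add u v hu hv =>
        rw [map_add, Subalgebra.coe_add, map_add, hu, hv]
        rfl
    have h := key t
    rw [ht, key t'] at h
    exact Subtype.ext (Subtype.ext h.symm)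
  · rintro ⟨_, t, rfl⟩
    induction t using DirectSum.induction_on with
    | zero => exact ⟨0, by ext; simp⟩
    | of i v =>
      refine ⟨DirectSum.of (fun i => segreGrading 𝒜 ℬ i) i
        ⟨⟨v.1, segrePiece_le 𝒜 ℬ i v.2⟩, v.2⟩, ?_⟩
      rw [DirectSum.coeAddMonoidHom_of]
      exact Subtype.ext (DirectSum.coeAlgHom_of _ i v).symm
    | add u v hu hv =>
      obtain ⟨a, ha⟩ := hu
      obtain ⟨b, hb⟩ := hv
      refine ⟨a + b, ?_⟩
      rw [map_add, ha, hb]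
      exact Subtype.ext (map_add (DirectSum.coeAlgHom (segrePiece 𝒜 ℬ)) u v).symm

/-- The Segre product is a graded `k`-algebra. -/
instance segreGradedAlgebra : GradedAlgebra (segreGrading 𝒜 ℬ) where
  toGradedMonoid := segreGrading_gradedMonoid 𝒜 ℬ
  toDecomposition := (segreGrading_isInternal 𝒜 ℬ).chooseDecomposition

/-- The Segre product of rings of characteristic `p` has characteristic `p`. -/
instance segreProduct_charP (p : ℕ) [Fact p.Prime] [CharP R p] [CharP S p] :
    CharP (segreProduct 𝒜 ℬ) p := by
  have : Nontrivial R := CharP.nontrivial_of_char_ne_one (Fact.out (p := p.Prime)).ne_one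
  have : Nontrivial S := CharP.nontrivial_of_char_ne_one (Fact.out (p := p.Prime)).ne_one
  have : CharP k p :=
    (RingHom.charP_iff (algebraMap k R) (algebraMap k R).injective p).mpr inferInstance
  have : Nontrivial (R ⊗[k] S) := inferInstance
  exact charP_of_injective_algebraMap (algebraMap k (segreProduct 𝒜 ℬ)).injective p

end Segre

end SegreF

end

/-! Nilpotence can be tested on homogeneous cocycles, and only negative degrees matter. Frobenius
multiplies degrees by `p`, and local cohomology vanishes in large degrees and is finite-dimensional
in each degree (`relCocycles_finite`). So classes of positive degree are nilpotent and degree `0`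
contributes finite length. A non-nilpotent class of negative degree has iterates in degrees tending
to `-∞`, all non-nilpotent, which is impossible in a noetherian quotient. Hence generalized
nilpotence means that the nil-support has no negative element (`isGeneralizedNilpotent_iff`).

In degree `n < 0` there is a Künneth formula: `[H^j(T)]_n` is the direct sum of `[H^a(R)]_n ⊗
[H^b(S)]_n` over `a + b = j + 1`. The further summands of the general formula, with a factor `[R]_n`
or `[S]_n`, vanish. The formula is compatible with Frobenius, and over a field a tensor of two
classes is nilpotent exactly when one of them is. So the negative nil-support of `H^j(T)` is the
union over `a + b = j + 1` of the intersections of those of `H^a(R)` and `H^b(S)`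
(`mem_nilSupport_segreProduct_iff`). The inequality and the criterion for equality are then
arithmetic of minimal indices.

For the Künneth formula, the families `x i ⊗ 1`, `1 ⊗ y j` and `z l` are put into one Čech complex
of `R ⊗ S`, indexed by the finite subsets of the union of the three index sets. In the spectrum of
`R ⊗ S` the open set `D(z)` is `D(x) ∩ D(y)`, and `nilDeg_chain` compares the corresponding
subquotients of this complex. One end is the Čech complex of `T` in diagonal degrees
(`nilDeg_subring_iff`), the other the tensor product of the complexes of `R` and `S`
(`nilDeg_tensor_iff`). No isomorphism of cohomology is constructed: the predicate `NilDeg`, that all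
relative cocycles of a bidegree are nilpotent, is carried from one pair of subcomplexes to the next.

Finiteness of `g_R` and `g_S` is `exists_not_nilDeg`. If the cohomology of `R / J` is nilpotent in
negative degrees, so is that of `R / (J + x R)` for each generator `x` (`NilNeg.sup_span`). At the
last stage the class of `1 / x` in `H^1` contradicts this unless the punctured spectrum is empty
(`NilNeg.mem_radical`). Going back, all generators would be nilpotent, but positive depth provides a
nonzerodivisor in the maximal ideal.

The last assertion also needs `dim T + 1 ≤ dim R + dim S`. A nonzerodivisor `r` in the maximal ideal
of `R` is transcendental over `T` inside `R ⊗ S`, because its powers lie off the diagonal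
(`injective_aeval_tmul_one`); transcendence degrees give the inequality. -/

noncomputable section

namespace SegreF

universe u v w

set_option linter.unusedSectionVars false

/-! ### The extended Čech complex indexed by all finite subsets -/

section Cochains

variable {U : Type u} [CommRing U] {ι : Type v} [LinearOrder ι] (f : ι → U)

/-- The localization of `U` at the product of the `f i`, `i ∈ s`. -/
abbrev Loc (s : Finset ι) : Type u := Localization.Away (∏ i ∈ s, f i)

theorem isUnit_algebraMap_loc {s t : Finset ι} (h : s ⊆ t) :
    IsUnit (algebraMap U (Loc f t) (∏ i ∈ s, f i)) :=
  isUnit_of_dvd_unit (map_dvd _ (Finset.prod_dvd_prod_of_subset _ _ _ h))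
    (IsLocalization.Away.algebraMap_isUnit _)

theorem isUnit_algebraMap_loc_of_mem {i : ι} {t : Finset ι} (h : i ∈ t) :
    IsUnit (algebraMap U (Loc f t) (f i)) := by
  simpa using isUnit_algebraMap_loc f (Finset.singleton_subset_iff.mpr h)

/-- The canonical map between localizations. -/
def res {s t : Finset ι} (h : s ⊆ t) : Loc f s →ₐ[U] Loc f t :=
  IsLocalization.Away.liftAlgHom (f := Algebra.ofId U (Loc f t)) (∏ i ∈ s, f i)
    (isUnit_algebraMap_loc f h)

variable {f}

theorem loc_algHom_ext {s : Finset ι} {B : Type*} [Semiring B] [Algebra U B]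
    (g h : Loc f s →ₐ[U] B) : g = h :=
  IsLocalization.algHom_ext (Submonoid.powers (∏ i ∈ s, f i)) (by ext)

theorem res_res {s t r : Finset ι} (h : s ⊆ t) (h' : t ⊆ r) (a : Loc f s) :
    res f h' (res f h a) = res f (h.trans h') a :=
  DFunLike.congr_fun (loc_algHom_ext ((res f h').comp (res f h)) (res f (h.trans h'))) a

theorem res_self {s : Finset ι} (h : s ⊆ s) (a : Loc f s) : res f h a = a :=
  DFunLike.congr_fun (loc_algHom_ext (res f h) (AlgHom.id U _)) a

theorem res_congr (c : ∀ s, Loc f s) {s s' t : Finset ι} (e : s = s') (h : s ⊆ t) (h' : s' ⊆ t) :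
    res f h (c s) = res f h' (c s') := by
  subst e; rfl

theorem exists_mul_eq_algebraMap {s : Finset ι} (a : Loc f s) :
    ∃ (m : ℕ) (r : U), a * algebraMap U _ (∏ i ∈ s, f i) ^ m = algebraMap U _ r :=
  IsLocalization.Away.surj (∏ i ∈ s, f i) a

theorem exists_mul_eq_algebraMap_of_mem_map {s : Finset ι} {I : Ideal U} {a : Loc f s}
    (ha : a ∈ I.map (algebraMap U (Loc f s))) :
    ∃ (m : ℕ), ∃ r ∈ I, a * algebraMap U _ (∏ i ∈ s, f i) ^ m = algebraMap U _ r := by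
  rw [IsLocalization.mem_map_algebraMap_iff (Submonoid.powers (∏ i ∈ s, f i))] at ha
  obtain ⟨⟨r, ⟨_, m, rfl⟩⟩, h⟩ := ha
  exact ⟨m, r.1, r.2, by simpa using h⟩

theorem algebraMap_mem_map_iff {s : Finset ι} {I : Ideal U} {r : U} :
    algebraMap U (Loc f s) r ∈ I.map (algebraMap U (Loc f s)) ↔
      ∃ m : ℕ, (∏ i ∈ s, f i) ^ m * r ∈ I := by
  rw [IsLocalization.algebraMap_mem_map_algebraMap_iff (Submonoid.powers (∏ i ∈ s, f i))]
  constructor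
  · rintro ⟨_, ⟨m, rfl⟩, h⟩
    exact ⟨m, h⟩
  · rintro ⟨m, h⟩
    exact ⟨_, ⟨m, rfl⟩, h⟩

theorem mem_ideal_of_mul_isUnit {B : Type*} [CommRing B] {I : Ideal B} {a b : B} (hb : IsUnit b)
    (h : a * b ∈ I) : a ∈ I := by
  obtain ⟨b, rfl⟩ := hb
  simpa [mul_assoc] using I.mul_mem_right (↑b⁻¹) h

/-- Clearing one denominator. -/
theorem exists_pow_smul_eq_res {s : Finset ι} {i : ι} (hi : i ∉ s) (h : s ⊆ insert i s)
    {I : Ideal U} {b : Loc f (insert i s)} (hb : b ∈ I.map (algebraMap U _)) :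
    ∃ (m : ℕ), ∃ a ∈ I.map (algebraMap U (Loc f s)), f i ^ m • b = res f h a := by
  obtain ⟨m, r, hr, hbr⟩ := exists_mul_eq_algebraMap_of_mem_map hb
  obtain ⟨u, hu⟩ := (isUnit_algebraMap_loc f (Finset.Subset.refl s)).pow m
  refine ⟨m, algebraMap U _ r * ↑u⁻¹, Ideal.mul_mem_right _ _ (Ideal.mem_map_of_mem _ hr), ?_⟩
  have hu' : IsUnit (res f h (u : Loc f s)) := u.isUnit.map _
  have hp : algebraMap U (Loc f (insert i s)) (∏ j ∈ insert i s, f j) =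
      algebraMap U _ (f i) * algebraMap U _ (∏ j ∈ s, f j) := by
    rw [← map_mul]
    exact congrArg _ (Finset.prod_insert hi)
  rw [hp] at hbr
  rw [← hu'.mul_left_inj, ← map_mul, mul_assoc, Units.inv_mul, mul_one, AlgHom.commutes, ← hbr, hu,
    map_pow, AlgHom.commutes, mul_pow, Algebra.smul_def, map_pow]
  ring

/-- Passing to `insert i s` inverts `f i`, so what becomes zero modulo `J` is `f i`-power torsion
modulo `J`. -/
theorem exists_pow_smul_mem {s : Finset ι} {i : ι} (hi : i ∉ s) (h : s ⊆ insert i s)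
    {J : Ideal U} {a : Loc f s} (ha : res f h a ∈ J.map (algebraMap U _)) :
    ∃ m : ℕ, f i ^ m • a ∈ J.map (algebraMap U (Loc f s)) := by
  obtain ⟨m, r, har⟩ := exists_mul_eq_algebraMap a
  have h1 : algebraMap U (Loc f (insert i s)) r ∈ J.map (algebraMap U _) := by
    rw [← (res f h).commutes, ← har, map_mul]
    exact Ideal.mul_mem_right _ _ ha
  obtain ⟨l, hl⟩ := algebraMap_mem_map_iff.mp h1
  refine ⟨l, mem_ideal_of_mul_isUnit
    ((isUnit_algebraMap_loc f (Finset.Subset.refl s)).pow m) ?_⟩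
  rw [smul_mul_assoc, har]
  refine mem_ideal_of_mul_isUnit ((isUnit_algebraMap_loc f (Finset.Subset.refl s)).pow l) ?_
  rw [Algebra.smul_def, ← map_pow, ← map_mul, ← map_mul]
  refine Ideal.mem_map_of_mem _ ?_
  convert hl using 1
  rw [Finset.prod_insert hi]
  ring

variable (f)

/-- Families of elements of all the localizations. -/
abbrev Cochain : Type max u v := ∀ s : Finset ι, Loc f s

/-- The sign with which the restriction omitting `i` enters into the differential. -/
def sgn (i : ι) (s : Finset ι) : ℤ := if i ∈ s then (-1) ^ (s.filter (· < i)).card else 0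

theorem sgn_of_notMem {i : ι} {s : Finset ι} (h : i ∉ s) : sgn i s = 0 := if_neg h

theorem sgn_mul_self {i : ι} {s : Finset ι} (h : i ∈ s) : sgn i s * sgn i s = 1 := by
  rw [sgn, if_pos h, ← mul_pow]; simp

/-- Erasing the smaller index shifts the position of the larger one by one; erasing the larger one
leaves the position of the smaller unchanged. -/
theorem sgn_mul_sgn_of_lt {i j : ι} (hij : i < j) (s : Finset ι) :
    sgn i s * sgn j (s.erase i) = -(sgn j s * sgn i (s.erase j)) := by
  by_cases hi : i ∈ s
  swap
  · rw [sgn_of_notMem hi, sgn_of_notMem fun h => hi (Finset.mem_of_mem_erase h)]; simp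
  by_cases hj : j ∈ s
  swap
  · rw [sgn_of_notMem hj, sgn_of_notMem fun h => hj (Finset.mem_of_mem_erase h)]; simp
  have h1 : (s.erase j).filter (· < i) = s.filter (· < i) := by
    ext a
    simp only [Finset.mem_filter, Finset.mem_erase]
    constructor
    · tauto
    · rintro ⟨ha, hai⟩
      exact ⟨⟨(hai.trans hij).ne, ha⟩, hai⟩
  have h2 : (s.filter (· < j)).card = ((s.erase i).filter (· < j)).card + 1 := by
    rw [Finset.filter_erase, Finset.card_erase_add_one]
    simp [hi, hij]
  rw [sgn, sgn, sgn, sgn, if_pos hi, if_pos hj, if_pos (by simp [hj, hij.ne']),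
    if_pos (by simp [hi, hij.ne]), h1, h2, pow_succ]
  ring

theorem sgn_mul_sgn {i j : ι} (hij : i ≠ j) (s : Finset ι) :
    sgn i s * sgn j (s.erase i) = -(sgn j s * sgn i (s.erase j)) := by
  rcases lt_or_gt_of_ne hij with h | h
  · exact sgn_mul_sgn_of_lt h s
  · rw [sgn_mul_sgn_of_lt h s, neg_neg]

variable [Fintype ι]

/-- The differential of the Čech complex. -/
def cDiff : Cochain f →ₗ[U] Cochain f where
  toFun c s := ∑ i, (sgn i s : Loc f s) * res f (Finset.erase_subset i s) (c (s.erase i))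
  map_add' c c' := by
    funext s
    simp [mul_add, Finset.sum_add_distrib]
  map_smul' r c := by
    funext s
    simp only [Pi.smul_apply, map_smul, RingHom.id_apply, Finset.smul_sum]
    exact Finset.sum_congr rfl fun i _ => mul_smul_comm _ _ _

variable {f}

theorem cDiff_apply (c : Cochain f) (s : Finset ι) :
    cDiff f c s = ∑ i, (sgn i s : Loc f s) * res f (Finset.erase_subset i s) (c (s.erase i)) := rfl

theorem cDiff_cDiff (c : Cochain f) : cDiff f (cDiff f c) = 0 := by
  funext s
  simp only [cDiff_apply, map_sum, map_mul, map_intCast, Finset.mul_sum, ← mul_assoc, res_res,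
    Pi.zero_apply, ← Int.cast_mul]
  rw [← Finset.sum_product' (f := fun i j => ((sgn i s * sgn j (s.erase i) : ℤ) : Loc f s) *
    res f (((Finset.erase_subset j (s.erase i)).trans (Finset.erase_subset i s)))
      (c ((s.erase i).erase j)))]
  -- Interchanging the two erased indices pairs off terms of opposite sign. Diagonal terms are zero
  -- since `sgn` vanishes at an index outside the set.
  refine Finset.sum_involution (fun x _ => (x.2, x.1)) ?_ ?_ (by simp) (by simp)
  · rintro ⟨i, j⟩ -
    by_cases hij : i = j
    · subst hij
      simp [sgn_of_notMem (Finset.notMem_erase i s)]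
    · dsimp only
      rw [sgn_mul_sgn hij, Int.cast_neg, neg_mul, res_congr c (Finset.erase_right_comm (a := i) (b := j))
        _ ((Finset.erase_subset i (s.erase j)).trans (Finset.erase_subset j s)), neg_add_cancel]
  · rintro ⟨i, j⟩ - h
    contrapose! h
    obtain rfl : j = i := congrArg Prod.fst h
    simp [sgn_of_notMem (Finset.notMem_erase j s)]

end Cochains

/-! ### Subcomplexes of cochains and acyclic pairs -/

section Families

variable {U : Type u} [CommRing U] {ι : Type v} [LinearOrder ι] (f : ι → U)

/-- A family of ideals in the localizations that is stable under the canonical maps. -/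
structure Fam where
  ideal : ∀ s : Finset ι, Ideal (Loc f s)
  res_mem : ∀ {s t : Finset ι} (h : s ⊆ t) {a : Loc f s}, a ∈ ideal s → res f h a ∈ ideal t

variable {f}

/-- The cochains with components in a family of ideals. -/
def Fam.sec (N : Fam f) : Submodule U (Cochain f) where
  carrier := {c | ∀ s, c s ∈ N.ideal s}
  add_mem' ha hb s := (N.ideal s).add_mem (ha s) (hb s)
  zero_mem' s := (N.ideal s).zero_mem
  smul_mem' r c hc s := by
    rw [Pi.smul_apply, Algebra.smul_def]
    exact (N.ideal s).mul_mem_left _ (hc s)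

/-- The extensions of an ideal to all the localizations. -/
def idealFam (f : ι → U) (I : Ideal U) : Fam f where
  ideal s := I.map (algebraMap U (Loc f s))
  res_mem {s t} h a ha := by
    have := Ideal.mem_map_of_mem (res f h).toRingHom ha
    rw [Ideal.map_map] at this
    have e : (res f h).toRingHom.comp (algebraMap U (Loc f s)) = algebraMap U (Loc f t) :=
      AlgHom.comp_algebraMap (res f h)
    rwa [e] at this

/-- The cochains supported on a set of indices closed under enlargement. -/
def suppFam (f : ι → U) (P : Finset ι → Prop) (hP : ∀ {s t}, s ⊆ t → P s → P t) : Fam f where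
  ideal s := {
    carrier := {a | ¬ P s → a = 0}
    add_mem' := fun ha hb h => by rw [ha h, hb h, add_zero]
    zero_mem' := fun _ => rfl
    smul_mem' := fun c a ha h => by rw [ha h, smul_zero] }
  res_mem {s t} h a ha ht := by rw [ha fun hs => ht (hP h hs), map_zero]

variable [Fintype ι]

theorem Fam.cDiff_mem {N : Fam f} {c : Cochain f} (hc : c ∈ N.sec) : cDiff f c ∈ N.sec := fun s =>
  sum_mem fun _ _ => Ideal.mul_mem_left _ _ (N.res_mem _ (hc _))

/-- The coboundaries of a pair of families. -/
def bd (N N' : Fam f) : Submodule U (Cochain f) := N.sec.map (cDiff f) ⊔ N'.sec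

theorem mem_bd {N N' : Fam f} {c : Cochain f} :
    c ∈ bd N N' ↔ ∃ b ∈ N.sec, ∃ a ∈ N'.sec, cDiff f b + a = c := by
  simp [bd, Submodule.mem_sup]

/-- The relative cohomology of a pair of families vanishes. -/
def Acyclic (N N' : Fam f) : Prop := ∀ c ∈ N.sec, cDiff f c ∈ N'.sec → c ∈ bd N N'

/-- This is the exact cohomology sequence of the filtration `N'' ≤ N' ≤ N`, on the level of
cochains. -/
theorem Acyclic.trans {N N' N'' : Fam f} (h : N'.sec ≤ N.sec) (h' : N''.sec ≤ N'.sec)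
    (h1 : Acyclic N N') (h2 : Acyclic N' N'') : Acyclic N N'' := by
  intro c hc hdc
  obtain ⟨b, hb, a, ha, rfl⟩ := mem_bd.mp (h1 c hc (h' hdc))
  rw [map_add, cDiff_cDiff, zero_add] at hdc
  obtain ⟨b', hb', a', ha', rfl⟩ := mem_bd.mp (h2 a ha hdc)
  exact mem_bd.mpr ⟨b + b', add_mem hb (h hb'), a', ha', by rw [map_add, add_assoc]⟩

/-- The condition under which relative cohomology is `f i`-power torsion. -/
structure Toggle (i : ι) (N N' : Fam f) : Prop where
  lift : ∀ {s : Finset ι}, i ∉ s → ∀ (h : s ⊆ insert i s), ∀ b ∈ N.ideal (insert i s),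
    ∃ m : ℕ, ∃ a ∈ N.ideal s, f i ^ m • b - res f h a ∈ N'.ideal (insert i s)
  torsion : ∀ {s : Finset ι}, i ∉ s → ∀ (h : s ⊆ insert i s), ∀ a ∈ N.ideal s,
    res f h a ∈ N'.ideal (insert i s) → ∃ m : ℕ, f i ^ m • a ∈ N'.ideal s

theorem Fam.smul_mem (N : Fam f) {s : Finset ι} (r : U) {a : Loc f s} (ha : a ∈ N.ideal s) :
    r • a ∈ N.ideal s := by
  rw [Algebra.smul_def]; exact Ideal.mul_mem_left _ _ ha

/-- The relative complex is the mapping cone of the restrictions from `s` to `insert i s`, for `i ∉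
s`. By `Toggle` these have `f i`-power torsion kernel and cokernel modulo `N'`, so the cohomology of
the cone is `f i`-power torsion. There are finitely many sets, hence uniform exponents. -/
theorem Toggle.exists_pow_smul_mem_bd {i : ι} {N N' : Fam f} (hT : Toggle i N N')
    {c : Cochain f} (hc : c ∈ N.sec) (hdc : cDiff f c ∈ N'.sec) :
    ∃ m : ℕ, f i ^ m • c ∈ bd N N' := by
  classical
  have key : ∀ s : Finset ι, ∃ m : ℕ, ∃ a ∈ N.ideal s, i ∉ s → ∀ m', m ≤ m' →
      ∀ t (_ : t = insert i s) (h : s ⊆ t),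
        f i ^ m' • c t - res f h (f i ^ (m' - m) • a) ∈ N'.ideal t := by
    intro s
    by_cases hi : i ∈ s
    · exact ⟨0, 0, zero_mem _, fun h => absurd hi h⟩
    obtain ⟨m, a, ha, h⟩ := hT.lift hi (Finset.subset_insert i s) _ (hc (insert i s))
    refine ⟨m, a, ha, ?_⟩
    rintro - m' hm t rfl hs
    rw [map_smul, ← Nat.sub_add_cancel hm, pow_add, mul_smul, Nat.add_sub_cancel, ← smul_sub]
    exact N'.smul_mem _ h
  choose m a ha hma using key
  set m₁ := Finset.univ.sup m with hm₁
  -- The homotopy moves the component at `insert i s` down to `s`. At a set containing `i` only the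
  -- term erasing `i` survives in its differential, and that term is `f i ^ m₁ • c` modulo `N'`.
  let b : Cochain f := fun s => if i ∈ s then 0 else (sgn i (insert i s) : Loc f s) * f i ^ (m₁ - m s) • a s
  have hb : b ∈ N.sec := by
    intro s
    by_cases hi : i ∈ s
    · simp [b, hi]
    · simp only [b, hi, if_false]
      exact Ideal.mul_mem_left _ _ (N.smul_mem _ (ha s))
  have hbi : ∀ s, i ∈ s → b s = 0 := fun s hs => if_pos hs
  set e : Cochain f := f i ^ m₁ • c - cDiff f b with he
  have heN : e ∈ N.sec := sub_mem (Submodule.smul_mem _ _ hc) (Fam.cDiff_mem hb)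
  have hei : ∀ t, i ∈ t → e t ∈ N'.ideal t := by
    intro t ht
    have h1 : cDiff f b t = res f (Finset.erase_subset i t)
        (f i ^ (m₁ - m (t.erase i)) • a (t.erase i)) := by
      rw [cDiff_apply, Finset.sum_eq_single i]
      · simp only [b, Finset.notMem_erase, if_false, Finset.insert_erase ht, map_mul, map_intCast,
          ← mul_assoc, ← Int.cast_mul, sgn_mul_self ht, Int.cast_one, one_mul]
      · intro j _ hj
        rw [hbi _ (by simp [ht, hj.symm]), map_zero, mul_zero]
      · simp
    rw [he, Pi.sub_apply, h1]
    exact hma _ (Finset.notMem_erase i t) m₁ (Finset.le_sup (Finset.mem_univ _)) t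
      (Finset.insert_erase ht).symm _
  have hde : cDiff f e ∈ N'.sec := by
    rw [he, map_sub, cDiff_cDiff, sub_zero, map_smul]
    exact Submodule.smul_mem _ _ hdc
  have key2 : ∀ s : Finset ι, ∃ l : ℕ, ∀ l', l ≤ l' → f i ^ l' • e s ∈ N'.ideal s := by
    intro s
    by_cases hi : i ∈ s
    · exact ⟨0, fun l' _ => N'.smul_mem _ (hei s hi)⟩
    -- In the component of `cDiff f e` at `insert i s`, every term except the one erasing `i` comes
    -- from a set containing `i`, where `e` is already in `N'`.
    have h1 : res f (Finset.subset_insert i s) (e s) ∈ N'.ideal (insert i s) := by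
      have h2 := hde (insert i s)
      rw [cDiff_apply, ← Finset.add_sum_erase _ _ (Finset.mem_univ i)] at h2
      have h3 : ∑ j ∈ Finset.univ.erase i, (sgn j (insert i s) : Loc f (insert i s)) *
          res f (Finset.erase_subset j (insert i s)) (e ((insert i s).erase j)) ∈
            N'.ideal (insert i s) := by
        refine sum_mem fun j hj => Ideal.mul_mem_left _ _ (N'.res_mem _ (hei _ ?_))
        simp [(Finset.ne_of_mem_erase hj).symm]
      have h4 := Ideal.mul_mem_left _ (sgn i (insert i s) : Loc f (insert i s))
        ((Ideal.add_mem_iff_left _ h3).mp h2)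
      rw [← mul_assoc, ← Int.cast_mul, sgn_mul_self (Finset.mem_insert_self i s), Int.cast_one,
        one_mul] at h4
      rwa [res_congr e (Finset.erase_insert hi) _ (Finset.subset_insert i s)] at h4
    obtain ⟨l, hl⟩ := hT.torsion hi (Finset.subset_insert i s) _ (heN s) h1
    refine ⟨l, fun l' h => ?_⟩
    rw [← Nat.sub_add_cancel h, pow_add, mul_smul]
    exact N'.smul_mem _ hl
  choose l hl using key2
  set l₁ := Finset.univ.sup l
  have h5 : f i ^ l₁ • e ∈ N'.sec := fun s => hl s l₁ (Finset.le_sup (Finset.mem_univ _))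
  refine ⟨l₁ + m₁, mem_bd.mpr ⟨f i ^ l₁ • b, Submodule.smul_mem _ _ hb, _, h5, ?_⟩⟩
  rw [he, map_smul, smul_sub, add_sub_cancel, smul_smul, pow_add]

theorem toggle_idealFam (i : ι) (I J : Ideal U) : Toggle i (idealFam f I) (idealFam f J) where
  lift hi h b hb := by
    obtain ⟨m, a, ha, hab⟩ := exists_pow_smul_eq_res hi h hb
    exact ⟨m, a, ha, by rw [hab, sub_self]; exact zero_mem _⟩
  torsion hi h a _ hra := exists_pow_smul_mem hi h hra

/-- If the difference of the supports is insensitive to `i`, the quotient has at `s` and `insert i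
s` either both full localizations or zero both times. -/
theorem toggle_suppFam (i : ι) {P P' : Finset ι → Prop} {hP : ∀ {s t}, s ⊆ t → P s → P t}
    {hP' : ∀ {s t}, s ⊆ t → P' s → P' t}
    (hinv : ∀ s, i ∉ s → ((P (insert i s) ∧ ¬ P' (insert i s)) ↔ (P s ∧ ¬ P' s))) :
    Toggle i (suppFam f P hP) (suppFam f P' hP') where
  lift {s} hi h b hb := by
    by_cases hp : P (insert i s) ∧ ¬ P' (insert i s)
    · obtain ⟨m, a, -, hab⟩ := exists_pow_smul_eq_res (I := ⊤) hi h (b := b) (by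
        rw [Ideal.map_top]; trivial)
      exact ⟨m, a, fun hn => absurd ((hinv s hi).mp hp).1 hn, by
        rw [hab, sub_self]; exact zero_mem _⟩
    · refine ⟨0, 0, zero_mem _, fun hn => ?_⟩
      rw [hb fun hq => hp ⟨hq, hn⟩]; simp
  torsion {s} hi h a ha hra := by
    by_cases hp : P s ∧ ¬ P' s
    · obtain ⟨m, hm⟩ := exists_pow_smul_mem (J := ⊥) hi h (a := a) (by
        rw [hra ((hinv s hi).mpr hp).2]; exact zero_mem _)
      rw [Ideal.map_bot, Ideal.mem_bot] at hm
      exact ⟨m, fun _ => hm⟩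
    · refine ⟨0, fun hn => ?_⟩
      rw [ha fun hq => hp ⟨hq, hn⟩]; simp

/-- Acyclicity of a pair of supports whose difference consists of all `s` with `s \ J = v`, when the
product of the `f i`, `i ∈ v`, is in the radical of the ideal of the `f i`, `i ∈ J`. -/
theorem acyclic_row {P P' : Finset ι → Prop} {hP : ∀ {s t}, s ⊆ t → P s → P t}
    {hP' : ∀ {s t}, s ⊆ t → P' s → P' t} (J v : Finset ι)
    (hrow : ∀ s, P s ∧ ¬ P' s ↔ s \ J = v)
    (hrad : ∏ i ∈ v, f i ∈ (Ideal.span (f '' J)).radical) :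
    Acyclic (suppFam f P hP) (suppFam f P' hP') := by
  classical
  intro c hc hdc
  -- The annihilator of the class of `c`. The row is stable under inserting indices of `J`, so `𝔞`
  -- contains a power of each `f i`, `i ∈ J`, and by `hrad` a power of the product over `v`.
  let 𝔞 : Ideal U :=
    { carrier := {r | r • c ∈ bd (suppFam f P hP) (suppFam f P' hP')}
      add_mem' := fun {a b} ha hb => by
        rw [Set.mem_ofPred_eq] at ha hb ⊢
        rw [add_smul]; exact add_mem ha hb
      zero_mem' := by simp
      smul_mem' := fun r a ha => by
        rw [Set.mem_ofPred_eq] at ha ⊢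
        rw [smul_eq_mul, mul_smul]; exact Submodule.smul_mem _ _ ha }
  have h1 : (Ideal.span (f '' J)).radical ≤ 𝔞.radical := by
    rw [Ideal.radical_le_radical_iff, Ideal.span_le]
    rintro _ ⟨i, hi, rfl⟩
    refine (toggle_suppFam (f := f) (hP := hP) (hP' := hP') i ?_).exists_pow_smul_mem_bd hc hdc
    intro s _
    rw [hrow, hrow, Finset.insert_sdiff_of_mem _ hi]
  obtain ⟨m, hm⟩ := h1 hrad
  obtain ⟨b, hb, a, ha, hba⟩ := mem_bd.mp hm
  -- The product over `v` is a unit in every localization of the row, so the primitive `b` of its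
  -- `m`-th power times `c` can be divided by that power.
  let θ : Cochain f := fun s => if h : v ⊆ s then
    ↑((isUnit_algebraMap_loc f h).pow m).unit⁻¹ * b s else 0
  have hθ : θ ∈ (suppFam f P hP).sec := by
    intro s hs
    by_cases h : v ⊆ s
    · simp only [θ, h, dif_pos, hb s hs, mul_zero]
    · simp only [θ, h, dif_neg, not_false_eq_true]
  refine mem_bd.mpr ⟨θ, hθ, c - cDiff f θ, ?_, by simp⟩
  intro s hs
  rw [Pi.sub_apply, sub_eq_zero]
  by_cases hps : P s
  swap
  · rw [hc s hps, Fam.cDiff_mem hθ s hps]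
  have hsv : s \ J = v := (hrow s).mp ⟨hps, hs⟩
  have hvs : v ⊆ s := hsv ▸ Finset.sdiff_subset
  have hcs := congrFun hba s
  rw [Pi.add_apply, ha s hs, add_zero, Pi.smul_apply, Algebra.smul_def, map_pow] at hcs
  have hu := (isUnit_algebraMap_loc f hvs).pow m
  rw [← hu.mul_right_inj, ← hcs, cDiff_apply, cDiff_apply, Finset.mul_sum]
  refine Finset.sum_congr rfl fun i _ => ?_
  by_cases his : i ∈ s
  swap
  · simp [sgn_of_notMem his]
  rw [mul_left_comm]
  congr 1
  -- Erasing an index of `v` leaves the row, and hence the support `P`, since `P'` is closed under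
  -- enlargement; there `b` is zero. Otherwise `v` remains inside the set and the unit commutes with
  -- restriction.
  by_cases hi : i ∈ v
  · have hv : ¬ v ⊆ s.erase i := fun h => Finset.notMem_erase i s (h hi)
    have hz : b (s.erase i) = 0 := by
      refine hb _ fun hp => ?_
      have hp' : ¬ P' (s.erase i) := fun hp' => hs (hP' (Finset.erase_subset i s) hp')
      have := (hrow _).mp ⟨hp, hp'⟩
      exact hv (this ▸ Finset.sdiff_subset)
    rw [hz]
    simp only [θ, hv, dif_neg, not_false_eq_true, map_zero, mul_zero]
  · have hv : v ⊆ s.erase i := fun j hj => Finset.mem_erase.mpr ⟨fun h => hi (h ▸ hj), hvs hj⟩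
    simp only [θ, hv, dif_pos, map_mul]
    rw [← mul_assoc, ← map_pow, ← (res f (Finset.erase_subset i s)).commutes, ← map_mul, map_pow,
      IsUnit.mul_val_inv, map_one, one_mul]

/-- Acyclicity of a pair of supports whose difference is a union of rows as in `acyclic_row`. -/
theorem acyclic_rows (J : Finset ι) {P P' : Finset ι → Prop} (hP : ∀ {s t}, s ⊆ t → P s → P t)
    (hP' : ∀ {s t}, s ⊆ t → P' s → P' t) (hle : ∀ s, P' s → P s)
    (hinv : ∀ s t, s \ J = t \ J → (P s ∧ ¬ P' s) → (P t ∧ ¬ P' t))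
    (hrad : ∀ s, P s → ¬ P' s → ∏ i ∈ s \ J, f i ∈ (Ideal.span (f '' J)).radical) :
    Acyclic (suppFam f P hP) (suppFam f P' hP') := by
  classical
  induction hn : (Finset.univ.filter fun v => ∃ s, P s ∧ ¬ P' s ∧ s \ J = v).card using
    Nat.strong_induction_on generalizing P' with
  | _ n ih =>
  set rows := Finset.univ.filter fun v => ∃ s, P s ∧ ¬ P' s ∧ s \ J = v with hrows
  by_cases hne : rows.Nonempty
  swap
  · intro c hc _
    refine mem_bd.mpr ⟨0, zero_mem _, c, fun s hs => ?_, by simp⟩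
    refine hc s fun hps => hne ⟨s \ J, ?_⟩
    simp only [hrows, Finset.mem_filter, Finset.mem_univ, true_and]
    exact ⟨s, hps, hs, rfl⟩
  -- Maximality makes `P'` together with this row closed under enlargement, so rows can be peeled
  -- off one at a time.
  obtain ⟨v, hv⟩ := rows.exists_maximal hne
  have hvr := hv.prop
  simp only [hrows, Finset.mem_filter, Finset.mem_univ, true_and] at hvr
  obtain ⟨s₀, hs₀, hs₀', hsv⟩ := hvr
  let P'' : Finset ι → Prop := fun s => P' s ∨ (P s ∧ s \ J = v)
  have hP'' : ∀ {s t}, s ⊆ t → P'' s → P'' t := by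
    rintro s t hst (h | ⟨h, h'⟩)
    · exact Or.inl (hP' hst h)
    by_cases ht : P' t
    · exact Or.inl ht
    refine Or.inr ⟨hP hst h, ?_⟩
    have ht' : t \ J ∈ rows := by
      simp only [hrows, Finset.mem_filter, Finset.mem_univ, true_and]
      exact ⟨t, hP hst h, ht, rfl⟩
    exact (hv.eq_of_le ht' (h' ▸ Finset.sdiff_subset_sdiff hst le_rfl)).symm
  refine Acyclic.trans (N' := suppFam f P'' hP'') ?_ ?_ ?_ ?_
  · intro c hc s hs
    exact hc s (by rintro (h | h); exacts [hs (hle s h), hs h.1])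
  · intro c hc s hs
    exact hc s fun h => hs (Or.inl h)
  · refine ih _ ?_ (P' := P'') hP'' ?_ ?_ ?_ rfl
    · rw [← hn]
      refine Finset.card_lt_card ⟨fun w hw => ?_, fun h => ?_⟩
      · simp only [hrows, Finset.mem_filter, Finset.mem_univ, true_and] at hw ⊢
        obtain ⟨s, h1, h2, h3⟩ := hw
        exact ⟨s, h1, fun h => h2 (Or.inl h), h3⟩
      · have := h hv.prop
        simp only [Finset.mem_filter, Finset.mem_univ, true_and] at this
        obtain ⟨s, h1, h2, h3⟩ := this
        exact h2 (Or.inr ⟨h1, h3⟩)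
    · rintro s (h | h)
      exacts [hle s h, h.1]
    · rintro s t hst ⟨h1, h2⟩
      have h3 := hinv s t hst ⟨h1, fun h => h2 (Or.inl h)⟩
      refine ⟨h3.1, ?_⟩
      rintro (h | h)
      exacts [h3.2 h, h2 (Or.inr ⟨h1, hst.trans h.2⟩)]
    · exact fun s h1 h2 => hrad s h1 fun h => h2 (Or.inl h)
  · refine acyclic_row J v (fun s => ?_) (hsv ▸ hrad s₀ hs₀ hs₀')
    constructor
    · rintro ⟨h | h, h'⟩
      exacts [absurd h h', h.2]
    · intro h
      have := hinv s₀ s (hsv.trans h.symm) ⟨hs₀, hs₀'⟩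
      exact ⟨Or.inr ⟨this.1, h⟩, this.2⟩

end Families

/-! ### Gradings as coactions, and their extension to localizations -/

section Coactions

/-- A grading of a commutative ring by an abelian group, given as a coaction of the group ring:
the elements `u` that are mapped to `single g u` are the homogeneous ones of degree `g`. -/
structure Coaction (G : Type v) [AddCommGroup G] (U : Type u) [CommRing U] where
  hom : U →+* AddMonoidAlgebra U G
  closure_eq_top : AddSubmonoid.closure {u | ∃ g, hom u = AddMonoidAlgebra.single g u} = ⊤

namespace Coaction

variable {G : Type v} [AddCommGroup G] {U : Type u} [CommRing U] (γ : Coaction G U)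

/-- The homogeneous elements of degree `g`. -/
def Homog (g : G) (u : U) : Prop := γ.hom u = AddMonoidAlgebra.single g u

variable {γ}

theorem Homog.zero (g : G) : γ.Homog g 0 := by simp [Homog]

theorem Homog.one : γ.Homog 0 1 := by simp [Homog, AddMonoidAlgebra.one_def]

theorem Homog.add {g : G} {a b : U} (ha : γ.Homog g a) (hb : γ.Homog g b) : γ.Homog g (a + b) := by
  rw [Homog] at *
  rw [map_add, ha, hb, AddMonoidAlgebra.single_add]

theorem Homog.mul {g h : G} {a b : U} (ha : γ.Homog g a) (hb : γ.Homog h b) :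
    γ.Homog (g + h) (a * b) := by
  rw [Homog] at *
  rw [map_mul, ha, hb, AddMonoidAlgebra.single_mul_single]

theorem Homog.pow {g : G} {a : U} (ha : γ.Homog g a) (n : ℕ) : γ.Homog (n • g) (a ^ n) := by
  rw [Homog] at *
  rw [map_pow, ha, AddMonoidAlgebra.single_pow]

theorem Homog.prod {κ : Type*} {s : Finset κ} {δ : κ → G} {a : κ → U}
    (h : ∀ i ∈ s, γ.Homog (δ i) (a i)) : γ.Homog (∑ i ∈ s, δ i) (∏ i ∈ s, a i) := by
  classical
  induction s using Finset.induction_on with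
  | empty => simpa using Homog.one
  | insert i s hi ih =>
    rw [Finset.sum_insert hi, Finset.prod_insert hi]
    exact (h i (by simp)).mul (ih fun j hj => h j (by simp [hj]))

variable (γ)

/-- The projection onto the component of degree `g`. -/
def proj (g : G) : U →+ U where
  toFun u := (γ.hom u).coeff g
  map_zero' := by simp
  map_add' a b := by simp

variable {γ}

open Classical in
theorem Homog.proj_eq_ite {g : G} {a : U} (ha : γ.Homog g a) (h : G) :
    γ.proj h a = if g = h then a else 0 := by
  change (γ.hom a).coeff h = _
  rw [ha, AddMonoidAlgebra.coeff_single, Finsupp.single_apply]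

theorem Homog.proj_self {g : G} {a : U} (ha : γ.Homog g a) : γ.proj g a = a := by
  rw [ha.proj_eq_ite, if_pos rfl]

theorem Homog.proj_of_ne {g h : G} {a : U} (ha : γ.Homog g a) (hgh : g ≠ h) : γ.proj h a = 0 := by
  rw [ha.proj_eq_ite, if_neg hgh]

theorem induction {p : U → Prop} (h : ∀ g a, γ.Homog g a → p a)
    (hadd : ∀ a b, p a → p b → p (a + b)) (u : U) : p u := by
  have hu : u ∈ AddSubmonoid.closure {u | ∃ g, γ.hom u = AddMonoidAlgebra.single g u} := by
    rw [γ.closure_eq_top]; trivial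
  induction hu using AddSubmonoid.closure_induction with
  | mem x hx => exact h _ x hx.choose_spec
  | zero => exact h 0 0 (Homog.zero 0)
  | add a b _ _ ha hb => exact hadd a b ha hb

theorem homog_proj (g : G) (u : U) : γ.Homog g (γ.proj g u) := by
  classical
  induction u using γ.induction with
  | h k a ha =>
    rw [ha.proj_eq_ite]
    split_ifs with h
    · rwa [← h]
    · exact Homog.zero g
  | hadd a b ha hb =>
    rw [map_add]
    exact ha.add hb

theorem proj_mul {h : G} {r : U} (hr : γ.Homog h r) (g : G) (u : U) :
    γ.proj (h + g) (r * u) = r * γ.proj g u := by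
  classical
  induction u using γ.induction with
  | h k a ha =>
    rw [ha.proj_eq_ite, (hr.mul ha).proj_eq_ite]
    simp
  | hadd a b ha hb => rw [mul_add, map_add, ha, hb, map_add, mul_add]

theorem exists_eq_sum_proj (u : U) :
    ∃ s : Finset G, (∀ g ∉ s, γ.proj g u = 0) ∧ u = ∑ g ∈ s, γ.proj g u := by
  classical
  induction u using γ.induction with
  | h k a ha =>
    refine ⟨{k}, fun g hg => ha.proj_of_ne fun h => hg (by simp [h]), ?_⟩
    rw [Finset.sum_singleton, ha.proj_self]
  | hadd a b ha hb =>
    obtain ⟨s, hs, hsa⟩ := ha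
    obtain ⟨t, ht, htb⟩ := hb
    refine ⟨s ∪ t, fun g hg => ?_, ?_⟩
    · rw [map_add, hs g fun h => hg (Finset.mem_union_left _ h),
        ht g fun h => hg (Finset.mem_union_right _ h), add_zero]
    · simp only [map_add, Finset.sum_add_distrib]
      rw [← Finset.sum_subset (Finset.subset_union_left (s₂ := t)) fun g _ hg => hs g hg,
        ← Finset.sum_subset (Finset.subset_union_right (s₁ := s)) fun g _ hg => ht g hg, ← hsa,
        ← htb]

theorem eq_zero_of_proj {u : U} (h : ∀ g, γ.proj g u = 0) : u = 0 := by
  obtain ⟨s, -, hs⟩ := γ.exists_eq_sum_proj u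
  rw [hs]
  exact Finset.sum_eq_zero fun g _ => h g

/-- A homomorphism that maps elements of degree `g` to elements of degree `g` commutes with the
projections. -/
theorem map_proj {U' : Type*} [CommRing U'] {γ' : Coaction G U'} {φ : U →+* U'}
    (hφ : ∀ g a, γ.Homog g a → γ'.Homog g (φ a)) (g : G) (a : U) :
    φ (γ.proj g a) = γ'.proj g (φ a) := by
  classical
  induction a using γ.induction with
  | h k a ha =>
    rw [ha.proj_eq_ite, (hφ k a ha).proj_eq_ite]
    split_ifs <;> simp
  | hadd a b ha hb => rw [map_add, map_add, map_add, map_add, ha, hb]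

/-- The grading of the localization at a homogeneous element: the homomorphism. -/
def awayHom {x : U} {δ : G} (hx : γ.Homog δ x) :
    Localization.Away x →+* AddMonoidAlgebra (Localization.Away x) G :=
  IsLocalization.Away.lift x (g := (AddMonoidAlgebra.mapRingHom G
    (algebraMap U (Localization.Away x))).comp γ.hom) (by
      rw [RingHom.comp_apply, hx, AddMonoidAlgebra.mapRingHom_single]
      obtain ⟨y, hy⟩ := IsLocalization.Away.algebraMap_isUnit (S := Localization.Away x) x
      refine isUnit_iff_exists_inv.mpr
        ⟨AddMonoidAlgebra.single (-δ) (↑y⁻¹ : Localization.Away x), ?_⟩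
      rw [AddMonoidAlgebra.single_mul_single, ← hy, Units.mul_inv, add_neg_cancel,
        AddMonoidAlgebra.one_def])

theorem awayHom_algebraMap {x : U} {δ : G} (hx : γ.Homog δ x) {g : G} {a : U}
    (ha : γ.Homog g a) :
    awayHom hx (algebraMap U _ a) = AddMonoidAlgebra.single g (algebraMap U _ a) := by
  rw [awayHom, IsLocalization.Away.lift_eq, RingHom.comp_apply, ha,
    AddMonoidAlgebra.mapRingHom_single]

theorem awayHom_eq_single {x : U} {δ : G} (hx : γ.Homog δ x) {g : G} {a : U}
    {z : Localization.Away x} {m : ℕ} (ha : γ.Homog (g + m • δ) a)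
    (hz : z * algebraMap U _ x ^ m = algebraMap U _ a) :
    awayHom hx z = AddMonoidAlgebra.single g z := by
  have h1 := awayHom_algebraMap hx ha
  have h2 := awayHom_algebraMap hx (hx.pow m)
  rw [← hz, map_mul, ← map_pow, h2] at h1
  obtain ⟨y, hy⟩ := (IsLocalization.Away.algebraMap_isUnit (S := Localization.Away x) x).pow m
  rw [← map_pow] at hy
  have h3 : awayHom hx z = awayHom hx z * (AddMonoidAlgebra.single (m • δ)
      (algebraMap U _ (x ^ m)) * AddMonoidAlgebra.single (-(m • δ)) (↑y⁻¹ : Localization.Away x)) := by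
    rw [AddMonoidAlgebra.single_mul_single, ← hy, Units.mul_inv, add_neg_cancel,
      ← AddMonoidAlgebra.one_def, mul_one]
  rw [h3, ← mul_assoc, h1, AddMonoidAlgebra.single_mul_single, ← hy, mul_assoc, Units.mul_inv,
    add_neg_cancel_right, mul_one]

/-- The grading of the localization at a homogeneous element. -/
def away {x : U} {δ : G} (hx : γ.Homog δ x) : Coaction G (Localization.Away x) where
  hom := awayHom hx
  closure_eq_top := by
    rw [eq_top_iff]
    rintro z -
    obtain ⟨m, a, hz⟩ := IsLocalization.Away.surj x z
    obtain ⟨y, hy⟩ := (IsLocalization.Away.algebraMap_isUnit (S := Localization.Away x) x).pow m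
    have hz' : z = algebraMap U _ a * ↑y⁻¹ := by
      rw [← hz, ← hy, mul_assoc, Units.mul_inv, mul_one]
    rw [hz']
    clear hz hz'
    induction a using γ.induction with
    | h g a ha =>
      refine AddSubmonoid.subset_closure ⟨g - m • δ, awayHom_eq_single hx (a := a) (m := m) ?_ ?_⟩
      · rwa [sub_add_cancel]
      · rw [← hy, mul_assoc, Units.inv_mul, mul_one]
    | hadd a b ha hb =>
      rw [map_add, add_mul]
      exact add_mem ha hb

theorem homog_algebraMap {x : U} {δ : G} (hx : γ.Homog δ x) {g : G} {a : U} (ha : γ.Homog g a) :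
    (away hx).Homog g (algebraMap U _ a) :=
  awayHom_algebraMap hx ha

theorem homog_of_mul_eq {x : U} {δ : G} (hx : γ.Homog δ x) {g : G} {a : U}
    {z : Localization.Away x} {m : ℕ} (ha : γ.Homog (g + m • δ) a)
    (hz : z * algebraMap U _ x ^ m = algebraMap U _ a) : (away hx).Homog g z :=
  awayHom_eq_single hx ha hz

/-- Any numerator of `z` may be replaced by its component of the expected degree, because `z` and
the denominator are homogeneous. -/
theorem exists_homog_of_homog_away {x : U} {δ : G} (hx : γ.Homog δ x) {g : G}
    {z : Localization.Away x} (hz : (away hx).Homog g z) :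
    ∃ (m : ℕ) (a : U), γ.Homog (g + m • δ) a ∧ z * algebraMap U _ x ^ m = algebraMap U _ a := by
  obtain ⟨m, a, hza⟩ := IsLocalization.Away.surj x z
  refine ⟨m, γ.proj (g + m • δ) a, homog_proj _ _, ?_⟩
  rw [map_proj (γ' := away hx) (fun _ _ => homog_algebraMap hx), ← hza, ← map_pow, mul_comm,
    add_comm, proj_mul (homog_algebraMap hx (hx.pow m)), hz.proj_self]

/-- A homomorphism of localizations at homogeneous elements maps homogeneous elements to
homogeneous elements if it does so on the elements of the ring. -/
theorem homog_map_away {G' : Type*} [AddCommGroup G'] (θ : G →+ G') {x : U} {δ : G}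
    (hx : γ.Homog δ x) {U' : Type*} [CommRing U'] {γ' : Coaction G' U'}
    (φ : Localization.Away x →+* U')
    (hφ : ∀ g a, γ.Homog g a → γ'.Homog (θ g) (φ (algebraMap U _ a))) {g : G}
    {z : Localization.Away x} (hz : (away hx).Homog g z) : γ'.Homog (θ g) (φ z) := by
  obtain ⟨m, a, ha, hza⟩ := exists_homog_of_homog_away hx hz
  have hxu : IsUnit (φ (algebraMap U _ x ^ m)) :=
    ((IsLocalization.Away.algebraMap_isUnit (S := Localization.Away x) x).pow m).map φ
  have h1 := (hφ _ a ha).proj_self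
  have h2 : γ'.Homog (θ (m • δ)) (φ (algebraMap U _ x ^ m)) := by
    rw [← map_pow]; exact hφ _ _ (hx.pow m)
  rw [← hza, map_mul, mul_comm, add_comm g, map_add, proj_mul h2, hxu.mul_right_inj] at h1
  rw [← h1]
  exact homog_proj _ _

end Coaction

section GradedRings

variable {k : Type w} [Field k] {R : Type u} [CommRing R] [Algebra k R]
  (𝒜 : ℕ → Submodule k R) [GradedAlgebra 𝒜]

/-- The coaction of a graded algebra: the homomorphism. -/
def gradedHom : R →+* AddMonoidAlgebra R ℤ :=
  (DirectSum.toSemiring (fun i : ℕ => (AddMonoidAlgebra.singleAddHom (i : ℤ)).comp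
      (𝒜 i).subtype.toAddMonoidHom)
    (by
      change AddMonoidAlgebra.single ((0 : ℕ) : ℤ) (1 : R) = 1
      rw [Nat.cast_zero, AddMonoidAlgebra.one_def])
    (by
      intro i j a b
      change AddMonoidAlgebra.single ((i + j : ℕ) : ℤ) (a * b : R) =
        AddMonoidAlgebra.single (i : ℤ) (a : R) * AddMonoidAlgebra.single (j : ℤ) (b : R)
      rw [AddMonoidAlgebra.single_mul_single, Nat.cast_add])).comp
    (DirectSum.decomposeRingEquiv 𝒜).toRingHom

theorem gradedHom_of_mem {i : ℕ} {a : R} (ha : a ∈ 𝒜 i) :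
    gradedHom 𝒜 a = AddMonoidAlgebra.single (i : ℤ) a := by
  rw [gradedHom, RingHom.comp_apply]
  change DirectSum.toSemiring _ _ _ (DirectSum.decompose 𝒜 a) = _
  rw [DirectSum.decompose_of_mem 𝒜 ha, DirectSum.toSemiring_of]
  rfl

/-- The coaction of a graded algebra. -/
def gradedCoaction : Coaction ℤ R where
  hom := gradedHom 𝒜
  closure_eq_top := by
    rw [eq_top_iff]
    rintro a -
    classical
    rw [← DirectSum.sum_support_decompose 𝒜 a]
    exact sum_mem fun i _ => AddSubmonoid.subset_closure
      ⟨i, gradedHom_of_mem 𝒜 (SetLike.coe_mem _)⟩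

theorem homog_of_mem {i : ℕ} {a : R} (ha : a ∈ 𝒜 i) : (gradedCoaction 𝒜).Homog i a :=
  gradedHom_of_mem 𝒜 ha

theorem proj_gradedCoaction (i : ℕ) (a : R) :
    (gradedCoaction 𝒜).proj i a = DirectSum.decompose 𝒜 a i := by
  induction a using DirectSum.Decomposition.inductionOn 𝒜 with
  | zero => simp
  | homogeneous a =>
    rename_i j
    by_cases h : j = i
    · subst h
      rw [(homog_of_mem 𝒜 a.2).proj_self, DirectSum.decompose_coe, DirectSum.of_eq_same]
    · rw [(homog_of_mem 𝒜 a.2).proj_of_ne (by exact_mod_cast h),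
        DirectSum.decompose_of_mem_ne 𝒜 a.2 h]
  | add a b ha hb => simp [ha, hb]

theorem mem_of_homog {i : ℕ} {a : R} (ha : (gradedCoaction 𝒜).Homog i a) : a ∈ 𝒜 i := by
  rw [← ha.proj_self, proj_gradedCoaction]
  exact SetLike.coe_mem _

theorem proj_eq_zero_of_neg {n : ℤ} (hn : n < 0) (a : R) : (gradedCoaction 𝒜).proj n a = 0 := by
  induction a using DirectSum.Decomposition.inductionOn 𝒜 with
  | zero => simp
  | homogeneous a => exact (homog_of_mem 𝒜 a.2).proj_of_ne (by omega)
  | add a b ha hb => simp [ha, hb]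

theorem eq_zero_of_homog_neg {n : ℤ} (hn : n < 0) {a : R} (ha : (gradedCoaction 𝒜).Homog n a) :
    a = 0 := by
  rw [← ha.proj_self, proj_eq_zero_of_neg 𝒜 hn]

theorem homog_zero_algebraMap (c : k) : (gradedCoaction 𝒜).Homog 0 (algebraMap k R c) := by
  simpa using homog_of_mem 𝒜 (SetLike.algebraMap_mem_graded 𝒜 c)

/-- The degree `d` part of a localization consists of the homogeneous elements of degree `d`. -/
theorem mem_localizationDegree_iff {x : R} {δ : ℕ} (hx : x ∈ 𝒜 δ) (d : ℤ)
    (z : Localization.Away x) :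
    z ∈ localizationDegree 𝒜 x d ↔ (Coaction.away (homog_of_mem 𝒜 hx)).Homog d z := by
  constructor
  · intro hz
    induction hz using Submodule.span_induction with
    | mem z hz =>
      obtain ⟨i, l, a, ⟨b, m, rfl⟩, ha, hb, hd, rfl⟩ := hz
      dsimp only at hb
      have e : Localization.mk a (⟨x ^ m, m, rfl⟩ : Submonoid.powers x) * algebraMap R (Localization.Away x) (x ^ m) =
          algebraMap R _ a := by
        rw [Localization.mk_eq_mk']
        exact IsLocalization.mk'_spec _ a (⟨x ^ m, m, rfl⟩ : Submonoid.powers x)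
      -- If the denominator is zero its degree `l` is arbitrary and need not be `m • δ`; the
      -- localization is then the zero ring.
      by_cases h0 : x ^ m = 0
      · have : Subsingleton (Localization.Away x) :=
          IsLocalization.subsingleton (M := Submonoid.powers x) ⟨m, h0⟩
        convert Coaction.Homog.zero (γ := Coaction.away (homog_of_mem 𝒜 hx)) d
      refine Coaction.homog_of_mul_eq (homog_of_mem 𝒜 hx) (m := m) (a := a) ?_ (by
        rw [← map_pow]; exact e)
      have hl : l = m • δ := DirectSum.degree_eq_of_mem_mem 𝒜 hb (SetLike.pow_mem_graded m hx) h0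
      convert homog_of_mem 𝒜 ha using 1
      rw [← hd, hl]
      simp
    | zero => exact Coaction.Homog.zero d
    | add a b _ _ ha hb => exact ha.add hb
    | smul c a _ ha =>
      rw [Algebra.smul_def, IsScalarTower.algebraMap_apply k R]
      have := (Coaction.homog_algebraMap (homog_of_mem 𝒜 hx) (homog_zero_algebraMap 𝒜 c)).mul ha
      rwa [zero_add] at this
  · intro hz
    obtain ⟨m, a, ha, hza⟩ := Coaction.exists_homog_of_homog_away _ hz
    obtain ⟨y, hy⟩ := (IsLocalization.Away.algebraMap_isUnit (S := Localization.Away x) x).pow m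
    -- The numerator must have a degree in `ℕ`; when the required degree is negative, the numerator
    -- is zero.
    rcases lt_or_ge (d + m • (δ : ℤ)) 0 with h | h
    · rw [eq_zero_of_homog_neg 𝒜 h ha, map_zero, ← hy] at hza
      rw [(Units.mul_left_eq_zero y).mp hza]
      exact zero_mem _
    · obtain ⟨i, hi⟩ := Int.eq_ofNat_of_zero_le h
      rw [hi] at ha
      refine Submodule.subset_span ⟨i, m • δ, a, ⟨x ^ m, Submonoid.pow_mem _ (Submonoid.mem_powers x) m⟩, mem_of_homog 𝒜 ha,
        SetLike.pow_mem_graded m hx, ?_, ?_⟩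
      · rw [← hi]; simp
      · rw [Localization.mk_eq_mk', IsLocalization.eq_mk'_iff_mul_eq, map_pow]
        exact hza

end GradedRings

end Coactions

/-! ### Cohomological and internal degrees of cochains -/

section Degrees

variable {U : Type u} [CommRing U] {ι : Type v} [LinearOrder ι] {f : ι → U}
  {G : Type w} [AddCommGroup G] {γ : Coaction G U} {δ : ι → G}
  (hδ : ∀ i, γ.Homog (δ i) (f i))

/-- The grading of a localization at a product of homogeneous elements. -/
def locCo (s : Finset ι) : Coaction G (Loc f s) :=
  Coaction.away (Coaction.Homog.prod fun i _ => hδ i)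

theorem homog_res {s t : Finset ι} (h : s ⊆ t) {g : G} {a : Loc f s}
    (ha : (locCo hδ s).Homog g a) : (locCo hδ t).Homog g (res f h a) :=
  Coaction.homog_map_away (AddMonoidHom.id G) _ (res f h).toRingHom (fun g a ha => by
    change Coaction.Homog _ _ (res f h (algebraMap U _ a))
    rw [AlgHom.commutes]
    exact Coaction.homog_algebraMap _ ha) ha

theorem res_proj {s t : Finset ι} (h : s ⊆ t) (g : G) (a : Loc f s) :
    res f h ((locCo hδ s).proj g a) = (locCo hδ t).proj g (res f h a) :=
  Coaction.map_proj (φ := (res f h).toRingHom) (fun _ _ => homog_res hδ h) g a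

/-- The projection of cochains onto an internal degree. -/
def cProj (g : G) : Cochain f →+ Cochain f where
  toFun c s := (locCo hδ s).proj g (c s)
  map_zero' := by funext s; simp
  map_add' a b := by funext s; simp

/-- The projection of cochains onto a cohomological degree. -/
def cCard (f : ι → U) (j : ℤ) : Cochain f →ₗ[U] Cochain f where
  toFun c s := if (s.card : ℤ) = j then c s else 0
  map_add' a b := by funext s; simp only [Pi.add_apply]; split_ifs <;> simp
  map_smul' a b := by
    funext s; simp only [Pi.smul_apply, RingHom.id_apply]; split_ifs <;> simp

/-- The projection onto a cohomological and an internal degree. -/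
def cDeg (j : ℤ) (g : G) : Cochain f →+ Cochain f := (cCard f j).toAddMonoidHom.comp (cProj hδ g)

theorem cDeg_apply (j : ℤ) (g : G) (c : Cochain f) (s : Finset ι) :
    cDeg hδ j g c s = if (s.card : ℤ) = j then (locCo hδ s).proj g (c s) else 0 := rfl

/-- The cochains that are homogeneous of a given cohomological and internal degree. -/
structure IsDeg (j : ℤ) (g : G) (c : Cochain f) : Prop where
  card : ∀ s : Finset ι, (s.card : ℤ) ≠ j → c s = 0
  homog : ∀ s : Finset ι, (locCo hδ s).Homog g (c s)

variable {hδ}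

theorem isDeg_cDeg (j : ℤ) (g : G) (c : Cochain f) : IsDeg hδ j g (cDeg hδ j g c) where
  card s hs := by rw [cDeg_apply, if_neg hs]
  homog s := by
    rw [cDeg_apply]
    split_ifs
    exacts [Coaction.homog_proj _ _, Coaction.Homog.zero g]

theorem IsDeg.cDeg_eq {j : ℤ} {g : G} {c : Cochain f} (hc : IsDeg hδ j g c) :
    cDeg hδ j g c = c := by
  funext s
  rw [cDeg_apply]
  split_ifs with h
  exacts [(hc.homog s).proj_self, (hc.card s h).symm]

theorem isDeg_iff_cDeg_eq {j : ℤ} {g : G} {c : Cochain f} :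
    IsDeg hδ j g c ↔ cDeg hδ j g c = c :=
  ⟨IsDeg.cDeg_eq, fun h => h ▸ isDeg_cDeg j g c⟩

theorem IsDeg.sub {j : ℤ} {g : G} {c c' : Cochain f} (hc : IsDeg hδ j g c)
    (hc' : IsDeg hδ j g c') : IsDeg hδ j g (c - c') := by
  rw [isDeg_iff_cDeg_eq, map_sub, hc.cDeg_eq, hc'.cDeg_eq]

variable [Fintype ι]

theorem cDiff_cProj (g : G) (c : Cochain f) :
    cDiff f (cProj hδ g c) = cProj hδ g (cDiff f c) := by
  funext s
  change cDiff f (cProj hδ g c) s = (locCo hδ s).proj g (cDiff f c s)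
  rw [cDiff_apply, cDiff_apply, map_sum]
  refine Finset.sum_congr rfl fun i _ => ?_
  rw [← zsmul_eq_mul, ← zsmul_eq_mul, map_zsmul, ← res_proj]
  rfl

theorem cDiff_cCard (j : ℤ) (c : Cochain f) :
    cDiff f (cCard f j c) = cCard f (j + 1) (cDiff f c) := by
  funext s
  change cDiff f (cCard f j c) s = if (s.card : ℤ) = j + 1 then cDiff f c s else 0
  have h : ∀ i, (sgn i s : Loc f s) * res f (Finset.erase_subset i s) (cCard f j c (s.erase i)) =
      if (s.card : ℤ) = j + 1 then
        (sgn i s : Loc f s) * res f (Finset.erase_subset i s) (c (s.erase i)) else 0 := by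
    intro i
    by_cases hi : i ∈ s
    · have h1 : ((s.erase i).card : ℤ) = j ↔ (s.card : ℤ) = j + 1 := by
        have := Finset.card_erase_add_one hi
        omega
      change _ * res f _ (if ((s.erase i).card : ℤ) = j then c (s.erase i) else 0) = _
      simp only [h1]
      split_ifs <;> simp
    · simp [sgn_of_notMem hi]
  rw [cDiff_apply, cDiff_apply]
  simp only [h]
  split_ifs <;> simp

theorem cDiff_cDeg (j : ℤ) (g : G) (c : Cochain f) :
    cDiff f (cDeg hδ j g c) = cDeg hδ (j + 1) g (cDiff f c) := by
  change cDiff f (cCard f j (cProj hδ g c)) = cCard f (j + 1) (cProj hδ g (cDiff f c))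
  rw [cDiff_cCard, cDiff_cProj]

theorem IsDeg.cDiff {j : ℤ} {g : G} {c : Cochain f} (hc : IsDeg hδ j g c) :
    IsDeg hδ (j + 1) g (cDiff f c) := by
  rw [isDeg_iff_cDeg_eq, ← cDiff_cDeg, hc.cDeg_eq]

variable (hδ) in
/-- The families of homogeneous ideals. -/
def Fam.Homog (N : Fam f) : Prop :=
  ∀ (s : Finset ι) (g : G) (a : Loc f s), a ∈ N.ideal s → (locCo hδ s).proj g a ∈ N.ideal s

theorem Fam.Homog.cProj_mem {N : Fam f} (hN : N.Homog hδ) {c : Cochain f} (hc : c ∈ N.sec)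
    (g : G) : cProj hδ g c ∈ N.sec := fun s => hN s g _ (hc s)

theorem Fam.Homog.cDeg_mem {N : Fam f} (hN : N.Homog hδ) {c : Cochain f} (hc : c ∈ N.sec)
    (j : ℤ) (g : G) : cDeg hδ j g c ∈ N.sec := by
  intro s
  rw [cDeg_apply]
  split_ifs
  exacts [hN s g _ (hc s), zero_mem _]

theorem homog_suppFam {P : Finset ι → Prop} {hP : ∀ {s t}, s ⊆ t → P s → P t} :
    (suppFam f P hP).Homog hδ := by
  intro s g a ha hs
  rw [ha hs, map_zero]

theorem homog_idealFam {I : Ideal U} (hI : ∀ g a, a ∈ I → γ.proj g a ∈ I) :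
    (idealFam f I).Homog hδ := by
  intro s g a ha
  obtain ⟨m, r, hr, har⟩ := exists_mul_eq_algebraMap_of_mem_map ha
  have hx : γ.Homog (∑ i ∈ s, δ i) (∏ i ∈ s, f i) := Coaction.Homog.prod fun i _ => hδ i
  refine mem_ideal_of_mul_isUnit ((isUnit_algebraMap_loc f (Finset.Subset.refl s)).pow m) ?_
  rw [mul_comm, ← map_pow, ← Coaction.proj_mul (γ := locCo hδ s)
    (Coaction.homog_algebraMap hx (hx.pow m)), map_pow, mul_comm, har,
    ← Coaction.map_proj (γ := γ) (γ' := locCo hδ s) (fun _ _ => Coaction.homog_algebraMap hx)]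
  exact Ideal.mem_map_of_mem _ (hI _ _ hr)

end Degrees

/-! ### The Frobenius action and transport of nilpotence between pairs -/

section Frobenius

variable {U : Type u} [CommRing U] {ι : Type v} [LinearOrder ι] {f : ι → U}
  (p : ℕ) [Fact p.Prime] [CharP U p]

/-- The Frobenius action on cochains. -/
def frob : Cochain f →+ Cochain f where
  toFun c s := powHom p (natCast_localization p (∏ i ∈ s, f i)) (c s)
  map_zero' := by funext s; exact map_zero _
  map_add' a b := by funext s; exact map_add _ _ _

theorem frob_apply (c : Cochain f) (s : Finset ι) : frob p c s = c s ^ p := rfl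

theorem frob_iterate_apply (e : ℕ) (c : Cochain f) (s : Finset ι) :
    (frob p)^[e] c s = c s ^ p ^ e := by
  induction e with
  | zero => simp
  | succ e ih => rw [Function.iterate_succ_apply', frob_apply, ih, ← pow_mul, pow_succ]

theorem frob_iterate_smul (e : ℕ) (r : U) (c : Cochain f) :
    (frob p)^[e] (r • c) = r ^ p ^ e • (frob p)^[e] c := by
  funext s
  rw [frob_iterate_apply, Pi.smul_apply, Pi.smul_apply, frob_iterate_apply, smul_pow]

theorem pos_of_prime : 0 < p := (Fact.out (p := p.Prime)).pos

theorem Fam.frob_mem {N : Fam f} {c : Cochain f} (hc : c ∈ N.sec) : frob p c ∈ N.sec := fun s =>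
  Ideal.pow_mem_of_mem _ (hc s) p (pos_of_prime p)

theorem Fam.frob_iterate_mem {N : Fam f} {c : Cochain f} (hc : c ∈ N.sec) (e : ℕ) :
    (frob p)^[e] c ∈ N.sec := by
  induction e with
  | zero => exact hc
  | succ e ih => rw [Function.iterate_succ_apply']; exact Fam.frob_mem p ih

variable [Fintype ι]

theorem cDiff_frob (c : Cochain f) : cDiff f (frob p c) = frob p (cDiff f c) := by
  funext s
  change _ = powHom p (natCast_localization p (∏ i ∈ s, f i)) (cDiff f c s)
  rw [cDiff_apply, cDiff_apply, map_sum]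
  refine Finset.sum_congr rfl fun i _ => ?_
  rw [map_mul, map_intCast]
  congr 1
  exact map_pow _ _ _

theorem cDiff_frob_iterate (e : ℕ) (c : Cochain f) :
    cDiff f ((frob p)^[e] c) = (frob p)^[e] (cDiff f c) := by
  induction e with
  | zero => rfl
  | succ e ih => rw [Function.iterate_succ_apply', cDiff_frob, ih, Function.iterate_succ_apply']

theorem frob_iterate_mem_bd {N N' : Fam f} {c : Cochain f} (hc : c ∈ bd N N') (e : ℕ) :
    (frob p)^[e] c ∈ bd N N' := by
  obtain ⟨b, hb, a, ha, rfl⟩ := mem_bd.mp hc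
  exact mem_bd.mpr ⟨_, Fam.frob_iterate_mem p hb e, _, Fam.frob_iterate_mem p ha e, by
    rw [cDiff_frob_iterate, iterate_map_add]⟩

/-- The cochains that some iterate of the Frobenius maps to a coboundary. -/
def Nilp (N N' : Fam f) (c : Cochain f) : Prop := ∃ e : ℕ, (frob p)^[e] c ∈ bd N N'

variable {p}

theorem Nilp.of_mem {N N' : Fam f} {c : Cochain f} (hc : c ∈ bd N N') : Nilp p N N' c := ⟨0, hc⟩

theorem Nilp.of_iterate {N N' : Fam f} {c : Cochain f} (e : ℕ)
    (hc : Nilp p N N' ((frob p)^[e] c)) : Nilp p N N' c := by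
  obtain ⟨e', h⟩ := hc
  exact ⟨e' + e, by rwa [Function.iterate_add_apply]⟩

theorem Nilp.add {N N' : Fam f} {c c' : Cochain f} (hc : Nilp p N N' c) (hc' : Nilp p N N' c') :
    Nilp p N N' (c + c') := by
  obtain ⟨e, h⟩ := hc
  obtain ⟨e', h'⟩ := hc'
  refine ⟨e + e', ?_⟩
  rw [iterate_map_add]
  refine add_mem ?_ ?_
  · rw [add_comm, Function.iterate_add_apply]
    exact frob_iterate_mem_bd p h e'
  · rw [Function.iterate_add_apply]
    exact frob_iterate_mem_bd p h' e

theorem Nilp.sum {N N' : Fam f} {κ : Type*} {s : Finset κ} {c : κ → Cochain f}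
    (h : ∀ i ∈ s, Nilp p N N' (c i)) : Nilp p N N' (∑ i ∈ s, c i) := by
  classical
  induction s using Finset.induction_on with
  | empty => exact Nilp.of_mem (zero_mem _)
  | insert i s hi ih =>
    rw [Finset.sum_insert hi]
    exact (h i (by simp)).add (ih fun j hj => h j (by simp [hj]))

theorem bd_mono {N N' M M' : Fam f} (h : N.sec ≤ M.sec) (h' : N'.sec ≤ M'.sec) :
    bd N N' ≤ bd M M' :=
  sup_le_sup (Submodule.map_mono h) h'

theorem Nilp.mono {N N' M M' : Fam f} (h : N.sec ≤ M.sec) (h' : N'.sec ≤ M'.sec)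
    {c : Cochain f} (hc : Nilp p N N' c) : Nilp p M M' c := by
  obtain ⟨e, he⟩ := hc
  exact ⟨e, bd_mono h h' he⟩

variable {G : Type w} [AddCommGroup G] {γ : Coaction G U} {δ : ι → G}
  (hδ : ∀ i, γ.Homog (δ i) (f i))

theorem IsDeg.frob_iterate {hδ : ∀ i, γ.Homog (δ i) (f i)} {j : ℤ} {g : G} {c : Cochain f}
    (hc : IsDeg hδ j g c) (e : ℕ) : IsDeg hδ j (p ^ e • g) ((frob p)^[e] c) where
  card s hs := by
    rw [frob_iterate_apply, hc.card s hs, zero_pow (pow_pos (pos_of_prime p) e).ne']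
  homog s := by
    rw [frob_iterate_apply]
    exact (hc.homog s).pow _

variable (p) in
/-- All relative cohomology classes of the given degrees are nilpotent. -/
def NilDeg (N N' : Fam f) (j : ℤ) (g : G) : Prop :=
  ∀ c ∈ N.sec, IsDeg hδ j g c → cDiff f c ∈ N'.sec → Nilp p N N' c

variable {hδ} {N N' N'' : Fam f}

/-- Acyclicity of `N' / N''` makes `N / N'' → N / N'` an isomorphism on cohomology, and this map
commutes with Frobenius. The cochains that acyclicity supplies are not homogeneous; homogeneity of
the families allows projecting them to the bidegree at hand. -/
theorem nilDeg_iff_of_acyclic_sub (h : N'.sec ≤ N.sec) (h' : N''.sec ≤ N'.sec)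
    (hN' : N'.Homog hδ) (hN'' : N''.Homog hδ) (hac : Acyclic N' N'') (j : ℤ) (g : G) :
    NilDeg p hδ N N'' j g ↔ NilDeg p hδ N N' j g := by
  constructor
  · intro H c hc hdeg hdc
    obtain ⟨b, hb, a, ha, hba⟩ := mem_bd.mp (hac _ hdc (by rw [cDiff_cDiff]; exact zero_mem _))
    have hb' := hN'.cDeg_mem hb j g
    have h1 : Nilp p N N'' (c - cDeg hδ j g b) := by
      refine H _ (sub_mem hc (h hb')) (hdeg.sub (isDeg_cDeg j g b)) ?_
      rw [map_sub, cDiff_cDeg, ← hdeg.cDiff.cDeg_eq, ← map_sub, ← hba, add_sub_cancel_left]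
      exact hN''.cDeg_mem ha _ _
    have h2 := (h1.mono le_rfl h').add (Nilp.of_mem (p := p)
      (Submodule.mem_sup_right hb' : cDeg hδ j g b ∈ bd N N'))
    rwa [sub_add_cancel] at h2
  · intro H c hc hdeg hdc
    obtain ⟨e, he⟩ := H c hc hdeg (h' hdc)
    obtain ⟨b, hb, a, ha, hba⟩ := mem_bd.mp he
    refine ⟨e, ?_⟩
    have h1 : cDiff f a ∈ N''.sec := by
      have := congrArg (cDiff f) hba
      rw [map_add, cDiff_cDiff, zero_add, cDiff_frob_iterate] at this
      rw [this]
      exact Fam.frob_iterate_mem p hdc e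
    rw [← hba]
    exact add_mem (Submodule.mem_sup_left ⟨b, hb, rfl⟩)
      (bd_mono h le_rfl (hac a ha h1))

/-- Here `N' / N'' → N / N''` is an isomorphism on cohomology because its cokernel complex `N / N'`
is acyclic. -/
theorem nilDeg_iff_of_acyclic_quot (h : N'.sec ≤ N.sec) (h' : N''.sec ≤ N'.sec)
    (hN : N.Homog hδ) (hN' : N'.Homog hδ) (hac : Acyclic N N') (j : ℤ) (g : G) :
    NilDeg p hδ N' N'' j g ↔ NilDeg p hδ N N'' j g := by
  constructor
  · intro H c hc hdeg hdc
    obtain ⟨b, hb, a, ha, hba⟩ := mem_bd.mp (hac c hc (h' hdc))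
    have h1 : c = cDiff f (cDeg hδ (j - 1) g b) + cDeg hδ j g a := by
      rw [cDiff_cDeg, sub_add_cancel, ← map_add, hba, hdeg.cDeg_eq]
    have h2 : Nilp p N' N'' (cDeg hδ j g a) := by
      refine H _ (hN'.cDeg_mem ha j g) (isDeg_cDeg j g a) ?_
      have := congrArg (cDiff f) h1
      rw [map_add, cDiff_cDiff, zero_add] at this
      rwa [← this]
    rw [h1]
    exact (Nilp.of_mem (Submodule.mem_sup_left ⟨_, hN.cDeg_mem hb _ _, rfl⟩)).add
      (h2.mono h le_rfl)
  · intro H c hc hdeg hdc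
    obtain ⟨e, he⟩ := H c (h hc) hdeg hdc
    obtain ⟨b, hb, a, ha, hba⟩ := mem_bd.mp he
    have h1 : cDiff f b ∈ N'.sec := by
      rw [← eq_sub_iff_add_eq] at hba
      rw [hba]
      exact sub_mem (Fam.frob_iterate_mem p hc e) (h' ha)
    obtain ⟨b', hb', a', ha', hba'⟩ := mem_bd.mp (hac b hb h1)
    refine ⟨e, mem_bd.mpr ⟨a', ha', a, ha, ?_⟩⟩
    rw [← hba, ← hba', map_add, cDiff_cDiff, zero_add]

/-- Acyclicity of the total pair makes the connecting map from `N / N'` to `N' / N''` an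
isomorphism. It sends `c` to `cDiff f c`, whence the shift by one. -/
theorem nilDeg_iff_of_acyclic_total (h : N'.sec ≤ N.sec) (h' : N''.sec ≤ N'.sec)
    (hN : N.Homog hδ) (hN'' : N''.Homog hδ) (hac : Acyclic N N'') (j : ℤ) (g : G) :
    NilDeg p hδ N N' j g ↔ NilDeg p hδ N' N'' (j + 1) g := by
  constructor
  · intro H c hc hdeg hdc
    obtain ⟨b, hb, a, ha, hba⟩ := mem_bd.mp (hac c (h hc) hdc)
    have hb' := hN.cDeg_mem hb j g
    have ha' := hN''.cDeg_mem ha (j + 1) g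
    have h1 : c = cDiff f (cDeg hδ j g b) + cDeg hδ (j + 1) g a := by
      rw [cDiff_cDeg, ← map_add, hba, hdeg.cDeg_eq]
    obtain ⟨e, he⟩ := H _ hb' (isDeg_cDeg j g b) (by
      rw [eq_comm, ← eq_sub_iff_add_eq] at h1
      rw [h1]
      exact sub_mem hc (h' ha'))
    obtain ⟨b₂, hb₂, a₂, ha₂, hba₂⟩ := mem_bd.mp he
    refine ⟨e, mem_bd.mpr ⟨a₂, ha₂, _, Fam.frob_iterate_mem p ha' e, ?_⟩⟩
    have := congrArg (cDiff f) hba₂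
    rw [map_add, cDiff_cDiff, zero_add, cDiff_frob_iterate] at this
    rw [this, ← iterate_map_add, ← h1]
  · intro H c hc hdeg hdc
    obtain ⟨e, he⟩ := H _ hdc hdeg.cDiff (by rw [cDiff_cDiff]; exact zero_mem _)
    obtain ⟨b, hb, a, ha, hba⟩ := mem_bd.mp he
    refine ⟨e, ?_⟩
    have h1 := hac ((frob p)^[e] c - b) (sub_mem (Fam.frob_iterate_mem p hc e) (h hb)) (by
      rw [map_sub, cDiff_frob_iterate, ← hba, add_sub_cancel_left]
      exact ha)
    have h2 := add_mem (bd_mono le_rfl h' h1) (Submodule.mem_sup_right hb : b ∈ bd N N')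
    rwa [sub_add_cancel] at h2

/-- Excision: the relative cohomology of `(N, A)` is that of `(N', A')` if `N = N' + A`,
`A' = N' ∩ A` and the sum is compatible with degrees. -/
theorem nilDeg_iff_of_excision {A A' : Fam f} (hN : N'.sec ≤ N.sec) (hA : A'.sec ≤ A.sec)
    (hinf : ∀ c ∈ N'.sec, c ∈ A.sec → c ∈ A'.sec)
    (hsup : ∀ c ∈ N.sec, ∃ c' ∈ N'.sec, c - c' ∈ A.sec)
    (hN' : N'.Homog hδ) (hAh : A.Homog hδ) (j : ℤ) (g : G) :
    NilDeg p hδ N' A' j g ↔ NilDeg p hδ N A j g := by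
  constructor
  · intro H c hc hdeg hdc
    obtain ⟨c', hc', hcc'⟩ := hsup c hc
    have h0 := hAh.cDeg_mem hcc' j g
    rw [map_sub, hdeg.cDeg_eq] at h0
    have h1 := hN'.cDeg_mem hc' j g
    have h2 : Nilp p N' A' (cDeg hδ j g c') := by
      refine H _ h1 (isDeg_cDeg j g c') (hinf _ (Fam.cDiff_mem h1) ?_)
      have := sub_mem hdc (Fam.cDiff_mem h0)
      rwa [← map_sub, sub_sub_cancel] at this
    have := (h2.mono hN hA).add (Nilp.of_mem (p := p)
      (Submodule.mem_sup_right h0 : c - cDeg hδ j g c' ∈ bd N A))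
    rwa [add_sub_cancel] at this
  · intro H c hc hdeg hdc
    obtain ⟨e, he⟩ := H c (hN hc) hdeg (hA hdc)
    obtain ⟨b, hb, a, ha, hba⟩ := mem_bd.mp he
    obtain ⟨b', hb', hbb'⟩ := hsup b hb
    refine ⟨e, mem_bd.mpr ⟨b', hb', (frob p)^[e] c - cDiff f b', hinf _
      (sub_mem (Fam.frob_iterate_mem p hc e) (Fam.cDiff_mem hb')) ?_, by abel⟩⟩
    have := add_mem ha (Fam.cDiff_mem hbb')
    rwa [map_sub, add_sub, add_comm a, hba] at this

end Frobenius

/-! ### Finite dimension modulo a subspace -/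

section FiniteModulo

variable {k : Type*} [Field k] {V V' : Type*} [AddCommGroup V] [Module k V] [AddCommGroup V']
  [Module k V']

/-- `Z` is finite-dimensional modulo `B`. -/
def FinMod (Z B : Submodule k V) : Prop := ∃ E : Submodule k V, E.FG ∧ Z ≤ E ⊔ B

theorem FinMod.of_le {Z B : Submodule k V} (h : Z ≤ B) : FinMod Z B :=
  ⟨⊥, Submodule.fg_bot, by simpa using h⟩

/-- Rank and nullity: the image of `Z` modulo `B'` is finite-dimensional, so finitely many elements
of `Z` account for it, and the rest lies in the kernel. The map need not carry `B` into `B'`. -/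
theorem FinMod.of_map {Z B : Submodule k V} {Z' B' : Submodule k V'} (φ : V →ₗ[k] V')
    (hφ : ∀ z ∈ Z, φ z ∈ Z') (h' : FinMod Z' B') (h : FinMod (Z ⊓ B'.comap φ) B) :
    FinMod Z B := by
  classical
  obtain ⟨E', hE', hZ'⟩ := h'
  obtain ⟨E₁, hE₁, hZ₁⟩ := h
  set ψ := B'.mkQ ∘ₗ φ with hψ
  have h1 : Z.map ψ ≤ E'.map B'.mkQ := by
    rintro _ ⟨z, hz, rfl⟩
    obtain ⟨e, he, b, hb, heb⟩ := Submodule.mem_sup.mp (hZ' (hφ z hz))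
    refine ⟨e, he, ?_⟩
    rw [hψ, LinearMap.comp_apply, ← heb, map_add, (Submodule.mkQ_apply B' b),
      (Submodule.Quotient.mk_eq_zero B').mpr hb, add_zero]
  have h2 : (Z.map ψ).FG := by
    have : FiniteDimensional k (E'.map B'.mkQ) := Module.Finite.iff_fg.mpr (hE'.map _)
    exact Module.Finite.iff_fg.mp (Submodule.finiteDimensional_of_le h1)
  obtain ⟨S, hS⟩ := h2
  have hSZ : (S : Set _) ⊆ ψ '' (Z : Set V) := by
    rw [← Submodule.map_coe, ← hS]
    exact Submodule.subset_span
  obtain ⟨t, htZ, rfl⟩ := Finset.subset_set_image_iff.mp hSZ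
  refine ⟨Submodule.span k (t : Set V) ⊔ E₁, (Submodule.fg_span t.finite_toSet).sup hE₁, ?_⟩
  intro z hz
  have h3 : ψ z ∈ (Submodule.span k (t : Set V)).map ψ := by
    rw [Submodule.map_span, ← Finset.coe_image, hS]
    exact ⟨z, hz, rfl⟩
  obtain ⟨e, he, hez⟩ := h3
  have h4 : z - e ∈ Z ⊓ B'.comap φ := by
    refine ⟨sub_mem hz (Submodule.span_le.mpr htZ he), ?_⟩
    have h5 : ψ (z - e) = 0 := by rw [map_sub, hez, sub_self]
    exact (Submodule.Quotient.mk_eq_zero B').mp h5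
  rw [sup_assoc, ← add_sub_cancel e z]
  exact Submodule.add_mem_sup he (hZ₁ h4)

end FiniteModulo

/-! ### Cochains with values in extended ideals -/

section Ideals

variable {U : Type u} [CommRing U] {ι : Type v} [LinearOrder ι] {f : ι → U}

/-- The ideal of the `a` in `I` with `x * a` in `J`. -/
def colonInf (x : U) (I J : Ideal U) : Ideal U := Submodule.comap (LinearMap.lsmul U U x) J ⊓ I

theorem mem_colonInf {x a : U} {I J : Ideal U} : a ∈ colonInf x I J ↔ x * a ∈ J ∧ a ∈ I := Iff.rfl

theorem idealFam_sec_mono {I J : Ideal U} (h : I ≤ J) :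
    (idealFam f I).sec ≤ (idealFam f J).sec := fun _ hc s => Ideal.map_mono h (hc s)

theorem mem_sec_colonInf {x : U} {I J : Ideal U} {c : Cochain f} (hc : c ∈ (idealFam f I).sec)
    (hxc : x • c ∈ (idealFam f J).sec) : c ∈ (idealFam f (colonInf x I J)).sec := by
  intro s
  obtain ⟨m, r, hr, har⟩ := exists_mul_eq_algebraMap_of_mem_map (hc s)
  have h1 : algebraMap U (Loc f s) (x * r) ∈ J.map (algebraMap U _) := by
    rw [map_mul, ← har, ← mul_assoc, ← Algebra.smul_def]
    exact Ideal.mul_mem_right _ _ (hxc s)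
  obtain ⟨l, hl⟩ := algebraMap_mem_map_iff.mp h1
  refine mem_ideal_of_mul_isUnit
    ((isUnit_algebraMap_loc f (Finset.Subset.refl s)).pow (m + l)) ?_
  rw [pow_add, ← mul_assoc, har, ← map_pow, ← map_mul]
  refine Ideal.mem_map_of_mem _ (mem_colonInf.mpr ⟨?_, Ideal.mul_mem_right _ _ hr⟩)
  convert hl using 1
  ring

theorem mem_sec_span_mul_sup {x : U} {I J : Ideal U} {c : Cochain f} :
    c ∈ (idealFam f (Ideal.span {x} * I ⊔ J)).sec ↔
      ∃ b ∈ (idealFam f I).sec, ∃ a ∈ (idealFam f J).sec, c = x • b + a := by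
  constructor
  · intro hc
    have : ∀ s, ∃ b ∈ I.map (algebraMap U (Loc f s)), ∃ a ∈ J.map (algebraMap U (Loc f s)),
        c s = x • b + a := by
      intro s
      have h1 : c s ∈ (Ideal.span {x} * I ⊔ J).map (algebraMap U (Loc f s)) := hc s
      rw [Ideal.map_sup, Ideal.map_mul, Ideal.map_span, Set.image_singleton] at h1
      obtain ⟨y, hy, a, ha, hya⟩ := Submodule.mem_sup.mp h1
      obtain ⟨b, hb, rfl⟩ := Ideal.mem_span_singleton_mul.mp hy
      exact ⟨b, hb, a, ha, by rw [← hya, Algebra.smul_def]⟩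
    choose b hb a ha h using this
    exact ⟨b, hb, a, ha, funext h⟩
  · rintro ⟨b, hb, a, ha, rfl⟩ s
    have h1 : algebraMap U (Loc f s) x ∈ (Ideal.span {x}).map (algebraMap U (Loc f s)) :=
      Ideal.mem_map_of_mem _ (Ideal.mem_span_singleton_self x)
    refine add_mem ?_ (Ideal.map_mono le_sup_right (ha s))
    rw [Pi.smul_apply, Algebra.smul_def]
    refine Ideal.map_mono le_sup_left ?_
    rw [Ideal.map_mul]
    exact Ideal.mul_mem_mul h1 (hb s)

/-- A quotient `I / J` killed by `f i` vanishes where `f i` is a unit. -/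
theorem loc_mem_of_mul_le {i : ι} {I J : Ideal U} (h : ∀ a ∈ I, f i * a ∈ J) {s : Finset ι}
    (hi : i ∈ s) {a : Loc f s} (ha : a ∈ I.map (algebraMap U (Loc f s))) :
    a ∈ J.map (algebraMap U (Loc f s)) := by
  refine mem_ideal_of_mul_isUnit (isUnit_algebraMap_loc_of_mem f hi) ?_
  have h1 : Ideal.span {f i} * I ≤ J := Ideal.span_singleton_mul_le_iff.mpr h
  have h2 := Ideal.map_mono (f := algebraMap U (Loc f s)) h1
  rw [Ideal.map_mul] at h2
  rw [mul_comm]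
  exact h2 (Ideal.mul_mem_mul (Ideal.mem_map_of_mem _ (Ideal.mem_span_singleton_self _)) ha)

/-- The ideals stable under the projections of a grading. -/
def StableIdeal {G : Type w} [AddCommGroup G] (γ : Coaction G U) (I : Ideal U) : Prop :=
  ∀ g a, a ∈ I → γ.proj g a ∈ I

variable {G : Type w} [AddCommGroup G] {γ : Coaction G U}

theorem proj_mul' {δ : G} {x : U} (hx : γ.Homog δ x) (g : G) (a : U) :
    γ.proj g (x * a) = x * γ.proj (g - δ) a := by
  rw [← Coaction.proj_mul hx, add_sub_cancel]

theorem stable_colonInf {δ : G} {x : U} (hx : γ.Homog δ x) {I J : Ideal U} (hI : StableIdeal γ I)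
    (hJ : StableIdeal γ J) : StableIdeal γ (colonInf x I J) := fun g a ha =>
  mem_colonInf.mpr ⟨by rw [← Coaction.proj_mul hx]; exact hJ _ _ ha.1, hI g a ha.2⟩

theorem stable_span_mul_sup {δ : G} {x : U} (hx : γ.Homog δ x) {I J : Ideal U}
    (hI : StableIdeal γ I) (hJ : StableIdeal γ J) : StableIdeal γ (Ideal.span {x} * I ⊔ J) := by
  intro g a ha
  obtain ⟨y, hy, a, ha', rfl⟩ := Submodule.mem_sup.mp ha
  obtain ⟨b, hb, rfl⟩ := Ideal.mem_span_singleton_mul.mp hy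
  rw [map_add, proj_mul' hx]
  exact add_mem (Ideal.mem_sup_left (Ideal.mem_span_singleton_mul.mpr ⟨_, hI _ _ hb, rfl⟩))
    (Ideal.mem_sup_right (hJ g a ha'))

theorem stable_bot : StableIdeal γ (⊥ : Ideal U) := by
  intro g a ha
  rw [Ideal.mem_bot] at ha ⊢
  rw [ha, map_zero]

theorem stable_top : StableIdeal γ (⊤ : Ideal U) := fun _ _ _ => trivial

end Ideals

/-! ### Finiteness in each degree and vanishing in large degrees -/

section Serre

variable {k : Type w} [Field k] {R : Type u} [CommRing R] [Algebra k R]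
  {ι : Type v} [LinearOrder ι] {x : ι → R} {γ : Coaction ℤ R} {δ : ι → ℤ}
  (hδ : ∀ i, γ.Homog (δ i) (x i))

theorem cProj_smul {d : ℤ} {r : R} (hr : γ.Homog d r) (n : ℤ) (c : Cochain x) :
    cProj hδ (n + d) (r • c) = r • cProj hδ n c := by
  funext s
  change (locCo hδ s).proj (n + d) (r • c s) = r • (locCo hδ s).proj n (c s)
  rw [Algebra.smul_def, Algebra.smul_def, add_comm, Coaction.proj_mul]
  exact Coaction.homog_algebraMap _ hr

theorem cProj_cProj (n : ℤ) (c : Cochain x) : cProj hδ n (cProj hδ n c) = cProj hδ n c := by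
  funext s
  exact (Coaction.homog_proj n (c s)).proj_self

variable [Fintype ι]

variable (hk : ∀ c : k, γ.Homog 0 (algebraMap k R c))

/-- The relative cocycles of internal degree `n`. -/
def relCocycles (I J : Ideal R) (n : ℤ) : Submodule k (Cochain x) where
  carrier := {c | c ∈ (idealFam x I).sec ∧ cProj hδ n c = c ∧ cDiff x c ∈ (idealFam x J).sec}
  add_mem' := by
    rintro a b ⟨ha, ha', ha''⟩ ⟨hb, hb', hb''⟩
    exact ⟨add_mem ha hb, by rw [map_add, ha', hb'], by rw [map_add]; exact add_mem ha'' hb''⟩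
  zero_mem' := ⟨zero_mem _, map_zero _, by rw [map_zero]; exact zero_mem _⟩
  smul_mem' := by
    rintro c a ⟨ha, ha', ha''⟩
    rw [← algebraMap_smul R c a]
    refine ⟨Submodule.smul_mem _ _ ha, ?_, ?_⟩
    · have := cProj_smul hδ (hk c) n a
      rwa [add_zero, ha'] at this
    · rw [map_smul]
      exact Submodule.smul_mem _ _ ha''

variable (k) in
/-- The relative coboundaries, as a subspace. -/
def relBd (x : ι → R) (I J : Ideal R) : Submodule k (Cochain x) :=
  (bd (idealFam x I) (idealFam x J)).restrictScalars k

variable {hδ hk} {I J : Ideal R}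

/-- If `x i` kills the class of `c` in the cohomology of `I / J`, a primitive of `x i • c` is a
relative cocycle of `I / (x i I + J)`. This reads off the connecting map of multiplication by `x i`
on `I / J`. -/
theorem exists_kernel_witness (hI : StableIdeal γ I) (hJ : StableIdeal γ J) {n : ℤ} {i : ι}
    {c : Cochain x} (hc : c ∈ relCocycles hδ hk I J n) (hxc : x i • c ∈ relBd k x I J) :
    ∃ b ∈ relCocycles hδ hk I (Ideal.span {x i} * I ⊔ J) (n + δ i),
      x i • c - cDiff x b ∈ (idealFam x J).sec := by
  obtain ⟨b, hb, a, ha, hba⟩ := mem_bd.mp hxc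
  have h1 : cDiff x (cProj hδ (n + δ i) b) + cProj hδ (n + δ i) a = x i • c := by
    rw [cDiff_cProj, ← map_add, hba, cProj_smul hδ (hδ i), hc.2.1]
  have h2 : cProj hδ (n + δ i) a ∈ (idealFam x J).sec := (homog_idealFam hJ).cProj_mem ha _
  refine ⟨cProj hδ (n + δ i) b, ⟨(homog_idealFam hI).cProj_mem hb _, cProj_cProj _ _ _, ?_⟩, ?_⟩
  · rw [← eq_sub_iff_add_eq] at h1
    rw [h1]
    exact mem_sec_span_mul_sup.mpr ⟨c, hc.1, _, neg_mem h2, sub_eq_add_neg _ _⟩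
  · rw [← h1, add_sub_cancel_left]
    exact h2

/-- If the witness is a coboundary, `x i • c` has a primitive divisible by `x i` modulo `J`.
Cancelling `x i` costs only an error annihilated by `x i`, that is, a cocycle with values in
`colonInf (x i) I J`. -/
theorem mem_of_kernel_witness (hI : StableIdeal γ I) (hJ : StableIdeal γ J) {n : ℤ} {i : ι}
    {b c : Cochain x} (hc : c ∈ relCocycles hδ hk I J n)
    (hb : b ∈ relBd k x I (Ideal.span {x i} * I ⊔ J))
    (hbc : x i • c - cDiff x b ∈ (idealFam x J).sec) :
    c ∈ relCocycles hδ hk (colonInf (x i) I J) J n ⊔ relBd k x I J := by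
  obtain ⟨b', hb', a, ha, rfl⟩ := mem_bd.mp hb
  obtain ⟨b₂, hb₂, e, he, rfl⟩ := mem_sec_span_mul_sup.mp ha
  rw [map_add, cDiff_cDiff, zero_add, map_add, map_smul, ← sub_sub, ← smul_sub] at hbc
  have h1 : x i • (c - cDiff x b₂) ∈ (idealFam x J).sec := by
    have := add_mem hbc (Fam.cDiff_mem he)
    rwa [sub_add_cancel] at this
  have h2 : x i • (c - cDiff x (cProj hδ n b₂)) ∈ (idealFam x J).sec := by
    have := (homog_idealFam (hδ := hδ) hJ).cProj_mem h1 (n + δ i)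
    rwa [cProj_smul hδ (hδ i), map_sub, hc.2.1, ← cDiff_cProj] at this
  have h3 : cProj hδ n b₂ ∈ (idealFam x I).sec := (homog_idealFam hI).cProj_mem hb₂ n
  rw [← sub_add_cancel c (cDiff x (cProj hδ n b₂))]
  refine Submodule.add_mem_sup ⟨?_, ?_, ?_⟩ (Submodule.mem_sup_left ⟨_, h3, rfl⟩)
  · exact mem_sec_colonInf (sub_mem hc.1 (Fam.cDiff_mem h3)) h2
  · rw [map_sub, hc.2.1, ← cDiff_cProj, cProj_cProj]
  · rw [map_sub, cDiff_cDiff, sub_zero]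
    exact hc.2.2

/-- The kernel of `x i` on the cohomology of `I / J` is bounded by the cohomologies of the kernel
and the cokernel of `x i` on `I / J` itself. -/
theorem finMod_kernel (hI : StableIdeal γ I) (hJ : StableIdeal γ J) {n : ℤ} {i : ι}
    (hK : FinMod (relCocycles hδ hk (colonInf (x i) I J) J n)
      (relBd k x (colonInf (x i) I J) J))
    (hQ : FinMod (relCocycles hδ hk I (Ideal.span {x i} * I ⊔ J) (n + δ i))
      (relBd k x I (Ideal.span {x i} * I ⊔ J))) :
    FinMod (relCocycles hδ hk I J n ⊓
      (relBd k x I J).comap (LinearMap.lsmul R (Cochain x) (x i) |>.restrictScalars k))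
      (relBd k x I J) := by
  -- A witness `b` is not determined by `c`. The linear relation between them avoids choosing it
  -- linearly: finiteness is shown for `Γ` and projected to the first factor.
  let Γ : Submodule k (Cochain x × Cochain x) :=
    { carrier := {z | z.1 ∈ relCocycles hδ hk I J n ∧
        z.2 ∈ relCocycles hδ hk I (Ideal.span {x i} * I ⊔ J) (n + δ i) ∧
        x i • z.1 - cDiff x z.2 ∈ (idealFam x J).sec}
      add_mem' := by
        rintro a b ⟨h1, h2, h3⟩ ⟨h1', h2', h3'⟩
        refine ⟨add_mem h1 h1', add_mem h2 h2', ?_⟩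
        have := add_mem h3 h3'
        rw [Prod.fst_add, Prod.snd_add, map_add, smul_add]
        convert this using 1
        abel
      zero_mem' := ⟨zero_mem _, zero_mem _, by simp⟩
      smul_mem' := by
        rintro c a ⟨h1, h2, h3⟩
        refine ⟨Submodule.smul_mem _ _ h1, Submodule.smul_mem _ _ h2, ?_⟩
        have := Submodule.smul_mem _ (algebraMap k R c) h3
        rw [Prod.smul_fst, Prod.smul_snd, ← algebraMap_smul R c, ← algebraMap_smul R c, map_smul,
          smul_comm, ← smul_sub]
        exact this }
  have hΓ : FinMod Γ ((relBd k x I J).comap (LinearMap.fst k _ _)) := by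
    refine FinMod.of_map (LinearMap.snd k _ _) (fun z hz => hz.2.1) hQ ?_
    obtain ⟨E, hE, hEZ⟩ := hK
    refine ⟨E.map (LinearMap.inl k _ _), hE.map _, ?_⟩
    rintro ⟨c, b⟩ ⟨⟨h1, h2, h3⟩, h4⟩
    have h5 := mem_of_kernel_witness hI hJ h1 h4 h3
    have h6 : c ∈ E ⊔ relBd k x I J := by
      refine (sup_le (hEZ.trans (sup_le_sup le_rfl ?_)) le_sup_right) h5
      exact bd_mono (idealFam_sec_mono inf_le_right) le_rfl
    obtain ⟨e, he, β, hβ, rfl⟩ := Submodule.mem_sup.mp h6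
    have : (e + β, b) = LinearMap.inl k (Cochain x) (Cochain x) e + (β, b) := by simp
    rw [this]
    exact Submodule.add_mem_sup ⟨e, he, rfl⟩ hβ
  obtain ⟨E, hE, hEΓ⟩ := hΓ
  refine ⟨E.map (LinearMap.fst k _ _), hE.map _, ?_⟩
  rintro c ⟨hc, hxc⟩
  obtain ⟨b, hb, hbc⟩ := exists_kernel_witness hI hJ hc hxc
  obtain ⟨e, he, β, hβ, heβ⟩ := Submodule.mem_sup.mp (hEΓ (⟨hc, hb, hbc⟩ : (c, b) ∈ Γ))
  have h1 : e.1 + β.1 = c := congrArg Prod.fst heβ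
  rw [← h1]
  exact Submodule.add_mem_sup ⟨e, he, rfl⟩ hβ

variable [IsNoetherianRing R]
  (hdec : ∀ r : R, ∃ c : k, r - algebraMap k R c ∈ Ideal.span (Set.range x))

theorem exists_span_sub_mem (hdec : ∀ r : R, ∃ c : k, r - algebraMap k R c ∈
    Ideal.span (Set.range x)) (hIJ : ∀ i, ∀ a ∈ I, x i * a ∈ J) {S : Finset R}
    (hS : Ideal.span (S : Set R) = I) {a : R} (ha : a ∈ I) :
    ∃ e ∈ Submodule.span k (S : Set R), a - e ∈ J := by
  have hm : ∀ r ∈ Ideal.span (Set.range x), ∀ a ∈ I, r * a ∈ J := by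
    intro r hr a ha
    induction hr using Submodule.span_induction with
    | mem y hy => obtain ⟨i, rfl⟩ := hy; exact hIJ i a ha
    | zero => simp
    | add y z _ _ hy hz => rw [add_mul]; exact add_mem hy hz
    | smul r y _ hy => rw [smul_eq_mul, mul_assoc]; exact Ideal.mul_mem_left _ _ hy
  rw [← hS] at ha
  induction ha using Submodule.span_induction with
  | mem y hy => exact ⟨y, Submodule.subset_span hy, by simp⟩
  | zero => exact ⟨0, zero_mem _, by simp⟩
  | add y z _ _ hy hz =>
    obtain ⟨e, he, h⟩ := hy
    obtain ⟨e', he', h'⟩ := hz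
    exact ⟨e + e', add_mem he he', by rw [add_sub_add_comm]; exact add_mem h h'⟩
  | smul r y hyI hy =>
    obtain ⟨e, he, h⟩ := hy
    obtain ⟨c, hc⟩ := hdec r
    refine ⟨c • e, Submodule.smul_mem _ _ he, ?_⟩
    have h1 := add_mem (hm _ hc y (hS ▸ hyI)) (Ideal.mul_mem_left J (algebraMap k R c) h)
    rw [Algebra.smul_def c e, smul_eq_mul]
    convert h1 using 1
    ring

/-- When every `x i` kills `I / J`, all components except the one at `∅` vanish and the complex is
`I / J` itself. This is finite-dimensional: finitely generated, and acted on through `R` modulo the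
`x i`, where every element is a constant. -/
theorem relCocycles_finite_of_mul_le (hI : StableIdeal γ I) (hJ : StableIdeal γ J)
    (hdec : ∀ r : R, ∃ c : k, r - algebraMap k R c ∈ Ideal.span (Set.range x))
    (hIJ : ∀ i, ∀ a ∈ I, x i * a ∈ J) :
    (∃ n₀ : ℤ, ∀ n, n₀ ≤ n → relCocycles hδ hk I J n ≤ relBd k x I J) ∧
      ∀ n, FinMod (relCocycles hδ hk I J n) (relBd k x I J) := by
  classical
  obtain ⟨S, hS⟩ := (IsNoetherian.noetherian I : I.FG)
  let j : R →ₗ[k] Cochain x :=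
    { toFun := fun a s => if s = ∅ then algebraMap R (Loc x s) a else 0
      map_add' := fun a b => by
        funext s; simp only [Pi.add_apply]; split_ifs <;> simp
      map_smul' := fun c a => by
        funext s
        simp only [Pi.smul_apply, RingHom.id_apply]
        split_ifs
        · exact map_smul (IsScalarTower.toAlgHom k R (Loc x s)) c a
        · simp }
  have hj0 : ∀ a, j a ∅ = algebraMap R (Loc x ∅) a := fun a => by
    change (if (∅ : Finset ι) = ∅ then algebraMap R (Loc x ∅) a else 0) = _
    exact if_pos rfl
  have hj1 : ∀ a s, s ≠ ∅ → j a s = 0 := fun a s hs => if_neg hs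
  have key : ∀ n, ∀ c ∈ relCocycles hδ hk I J n, ∃ a ∈ I, γ.proj n a = a ∧
      c - j a ∈ (idealFam x J).sec := by
    intro n c hc
    obtain ⟨m, r, hr, hcr⟩ := exists_mul_eq_algebraMap_of_mem_map (hc.1 ∅)
    have h1 : c ∅ = algebraMap R _ r := by
      have hp : algebraMap R (Loc x ∅) (∏ i ∈ ∅, x i) = 1 := by
        rw [← map_one (algebraMap R (Loc x ∅))]
        exact congrArg _ Finset.prod_empty
      rw [← hcr, hp, one_pow, mul_one]
    have h2 : c ∅ = algebraMap R _ (γ.proj n r) := by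
      rw [Coaction.map_proj (γ' := locCo hδ ∅) (fun _ _ => Coaction.homog_algebraMap _), ← h1]
      exact (congrFun hc.2.1 ∅).symm
    refine ⟨γ.proj n r, hI _ _ hr, (Coaction.homog_proj _ _).proj_self, fun s => ?_⟩
    by_cases hs : s = ∅
    · subst hs
      rw [Pi.sub_apply, hj0, ← h2, sub_self]
      exact zero_mem _
    · rw [Pi.sub_apply, hj1 _ s hs, sub_zero]
      obtain ⟨i, hi⟩ := Finset.nonempty_iff_ne_empty.mpr hs
      exact loc_mem_of_mul_le (hIJ i) hi (hc.1 s)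
  have hj : ∀ a ∈ J, j a ∈ (idealFam x J).sec := by
    intro a ha s
    by_cases hs : s = ∅
    · subst hs
      rw [hj0]
      exact Ideal.mem_map_of_mem _ ha
    · rw [hj1 _ s hs]
      exact zero_mem _
  constructor
  · have hbound : ∃ n₀ : ℤ, ∀ n, n₀ ≤ n → ∀ a ∈ S, γ.proj n a = 0 := by
      choose t ht _ using fun a : R => γ.exists_eq_sum_proj a
      obtain ⟨M, hM⟩ := (S.biUnion t).bddAbove
      refine ⟨M + 1, fun n hn a ha => ht a n fun h => ?_⟩
      have := hM (Finset.mem_coe.mpr (Finset.mem_biUnion.mpr ⟨a, ha, h⟩))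
      omega
    obtain ⟨n₀, hn₀⟩ := hbound
    refine ⟨n₀, fun n hn c hc => ?_⟩
    obtain ⟨a, ha, hna, hca⟩ := key n c hc
    obtain ⟨e, he, hae⟩ := exists_span_sub_mem (k := k) hdec hIJ hS ha
    have h1 : γ.proj n e = 0 := by
      clear hae
      induction he using Submodule.span_induction with
      | mem y hy => exact hn₀ n hn y hy
      | zero => simp
      | add y z _ _ hy hz => rw [map_add, hy, hz, add_zero]
      | smul r y _ hy =>
        rw [Algebra.smul_def]
        have := Coaction.proj_mul (hk r) n y
        rwa [zero_add, hy, mul_zero] at this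
    have h2 := hJ n _ hae
    rw [map_sub, h1, sub_zero, hna] at h2
    have h3 := add_mem hca (hj a h2)
    rw [sub_add_cancel] at h3
    exact Submodule.mem_sup_right h3
  · refine fun n => ⟨(Submodule.span k (S : Set R)).map j,
      (Submodule.fg_span S.finite_toSet).map j, fun c hc => ?_⟩
    obtain ⟨a, ha, hna, hca⟩ := key n c hc
    obtain ⟨e, he, hae⟩ := exists_span_sub_mem (k := k) hdec hIJ hS ha
    have h1 := add_mem hca (hj _ hae)
    rw [map_sub, sub_add_sub_cancel] at h1
    rw [← add_sub_cancel (j e) c]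
    exact Submodule.add_mem_sup ⟨e, he, rfl⟩ (Submodule.mem_sup_right h1)

/-- Relative cohomology is finite-dimensional in each degree and vanishes in large degrees. -/
theorem relCocycles_finite (hpos : ∀ i, 0 < δ i) (hI : StableIdeal γ I) (hJ : StableIdeal γ J)
    (hJI : J ≤ I)
    (hdec : ∀ r : R, ∃ c : k, r - algebraMap k R c ∈ Ideal.span (Set.range x)) :
    (∃ n₀ : ℤ, ∀ n, n₀ ≤ n → relCocycles hδ hk I J n ≤ relBd k x I J) ∧
      ∀ n, FinMod (relCocycles hδ hk I J n) (relBd k x I J) := by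
  classical
  induction hN : (Finset.univ.filter fun i => ¬ ∀ a ∈ I, x i * a ∈ J).card using
    Nat.strong_induction_on generalizing I J with
  | _ N ih =>
  by_cases hIJ : ∀ i, ∀ a ∈ I, x i * a ∈ J
  · exact relCocycles_finite_of_mul_le hI hJ hdec hIJ
  obtain ⟨i, hi⟩ := not_forall.mp hIJ
  have hKI : colonInf (x i) I J ≤ I := inf_le_right
  have hJK : J ≤ colonInf (x i) I J := fun a ha =>
    mem_colonInf.mpr ⟨Ideal.mul_mem_left _ _ ha, hJI ha⟩
  have hQI : Ideal.span {x i} * I ⊔ J ≤ I := sup_le Ideal.mul_le_right hJI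
  have hK := stable_colonInf (hδ i) hI hJ
  have hQ := stable_span_mul_sup (hδ i) hI hJ
  -- The kernel and the cokernel of `x i` on `I / J` are killed by `x i` and by every generator that
  -- kills `I / J`, so the induction on the number of remaining generators applies to both.
  obtain ⟨⟨n₁, hn₁⟩, hK2⟩ := ih _ (by
    rw [← hN]
    refine Finset.card_lt_card ⟨fun l hl => ?_, fun h => ?_⟩
    · simp only [Finset.mem_filter, Finset.mem_univ, true_and] at hl ⊢
      exact fun h => hl fun a ha => h a (hKI ha)
    · have := h (Finset.mem_filter.mpr ⟨Finset.mem_univ i, hi⟩)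
      simp only [Finset.mem_filter, Finset.mem_univ, true_and] at this
      exact this fun a ha => ha.1) hK hJ hJK rfl
  obtain ⟨⟨n₂, hn₂⟩, hQ2⟩ := ih _ (by
    rw [← hN]
    refine Finset.card_lt_card ⟨fun l hl => ?_, fun h => ?_⟩
    · simp only [Finset.mem_filter, Finset.mem_univ, true_and] at hl ⊢
      exact fun h => hl fun a ha => Ideal.mem_sup_right (h a ha)
    · have := h (Finset.mem_filter.mpr ⟨Finset.mem_univ i, hi⟩)
      simp only [Finset.mem_filter, Finset.mem_univ, true_and] at this
      exact this fun a ha => Ideal.mem_sup_left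
        (Ideal.mul_mem_mul (Ideal.mem_span_singleton_self _) ha)) hI hQ hQI rfl
  have hBK : relBd k x (colonInf (x i) I J) J ≤ relBd k x I J :=
    bd_mono (idealFam_sec_mono hKI) le_rfl
  have hsm : ∀ n, ∀ c ∈ relCocycles hδ hk I J n, x i • c ∈ relCocycles hδ hk I J (n + δ i) := by
    intro n c hc
    refine ⟨Submodule.smul_mem _ _ hc.1, ?_, ?_⟩
    · rw [cProj_smul hδ (hδ i), hc.2.1]
    · rw [map_smul]; exact Submodule.smul_mem _ _ hc.2.2
  have hpi := hpos i
  -- Beyond both bounds multiplication by `x i` is injective on cohomology. Every class being `x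
  -- i`-power torsion by `toggle_idealFam`, the cohomology vanishes there.
  have hvan : ∀ (m : ℕ) (n : ℤ), max n₁ n₂ ≤ n → ∀ c ∈ relCocycles hδ hk I J n,
      x i ^ m • c ∈ relBd k x I J → c ∈ relBd k x I J := by
    intro m
    induction m with
    | zero => intro n _ c _ h; simpa using h
    | succ m ihm =>
      intro n hn c hc h
      rw [pow_succ, mul_smul] at h
      have h1 := ihm (n + δ i) (by omega) _ (hsm n c hc) h
      obtain ⟨b, hb, hbc⟩ := exists_kernel_witness hI hJ hc h1
      have h2 := mem_of_kernel_witness hI hJ hc (hn₂ _ (by omega) hb) hbc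
      exact (sup_le ((hn₁ n (by omega)).trans hBK) le_rfl) h2
  have hvan' : ∀ n : ℤ, max n₁ n₂ ≤ n → relCocycles hδ hk I J n ≤ relBd k x I J := by
    intro n hn c hc
    obtain ⟨m, hm⟩ := (toggle_idealFam (f := x) i I J).exists_pow_smul_mem_bd hc.1 hc.2.2
    exact hvan m n hn c hc hm
  refine ⟨⟨_, hvan'⟩, fun n => ?_⟩
  -- Descending induction on the degree: `x i` maps degree `n` to the higher degree `n + δ i`, with
  -- finite-dimensional kernel.
  induction hl : (max n₁ n₂ - n).toNat using Nat.strong_induction_on generalizing n with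
  | _ l ihl =>
  by_cases hn : max n₁ n₂ ≤ n
  · exact FinMod.of_le (hvan' n hn)
  · exact FinMod.of_map ((LinearMap.lsmul R (Cochain x) (x i)).restrictScalars k) (hsm n)
      (ihl _ (by omega) (n + δ i) rfl) (finMod_kernel hI hJ (hK2 n) (hQ2 _))

end Serre

/-! ### Existence of a non-nilpotent class of negative degree -/

section Nonvanishing

variable {R : Type u} [CommRing R] {ι : Type v} [LinearOrder ι] [Fintype ι]
  {x : ι → R} {γ : Coaction ℤ R} {δ : ι → ℤ} (hδ : ∀ i, γ.Homog (δ i) (x i))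
  (p : ℕ) [Fact p.Prime] [CharP R p]

/-- The relative cohomology modulo `J` is nilpotent in negative degrees. -/
def NilNeg (J : Ideal R) : Prop := ∀ n : ℤ, n < 0 → ∀ c : Cochain x, cProj hδ n c = c →
  cDiff x c ∈ (idealFam x J).sec → Nilp p (idealFam x ⊤) (idealFam x J) c

variable {hδ p}

theorem mem_sec_top (c : Cochain x) : c ∈ (idealFam x ⊤).sec := by
  intro s
  change c s ∈ (⊤ : Ideal R).map (algebraMap R (Loc x s))
  rw [Ideal.map_top]
  trivial

theorem cProj_frob_iterate {n : ℤ} {c : Cochain x} (hc : cProj hδ n c = c) (e : ℕ) :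
    cProj hδ (p ^ e * n) ((frob p)^[e] c) = (frob p)^[e] c := by
  funext s
  change (locCo hδ s).proj _ ((frob p)^[e] c s) = _
  rw [frob_iterate_apply]
  have h : (locCo hδ s).Homog n (c s) := by
    have := congrFun hc s
    rw [← this]
    exact Coaction.homog_proj _ _
  have h2 := (h.pow (p ^ e)).proj_self
  rwa [nsmul_eq_mul, Nat.cast_pow] at h2

/-- A cocycle `c` modulo `x i` and `J` has `cDiff x c = x i • g'` modulo `J`. The twisted Frobenius
`x i ^ (p - 1) • frob` makes `g'` a cocycle modulo `J` of negative degree, so by hypothesis an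
iterate of it is a coboundary. Subtracting its primitive times a power of `x i` from an iterate of
`c` gives a cocycle modulo `J`, which is nilpotent. -/
theorem NilNeg.sup_span (hpos : ∀ i, 0 < δ i) {J : Ideal R} (hJ : StableIdeal γ J)
    (hB : NilNeg hδ p J) (i : ι) : NilNeg hδ p (Ideal.span {x i} * ⊤ ⊔ J) := by
  intro n hn c hc hdc
  have hp : 1 < p := (Fact.out (p := p.Prime)).one_lt
  have hpi := hpos i
  obtain ⟨g, a, ha, hga⟩ : ∃ g : Cochain x, ∃ a ∈ (idealFam x J).sec,
      cDiff x c = x i • cProj hδ (n - δ i) g + a := by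
    obtain ⟨g, -, a, ha, hga⟩ := mem_sec_span_mul_sup.mp hdc
    refine ⟨g, cProj hδ n a, (homog_idealFam hJ).cProj_mem ha n, ?_⟩
    rw [← cProj_smul hδ (hδ i), sub_add_cancel, ← map_add, ← hga, ← cDiff_cProj, hc]
  set g' := cProj hδ (n - δ i) g with hg'
  have h1 : x i • cDiff x g' ∈ (idealFam x J).sec := by
    have h := congrArg (cDiff x) hga
    rw [cDiff_cDiff, map_add, map_smul, eq_comm, ← eq_sub_iff_add_eq, zero_sub] at h
    rw [h]
    exact neg_mem (Fam.cDiff_mem ha)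
  -- Only `x i • cDiff x g'` is known to lie in `J`. The twist exhibits `(x i * cDiff x g') ^ (p -
  -- 1)` as a factor, with positive exponent.
  have h2 : cDiff x (x i ^ (p - 1) • frob p g') ∈ (idealFam x J).sec := by
    rw [map_smul, cDiff_frob]
    intro s
    have h3 : (x i • cDiff x g') s ∈ (idealFam x J).ideal s := h1 s
    rw [Pi.smul_apply, Algebra.smul_def] at h3
    have h4 : (x i ^ (p - 1) • frob p (cDiff x g')) s =
        (algebraMap R _ (x i) * cDiff x g' s) ^ (p - 1) * cDiff x g' s := by
      rw [Pi.smul_apply, Algebra.smul_def, frob_apply, mul_pow, mul_assoc, ← pow_succ,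
        Nat.sub_add_cancel hp.le, map_pow]
    rw [h4]
    exact Ideal.mul_mem_right _ _ (Ideal.pow_mem_of_mem _ h3 _ (by omega))
  have h3 : cProj hδ ((p : ℤ) * n - δ i) (x i ^ (p - 1) • frob p g') =
      x i ^ (p - 1) • frob p g' := by
    have h4 : cProj hδ ((p : ℤ) * (n - δ i)) (frob p g') = frob p g' := by
      have := cProj_frob_iterate (p := p) (cProj_cProj hδ (n - δ i) g) 1
      simpa using this
    have h5 := cProj_smul hδ ((hδ i).pow (p - 1)) ((p : ℤ) * (n - δ i)) (frob p g')
    rw [h4] at h5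
    have h6 : (p : ℤ) * (n - δ i) + (p - 1) • δ i = (p : ℤ) * n - δ i := by
      rw [nsmul_eq_mul, Nat.cast_sub hp.le]
      ring
    rwa [h6] at h5
  -- The twist raises the degree `p * (n - δ i)` by `(p - 1) * δ i`, which leaves it negative.
  have hneg : (p : ℤ) * n - δ i < 0 := by nlinarith
  obtain ⟨e, he⟩ := hB _ hneg _ h3 h2
  obtain ⟨b, -, a', ha', hba'⟩ := mem_bd.mp he
  have h4 : (frob p)^[e + 1] (cDiff x c) =
      x i ^ p ^ e • (cDiff x b + a') + (frob p)^[e + 1] a := by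
    have h5 : frob p (x i • g') = x i • (x i ^ (p - 1) • frob p g') := by
      have := frob_iterate_smul p 1 (x i) g'
      rw [smul_smul, ← pow_succ', Nat.sub_add_cancel hp.le]
      simpa using this
    rw [hga, iterate_map_add, Function.iterate_succ_apply, h5, frob_iterate_smul, hba']
  set N : ℤ := ((p ^ (e + 1) : ℕ) : ℤ) * n with hN
  have hcN : cProj hδ N ((frob p)^[e + 1] c) = (frob p)^[e + 1] c := by
    rw [hN, Nat.cast_pow]
    exact cProj_frob_iterate hc _
  have hNneg : N < 0 := by
    have : (0 : ℤ) < ((p ^ (e + 1) : ℕ) : ℤ) := by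
      exact_mod_cast pow_pos (pos_of_prime p) _
    nlinarith
  have h5 : Nilp p (idealFam x ⊤) (idealFam x J)
      (cProj hδ N ((frob p)^[e + 1] c - x i ^ p ^ e • b)) := by
    refine hB N hNneg _ (cProj_cProj _ _ _) ?_
    rw [cDiff_cProj]
    refine (homog_idealFam hJ).cProj_mem ?_ N
    rw [map_sub, cDiff_frob_iterate, h4, map_smul, smul_add, add_assoc, add_sub_cancel_left]
    exact add_mem (Submodule.smul_mem _ _ ha') (Fam.frob_iterate_mem p ha _)
  -- The correction term is divisible by `x i` and therefore disappears modulo the enlarged ideal.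
  have h6 : cProj hδ N (x i ^ p ^ e • b) ∈ (idealFam x (Ideal.span {x i} * ⊤ ⊔ J)).sec := by
    refine (homog_idealFam (stable_span_mul_sup (hδ i) stable_top hJ)).cProj_mem ?_ N
    refine mem_sec_span_mul_sup.mpr ⟨x i ^ (p ^ e - 1) • b, mem_sec_top _, 0, zero_mem _, ?_⟩
    rw [smul_smul, ← pow_succ', Nat.sub_add_cancel (pow_pos (pos_of_prime p) e), add_zero]
  refine Nilp.of_iterate (e + 1) ?_
  rw [map_sub, hcN] at h5
  have h7 := (h5.mono le_rfl (idealFam_sec_mono le_sup_right)).add (Nilp.of_mem (p := p)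
    (Submodule.mem_sup_right h6 : _ ∈ bd (idealFam x ⊤) (idealFam x (Ideal.span {x i} * ⊤ ⊔ J))))
  rwa [sub_add_cancel] at h7

theorem loc_empty_eq_zero (hneg : ∀ n < 0, ∀ a, γ.Homog n a → a = 0) {n : ℤ} (hn : n < 0)
    {z : Loc x ∅} (hz : (locCo hδ ∅).Homog n z) : z = 0 := by
  obtain ⟨m, a, ha, hza⟩ := Coaction.exists_homog_of_homog_away _ hz
  rw [Finset.sum_empty, smul_zero, add_zero] at ha
  rw [hneg n hn a ha, map_zero] at hza
  have hu := (isUnit_algebraMap_loc x (Finset.Subset.refl ∅)).pow m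
  exact hu.mul_left_eq_zero.mp hza

/-- Modulo `J`, the element `x i` is invertible on the whole punctured spectrum, so `1 / x i`
defines a class of degree `-δ i` in `H^1`. Since no nonzero element of the ring has negative degree,
its nilpotence forces a power of `1 / x i` to vanish on each `D(x l)`; these sets are then empty
modulo `J`. -/
theorem NilNeg.mem_radical (hpos : ∀ i, 0 < δ i) (hneg : ∀ n < 0, ∀ a, γ.Homog n a → a = 0)
    {J : Ideal R} (hJ : StableIdeal γ J) (hB : NilNeg hδ p J) (i : ι)
    (hrad : ∀ l, x l ∈ (Ideal.span {x i} * ⊤ ⊔ J).radical) (l : ι) : x l ∈ J.radical := by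
  have hu : ∀ s : Finset ι, s ≠ ∅ → ∃ u : Loc x s, (locCo hδ s).Homog (-δ i) u ∧
      algebraMap R _ (x i) * u - 1 ∈ J.map (algebraMap R (Loc x s)) := by
    intro s hs
    obtain ⟨l, hl⟩ := Finset.nonempty_iff_ne_empty.mpr hs
    obtain ⟨m, hm⟩ := hrad l
    obtain ⟨y, hy, j, hj, hyj⟩ := Submodule.mem_sup.mp hm
    obtain ⟨a, -, rfl⟩ := Ideal.mem_span_singleton_mul.mp hy
    obtain ⟨t, ht⟩ := (isUnit_algebraMap_loc_of_mem x hl).pow m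
    refine ⟨(locCo hδ s).proj (-δ i) (algebraMap R _ a * ↑t⁻¹), Coaction.homog_proj _ _, ?_⟩
    have hxi : (locCo hδ s).Homog (δ i) (algebraMap R _ (x i)) :=
      Coaction.homog_algebraMap _ (hδ i)
    have h1 : algebraMap R (Loc x s) (x i) * (algebraMap R _ a * ↑t⁻¹) =
        1 - algebraMap R _ j * ↑t⁻¹ := by
      rw [← mul_assoc, ← map_mul, eq_sub_of_add_eq hyj, map_sub, map_pow, ← ht, sub_mul,
        Units.mul_inv]
    rw [← Coaction.proj_mul hxi, add_neg_cancel, h1, map_sub, Coaction.Homog.one.proj_self,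
      sub_sub_cancel_left]
    exact neg_mem (homog_idealFam hJ s 0 _ (Ideal.mul_mem_right _ _ (Ideal.mem_map_of_mem _ hj)))
  choose! u hu1 hu2 using hu
  let e₀ : Cochain x := fun s => if s = ∅ then 1 else 0
  have he₀ : cProj hδ 0 e₀ = e₀ := by
    funext s
    change (locCo hδ s).proj 0 (if s = ∅ then 1 else 0) = if s = ∅ then 1 else 0
    split_ifs
    · exact Coaction.Homog.one.proj_self
    · simp
  have hd0 : ∀ c : Cochain x, cDiff x c ∅ = 0 := by
    intro c
    rw [cDiff_apply]
    exact Finset.sum_eq_zero fun i _ => by rw [sgn_of_notMem (Finset.notMem_empty i)]; simp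
  -- With `e₀` the constant `1` placed at `∅`, this is `1 / x i` times the coboundary of `1`, the
  -- cocycle modulo `J` representing the function `1 / x i`.
  let c : Cochain x := fun s => if s = ∅ then 0 else u s * cDiff x e₀ s
  have hcdeg : cProj hδ (-δ i) c = c := by
    funext s
    change (locCo hδ s).proj (-δ i) (if s = ∅ then 0 else u s * cDiff x e₀ s) =
      if s = ∅ then 0 else u s * cDiff x e₀ s
    split_ifs with hs
    · simp
    · have h1 : (locCo hδ s).Homog 0 (cDiff x e₀ s) := by
        rw [← he₀, cDiff_cProj]
        exact Coaction.homog_proj _ _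
      have := ((hu1 s hs).mul h1).proj_self
      rwa [add_zero] at this
  have hxc : x i • c - cDiff x e₀ ∈ (idealFam x J).sec := by
    intro s
    rw [Pi.sub_apply, Pi.smul_apply, Algebra.smul_def]
    change _ * (if s = ∅ then 0 else u s * cDiff x e₀ s) - _ ∈ _
    split_ifs with hs
    · subst hs
      rw [hd0, mul_zero, sub_zero]
      exact zero_mem _
    · rw [← mul_assoc, ← sub_one_mul]
      exact Ideal.mul_mem_right _ _ (hu2 s hs)
  have hdc : cDiff x c ∈ (idealFam x J).sec := by
    intro s
    by_cases hs : s = ∅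
    · subst hs
      rw [hd0]
      exact zero_mem _
    · have h1 := Fam.cDiff_mem hxc s
      rw [map_sub, cDiff_cDiff, sub_zero, map_smul, Pi.smul_apply, Algebra.smul_def] at h1
      have h2 := sub_mem (Ideal.mul_mem_left _ (u s) h1)
        (Ideal.mul_mem_left _ (cDiff x c s) (hu2 s hs))
      convert h2 using 1
      ring
  obtain ⟨e, he⟩ := hB _ (neg_lt_zero.mpr (hpos i)) c hcdeg hdc
  obtain ⟨b, -, v, hv, hbv⟩ := mem_bd.mp he
  have hN := cProj_frob_iterate (p := p) hcdeg e
  have hNneg : (p ^ e : ℤ) * -δ i < 0 := by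
    have h1 : (0 : ℤ) < (p ^ e : ℤ) := by exact_mod_cast pow_pos (pos_of_prime p) e
    have h2 := hpos i
    nlinarith
  rw [← hbv, map_add, ← cDiff_cProj] at hN
  have hv' := (homog_idealFam (hδ := hδ) hJ).cProj_mem hv ((p ^ e : ℤ) * -δ i)
  set b' := cProj hδ ((p ^ e : ℤ) * -δ i) b with hb'
  -- The component at `∅` is a ring element of negative degree. Hence `cDiff x b'` vanishes at every
  -- singleton, and `u {l} ^ p ^ e` itself lies in the extension of `J`.
  have hb0 : ∀ s, s = ∅ → b' s = 0 := by
    rintro s rfl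
    exact loc_empty_eq_zero hneg hNneg (Coaction.homog_proj _ (b ∅))
  have herase : ∀ a ∈ ({l} : Finset ι), ({l} : Finset ι).erase a = ∅ := by
    intro a ha
    rw [Finset.mem_singleton.mp ha, Finset.erase_singleton]
  have h1 : cDiff x b' {l} = 0 := by
    rw [cDiff_apply]
    refine Finset.sum_eq_zero fun a _ => ?_
    by_cases ha : a ∈ ({l} : Finset ι)
    · rw [hb0 _ (herase a ha), map_zero, mul_zero]
    · rw [sgn_of_notMem ha]; simp
  have h2 : cDiff x e₀ {l} = 1 := by
    rw [cDiff_apply, Finset.sum_eq_single l]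
    · have : e₀ (({l} : Finset ι).erase l) = 1 :=
        if_pos (herase l (Finset.mem_singleton_self l))
      rw [this, map_one, mul_one, sgn, if_pos (Finset.mem_singleton_self l)]
      simp [Finset.filter_singleton]
    · intro a _ ha
      rw [sgn_of_notMem fun h => ha (Finset.mem_singleton.mp h)]; simp
    · simp
  have hl0 : ({l} : Finset ι) ≠ ∅ := Finset.singleton_ne_empty l
  have h3 : c {l} = u {l} := by
    change (if ({l} : Finset ι) = ∅ then 0 else u {l} * cDiff x e₀ {l}) = _
    rw [if_neg hl0, h2, mul_one]
  have h4 : u {l} ^ p ^ e ∈ J.map (algebraMap R (Loc x {l})) := by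
    have h5 : (frob p)^[e] c {l} = u {l} ^ p ^ e := by rw [frob_iterate_apply, h3]
    rw [← h5, ← hbv, ← hN, Pi.add_apply, h1, zero_add]
    exact hv' {l}
  have h5 : (1 : Loc x {l}) ∈ J.map (algebraMap R (Loc x {l})) := by
    have h6 := Ideal.mul_mem_left _ (algebraMap R (Loc x {l}) (x i) ^ p ^ e) h4
    rw [← mul_pow] at h6
    have h7 : (algebraMap R (Loc x {l}) (x i) * u {l}) ^ p ^ e - 1 ∈
        J.map (algebraMap R (Loc x {l})) := by
      obtain ⟨t, ht⟩ := sub_one_dvd_pow_sub_one (algebraMap R (Loc x {l}) (x i) * u {l}) (p ^ e)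
      rw [ht]
      exact Ideal.mul_mem_right _ _ (hu2 _ hl0)
    have := sub_mem h6 h7
    rwa [sub_sub_cancel] at this
  rw [← map_one (algebraMap R _)] at h5
  obtain ⟨m, hm⟩ := algebraMap_mem_map_iff.mp h5
  refine ⟨m, ?_⟩
  simpa using hm

/-- The generators are adjoined to `J` one after another by `NilNeg.sup_span`, until all lie in the
radical; `NilNeg.mem_radical` then removes them again in the reverse order. -/
theorem NilNeg.mem_radical_of_list (hpos : ∀ i, 0 < δ i)
    (hneg : ∀ n < 0, ∀ a, γ.Homog n a → a = 0) (L : List ι) {J : Ideal R}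
    (hJ : StableIdeal γ J) (hB : NilNeg hδ p J) (hL : ∀ l, x l ∈ J.radical ∨ l ∈ L) (l : ι) :
    x l ∈ J.radical := by
  induction L generalizing J l with
  | nil => exact (hL l).resolve_right (by simp)
  | cons i L ih =>
    refine hB.mem_radical hpos hneg hJ i (fun l => ?_) l
    refine ih (stable_span_mul_sup (hδ i) stable_top hJ) (hB.sup_span hpos hJ i) (fun l => ?_) l
    rcases hL l with h | h
    · exact Or.inl (Ideal.radical_mono le_sup_right h)
    · rcases List.mem_cons.mp h with rfl | h
      · exact Or.inl (Ideal.le_radical (Ideal.mem_sup_left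
          (by simp)))
      · exact Or.inr h

theorem eq_sum_cCard (c : Cochain x) :
    c = ∑ j ∈ Finset.range (Fintype.card ι + 1), cCard x (j : ℤ) c := by
  funext s
  rw [Finset.sum_apply, Finset.sum_eq_single s.card]
  · exact (if_pos rfl).symm
  · intro j _ hj
    exact if_neg fun h => hj (by exact_mod_cast h.symm)
  · intro h
    exact absurd (Finset.mem_range.mpr (Nat.lt_succ_of_le (Finset.card_le_univ s))) h

/-- Unless all the elements `x l` are nilpotent, some cohomology class of negative degree is not
nilpotent. -/
theorem exists_not_nilDeg (hpos : ∀ i, 0 < δ i) (hneg : ∀ n < 0, ∀ a, γ.Homog n a → a = 0)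
    (hx : ∃ l, ¬ IsNilpotent (x l)) :
    ∃ (j : ℕ) (n : ℤ), n < 0 ∧ ¬ NilDeg p hδ (idealFam x ⊤) (idealFam x ⊥) j n := by
  by_contra! hcon
  obtain ⟨l, hl⟩ := hx
  refine hl ?_
  -- `NilNeg` mixes the cohomological degrees, so a cocycle is split by the cardinality of the index
  -- sets.
  have hB : NilNeg hδ p (⊥ : Ideal R) := by
    intro n hn c hc hdc
    rw [eq_sum_cCard c]
    refine Nilp.sum fun j _ => hcon j n hn _ (mem_sec_top _) ?_ ?_
    · rw [← hc]
      exact isDeg_cDeg (hδ := hδ) j n c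
    · rw [cDiff_cCard]
      intro s
      change (if (s.card : ℤ) = j + 1 then cDiff x c s else 0) ∈ _
      split_ifs
      exacts [hdc s, zero_mem _]
  have := hB.mem_radical_of_list hpos hneg Finset.univ.toList stable_bot
    (fun l => Or.inr (by simp)) l
  obtain ⟨m, hm⟩ := this
  exact ⟨m, hm⟩

end Nonvanishing

/-! ### Localizations at equal elements -/

section AwayCongr

variable {R : Type u} [CommRing R]

/-- The identification of the localizations at equal elements. -/
def awayCongr {a b : R} (h : a = b) : Localization.Away a ≃ₐ[R] Localization.Away b :=
  h ▸ AlgEquiv.refl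

theorem away_algHom_ext {a : R} {B : Type*} [Semiring B] [Algebra R B]
    (g h : Localization.Away a →ₐ[R] B) (z : Localization.Away a) : g z = h z :=
  DFunLike.congr_fun (IsLocalization.algHom_ext (Submonoid.powers a) (by ext) : g = h) z

theorem homog_away_algHom {G : Type w} [AddCommGroup G] {γ : Coaction G R} {a b : R} {δ δ' : G}
    (ha : γ.Homog δ a) (hb : γ.Homog δ' b) (φ : Localization.Away a →ₐ[R] Localization.Away b)
    {g : G} {z : Localization.Away a} (hz : (Coaction.away ha).Homog g z) :
    (Coaction.away hb).Homog g (φ z) :=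
  Coaction.homog_map_away (AddMonoidHom.id G) ha φ.toRingHom (fun g a ha' => by
    change Coaction.Homog _ _ (φ (algebraMap R _ a))
    rw [AlgHom.commutes]
    exact Coaction.homog_algebraMap hb ha') hz

end AwayCongr

/-! ### Cochains on finite sets versus the ordered Čech complex -/

section Comparison

variable {R : Type u} [CommRing R] {n : ℕ} (x : Fin n → R)

/-- The set of values of an increasing map. -/
def img {j : ℕ} (e : Fin j ↪o Fin n) : Finset (Fin n) := Finset.univ.map e.toEmbedding

theorem mem_img {j : ℕ} {e : Fin j ↪o Fin n} {a : Fin n} : a ∈ img e ↔ ∃ i, e i = a := by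
  simp [img]

theorem card_img {j : ℕ} (e : Fin j ↪o Fin n) : (img e).card = j := by simp [img]

theorem prod_img {j : ℕ} (e : Fin j ↪o Fin n) : ∏ i ∈ img e, x i = ∏ i, x (e i) := by
  simp [img]

theorem img_injective {j : ℕ} {e e' : Fin j ↪o Fin n} (h : img e = img e') : e = e' := by
  rw [Finset.orderEmbOfFin_unique' (card_img e') (f := e)
      (fun i => h ▸ mem_img.mpr ⟨i, rfl⟩),
    ← Finset.orderEmbOfFin_unique' (card_img e') (f := e') (fun i => mem_img.mpr ⟨i, rfl⟩)]

theorem exists_img_eq {j : ℕ} {s : Finset (Fin n)} (hs : s.card = j) :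
    ∃ e : Fin j ↪o Fin n, img e = s :=
  ⟨s.orderEmbOfFin hs, by simp [img]⟩

theorem erase_img {j : ℕ} (e : Fin (j + 1) ↪o Fin n) (i : Fin (j + 1)) :
    (img e).erase (e i) = img (face e i) := by
  ext a
  simp only [Finset.mem_erase, mem_img, face, RelEmbedding.coe_trans, Function.comp_apply,
    Fin.succAboveOrderEmb_apply]
  constructor
  · rintro ⟨ha, l, rfl⟩
    obtain ⟨l', rfl⟩ := Fin.exists_succAbove_eq (x := l) (y := i) fun h => ha (h ▸ rfl)
    exact ⟨l', rfl⟩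
  · rintro ⟨l, rfl⟩
    exact ⟨fun h => Fin.succAbove_ne i l (e.injective h), _, rfl⟩

theorem sgn_img {j : ℕ} (e : Fin j ↪o Fin n) (i : Fin j) :
    sgn (e i) (img e) = (-1) ^ (i : ℕ) := by
  rw [sgn, if_pos (mem_img.mpr ⟨i, rfl⟩)]
  congr 1
  have : (img e).filter (· < e i) = (Finset.univ.filter (· < i)).map e.toEmbedding := by
    ext a
    simp only [Finset.mem_filter, mem_img, Finset.mem_map, Finset.mem_univ, true_and]
    constructor
    · rintro ⟨⟨l, rfl⟩, h⟩
      exact ⟨l, e.lt_iff_lt.mp h, rfl⟩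
    · rintro ⟨l, h, rfl⟩
      exact ⟨⟨l, rfl⟩, e.lt_iff_lt.mpr h⟩
  rw [this, Finset.card_map]
  have : Finset.univ.filter (· < i) = Finset.Iio i := by ext; simp
  rw [this, Fin.card_Iio]

/-- The Čech cochain given by the components of a cochain of cohomological degree `j`. -/
def toCech (j : ℕ) : Cochain x →ₗ[R] CechCochain x j where
  toFun v e := awayCongr (prod_img x e) (v (img e))
  map_add' v v' := by funext e; exact map_add (awayCongr (prod_img x e)) _ _
  map_smul' r v := by funext e; exact map_smul (awayCongr (prod_img x e)) _ _

theorem toCech_apply (j : ℕ) (v : Cochain x) (e : Fin j ↪o Fin n) :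
    toCech x j v e = awayCongr (prod_img x e) (v (img e)) := rfl

theorem cechD_toCech (j : ℕ) (v : Cochain x) :
    cechD x j (toCech x j v) = toCech x (j + 1) (cDiff x v) := by
  funext e
  rw [cechD_apply, toCech_apply, cDiff_apply, map_sum]
  rw [← Finset.sum_subset (Finset.subset_univ (img e)) (fun a _ ha => by
    rw [sgn_of_notMem ha]; simp)]
  refine Eq.trans ?_ (Finset.sum_map Finset.univ e.toEmbedding _).symm
  refine Finset.sum_congr rfl fun i _ => ?_
  change _ = awayCongr (prod_img x e) ((sgn (e i) (img e) : Loc x (img e)) *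
    res x (Finset.erase_subset (e i) (img e)) (v ((img e).erase (e i))))
  have key : ∀ t (_ : t = img (face e i)) (h : t ⊆ img e),
      awayCongr (prod_img x e) (res x h (v t)) =
        cechRestrict x e i (awayCongr (prod_img x (face e i)) (v (img (face e i)))) := by
    rintro t rfl h
    exact away_algHom_ext (((awayCongr (prod_img x e)).toAlgHom).comp (res x h))
      ((cechRestrict x e i).comp (awayCongr (prod_img x (face e i))).toAlgHom) _
  rw [map_mul, key _ (erase_img e i), map_intCast, sgn_img, Algebra.smul_def, toCech_apply]
  congr 1
  simp

/-- The cochain of cohomological degree `j` given by a Čech cochain. -/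
def ofCech (j : ℕ) (c : CechCochain x j) : Cochain x := fun s =>
  if h : ∃ e : Fin j ↪o Fin n, img e = s then
    awayCongr ((prod_img x h.choose).symm.trans (congrArg (fun s => ∏ i ∈ s, x i) h.choose_spec))
      (c h.choose)
  else 0

theorem toCech_ofCech (j : ℕ) (c : CechCochain x j) : toCech x j (ofCech x j c) = c := by
  funext e
  have h : ∃ e' : Fin j ↪o Fin n, img e' = img e := ⟨e, rfl⟩
  rw [toCech_apply, ofCech, dif_pos h]
  have key : ∀ e' (_ : e' = e) (h₁ : ∏ i, x (e' i) = ∏ i ∈ img e, x i),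
      awayCongr (prod_img x e) (awayCongr h₁ (c e')) = c e := by
    rintro e' rfl h₁
    exact away_algHom_ext (((awayCongr (prod_img x e')).toAlgHom).comp (awayCongr h₁).toAlgHom)
      (AlgHom.id R _) _
  exact key _ (img_injective h.choose_spec) _

theorem ofCech_of_card_ne {j : ℕ} (c : CechCochain x j) {s : Finset (Fin n)}
    (hs : (s.card : ℤ) ≠ j) : ofCech x j c s = 0 := by
  rw [ofCech, dif_neg]
  rintro ⟨e, rfl⟩
  exact hs (by rw [card_img])

theorem eq_zero_of_toCech_eq_zero {j : ℕ} {v : Cochain x}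
    (hv : ∀ s : Finset (Fin n), (s.card : ℤ) ≠ j → v s = 0) (h : toCech x j v = 0) : v = 0 := by
  funext s
  by_cases hs : (s.card : ℤ) = j
  · obtain ⟨e, rfl⟩ := exists_img_eq (n := n) (s := s) (j := j) (by exact_mod_cast hs)
    have := congrFun h e
    rw [toCech_apply] at this
    exact (map_eq_zero_iff _ (awayCongr (prod_img x e)).injective).mp this
  · exact hv s hs

theorem cDiff_of_card {j : ℕ} {v : Cochain x}
    (hv : ∀ s : Finset (Fin n), (s.card : ℤ) ≠ j → v s = 0) (s : Finset (Fin n))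
    (hs : (s.card : ℤ) ≠ (j + 1 : ℕ)) : cDiff x v s = 0 := by
  have h : cCard x j v = v := by
    funext s
    change (if (s.card : ℤ) = j then v s else 0) = v s
    split_ifs with h
    exacts [rfl, (hv s h).symm]
  rw [← h, cDiff_cCard]
  exact if_neg (by exact_mod_cast hs)

theorem cDiff_empty {U : Type u} [CommRing U] {ι : Type v} [LinearOrder ι] [Fintype ι]
    {f : ι → U} (c : Cochain f) : cDiff f c ∅ = 0 := by
  rw [cDiff_apply]
  exact Finset.sum_eq_zero fun i _ => by rw [sgn_of_notMem (Finset.notMem_empty i)]; simp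

/-- The primitive on the right may have components in all cohomological degrees, as `toCech` selects
the relevant one. In degree `0` both sides mean `v = 0`, because a differential vanishes at `∅`. -/
theorem toCech_mem_coboundaries_iff {j : ℕ} {v : Cochain x}
    (hv : ∀ s : Finset (Fin n), (s.card : ℤ) ≠ j → v s = 0) :
    toCech x j v ∈ cechCoboundaries x j ↔ ∃ b, cDiff x b = v := by
  cases j with
  | zero =>
    constructor
    · intro h
      exact ⟨0, by rw [map_zero, eq_zero_of_toCech_eq_zero x hv h]⟩
    · rintro ⟨b, rfl⟩
      change toCech x 0 _ = 0
      funext e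
      rw [toCech_apply]
      have key : ∀ s (_ : s = ∅), cDiff x b s = 0 := by
        rintro s rfl
        exact cDiff_empty b
      rw [key _ (Finset.card_eq_zero.mp (card_img e)), map_zero]
      rfl
  | succ j =>
    constructor
    · rintro ⟨b, hb⟩
      refine ⟨ofCech x j b, ?_⟩
      rw [← sub_eq_zero]
      refine eq_zero_of_toCech_eq_zero x (j := j + 1) (fun s hs => ?_) ?_
      · rw [Pi.sub_apply, hv s hs, sub_zero]
        exact cDiff_of_card x (fun s => ofCech_of_card_ne x b) s hs
      · rw [map_sub, ← cechD_toCech, toCech_ofCech, hb, sub_self]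
    · rintro ⟨b, rfl⟩
      exact ⟨toCech x j b, cechD_toCech x j b⟩

/-- The cocycles of cohomological degree `j`. -/
def cocycles (j : ℕ) : Submodule R (Cochain x) where
  carrier := {v | (∀ s : Finset (Fin n), (s.card : ℤ) ≠ j → v s = 0) ∧ cDiff x v = 0}
  add_mem' := by
    rintro a b ⟨ha, ha'⟩ ⟨hb, hb'⟩
    exact ⟨fun s hs => by rw [Pi.add_apply, ha s hs, hb s hs, add_zero], by
      rw [map_add, ha', hb', add_zero]⟩
  zero_mem' := ⟨fun _ _ => rfl, map_zero _⟩
  smul_mem' := by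
    rintro r a ⟨ha, ha'⟩
    exact ⟨fun s hs => by rw [Pi.smul_apply, ha s hs, smul_zero], by rw [map_smul, ha', smul_zero]⟩

/-- The cohomology class of a cocycle. -/
def toCohomology (j : ℕ) : cocycles x j →ₗ[R] LocalCohomology x j :=
  Submodule.mkQ _ ∘ₗ ((toCech x j) ∘ₗ (cocycles x j).subtype).codRestrict (cechCocycles x j)
    (fun v => by
      change cechD x j (toCech x j v) = 0
      rw [cechD_toCech, v.2.2, map_zero])

theorem toCohomology_surjective (j : ℕ) : Function.Surjective (toCohomology x j) := by
  intro m
  obtain ⟨⟨c, hc⟩, rfl⟩ := Submodule.mkQ_surjective _ m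
  have hcard := fun s => ofCech_of_card_ne x c (s := s)
  refine ⟨⟨ofCech x j c, hcard, ?_⟩, ?_⟩
  · refine eq_zero_of_toCech_eq_zero x (j := j + 1) (cDiff_of_card x hcard) ?_
    rw [← cechD_toCech, toCech_ofCech]
    exact hc
  · change Submodule.mkQ _ _ = _
    congr 1
    exact Subtype.ext (toCech_ofCech x j c)

theorem toCohomology_eq_zero_iff {j : ℕ} (v : cocycles x j) :
    toCohomology x j v = 0 ↔ ∃ b, cDiff x b = v := by
  rw [← toCech_mem_coboundaries_iff x v.2.1]
  exact Submodule.Quotient.mk_eq_zero _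

variable (p : ℕ) [Fact p.Prime] [CharP R p]

theorem frob_mem_cocycles {j : ℕ} {v : Cochain x} (hv : v ∈ cocycles x j) :
    frob p v ∈ cocycles x j :=
  ⟨fun s hs => by
    rw [frob_apply, hv.1 s hs, zero_pow (pos_of_prime p).ne'], by
    rw [cDiff_frob, hv.2, map_zero]⟩

theorem frobenius_toCohomology {j : ℕ} (v : cocycles x j) :
    localCohomologyFrobenius x p j (toCohomology x j v) =
      toCohomology x j ⟨frob p v, frob_mem_cocycles x p v.2⟩ := by
  change Submodule.mkQ _ _ = Submodule.mkQ _ _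
  congr 1
  refine Subtype.ext (funext fun e => ?_)
  change awayCongr (prod_img x e) (v.1 (img e)) ^ p = awayCongr (prod_img x e) (v.1 (img e) ^ p)
  rw [map_pow]

theorem frob_iterate_mem_cocycles {j : ℕ} {v : Cochain x} (hv : v ∈ cocycles x j) (e : ℕ) :
    (frob p)^[e] v ∈ cocycles x j := by
  induction e with
  | zero => exact hv
  | succ e ih => rw [Function.iterate_succ_apply']; exact frob_mem_cocycles x p ih

theorem frobenius_iterate_toCohomology {j : ℕ} (v : cocycles x j) (e : ℕ) :
    (localCohomologyFrobenius x p j)^[e] (toCohomology x j v) =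
      toCohomology x j ⟨(frob p)^[e] v, frob_iterate_mem_cocycles x p v.2 e⟩ := by
  induction e with
  | zero => rfl
  | succ e ih =>
    rw [Function.iterate_succ_apply', ih, frobenius_toCohomology]
    simp only [Function.iterate_succ_apply']

theorem mem_bd_top_bot {U : Type u} [CommRing U] {ι : Type v} [LinearOrder ι] [Fintype ι]
    {f : ι → U} {c : Cochain f} :
    c ∈ bd (idealFam f ⊤) (idealFam f ⊥) ↔ ∃ b, cDiff f b = c := by
  rw [mem_bd]
  constructor
  · rintro ⟨b, -, a, ha, rfl⟩
    refine ⟨b, ?_⟩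
    have : a = 0 := by
      funext s
      have h : a s ∈ (⊥ : Ideal U).map (algebraMap U (Loc f s)) := ha s
      rwa [Ideal.map_bot] at h
    rw [this, add_zero]
  · rintro ⟨b, rfl⟩
    exact ⟨b, mem_sec_top b, 0, zero_mem _, add_zero _⟩

theorem mem_sec_bot {U : Type u} [CommRing U] {ι : Type v} [LinearOrder ι]
    {f : ι → U} {c : Cochain f} : c ∈ (idealFam f ⊥).sec ↔ c = 0 := by
  constructor
  · intro ha
    funext s
    have h : c s ∈ (⊥ : Ideal U).map (algebraMap U (Loc f s)) := ha s
    rwa [Ideal.map_bot] at h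
  · rintro rfl
    exact zero_mem _

theorem toCohomology_mem_orbitClosureZero {j : ℕ} (v : cocycles x j) :
    toCohomology x j v ∈ orbitClosureZero (localCohomologyFrobenius x p j) ↔
      Nilp p (idealFam x ⊤) (idealFam x ⊥) v.1 := by
  change (∃ e : ℕ, (localCohomologyFrobenius x p j)^[e] (toCohomology x j v) = 0) ↔
    ∃ e : ℕ, (frob p)^[e] v.1 ∈ _
  simp only [frobenius_iterate_toCohomology, toCohomology_eq_zero_iff, mem_bd_top_bot]

end Comparison

/-! ### Frobenius and homogeneous components -/

section ProjPow

variable {U : Type u} [CommRing U] (p : ℕ) [Fact p.Prime]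

/-- The `p ^ e`-th power is additive, and multiplication by `p ^ e` is injective on degrees, so
different components do not mix. -/
theorem Coaction.proj_pow {γ : Coaction ℤ U} (hU : (p : U) = 0) (e : ℕ) (n : ℤ) (u : U) :
    γ.proj (p ^ e * n) (u ^ p ^ e) = γ.proj n u ^ p ^ e := by
  have hadd : ∀ a b : U, (a + b) ^ p ^ e = a ^ p ^ e + b ^ p ^ e := by
    have h : ∀ a : U, a ^ p ^ e = (powHom p hU)^[e] a := by
      intro a
      induction e with
      | zero => simp
      | succ e ih =>
        rw [Function.iterate_succ_apply', ← ih]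
        change _ = (a ^ p ^ e) ^ p
        rw [← pow_mul, pow_succ]
    intro a b
    rw [h, h, h, iterate_map_add]
  have hp : p ^ e ≠ 0 := (pow_pos (pos_of_prime p) e).ne'
  induction u using γ.induction with
  | h g a ha =>
    have h1 := ha.pow (p ^ e)
    rw [nsmul_eq_mul, Nat.cast_pow] at h1
    rw [h1.proj_eq_ite, ha.proj_eq_ite]
    have hp' : (p ^ e : ℤ) ≠ 0 := by exact_mod_cast hp
    simp only [mul_right_inj' hp']
    split_ifs
    · rfl
    · rw [zero_pow hp]
  | hadd a b ha hb => rw [hadd, map_add, ha, hb, map_add, hadd]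

end ProjPow

/-! ### Finite-dimensional quotients -/

section FiniteQuotient

variable {k : Type w} [Field k] {V : Type u} [AddCommGroup V] [Module k V]

theorem FinMod.finite {Z B : Submodule k V} (h : FinMod Z B) {Q : Type v} [AddCommGroup Q]
    [Module k Q] (g : Z →ₗ[k] Q) (hg : Function.Surjective g) (hker : ∀ z : Z, z.1 ∈ B → g z = 0) :
    Module.Finite k Q := by
  obtain ⟨E, hE, hZ⟩ := h
  have h1 : Z.map B.mkQ ≤ E.map B.mkQ := by
    rintro _ ⟨z, hz, rfl⟩
    obtain ⟨e, he, b, hb, rfl⟩ := Submodule.mem_sup.mp (hZ hz)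
    refine ⟨e, he, ?_⟩
    rw [map_add, (Submodule.Quotient.mk_eq_zero B).mpr hb |> (fun h => (h : B.mkQ b = 0)), add_zero]
  have : Module.Finite k (E.map B.mkQ) := Module.Finite.iff_fg.mpr (hE.map _)
  have : Module.Finite k (Z.map B.mkQ) :=
    Module.Finite.of_injective (Submodule.inclusion h1) (Submodule.inclusion_injective h1)
  let f : Z →ₗ[k] V ⧸ B := B.mkQ ∘ₗ Z.subtype
  have hf : LinearMap.range f = Z.map B.mkQ := by
    rw [LinearMap.range_comp, Submodule.range_subtype]
  have : Module.Finite k (LinearMap.range f) := by rw [hf]; infer_instance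
  have : Module.Finite k (Z ⧸ LinearMap.ker f) :=
    Module.Finite.equiv f.quotKerEquivRange.symm
  have hle : LinearMap.ker f ≤ LinearMap.ker g := fun z hz =>
    hker z ((Submodule.Quotient.mk_eq_zero B).mp hz)
  refine Module.Finite.of_surjective ((LinearMap.ker f).liftQ g hle) ?_
  intro q
  obtain ⟨z, rfl⟩ := hg q
  exact ⟨Submodule.Quotient.mk z, rfl⟩

end FiniteQuotient

/-! ### Nil-supports in terms of homogeneous cochains -/

section GradedComparison

variable {k : Type w} [Field k] {R : Type u} [CommRing R] [Algebra k R]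
  (𝒜 : ℕ → Submodule k R) [GradedAlgebra 𝒜] {n : ℕ} {x : Fin n → R} {δ : Fin n → ℕ}

variable {𝒜} in
theorem homog_family (hx : ∀ i, x i ∈ 𝒜 (δ i)) (i : Fin n) :
    (gradedCoaction 𝒜).Homog ((δ i : ℕ) : ℤ) (x i) := homog_of_mem 𝒜 (hx i)

theorem prod_comp_mem (hx : ∀ i, x i ∈ 𝒜 (δ i)) {j : ℕ} (e : Fin j ↪o Fin n) :
    ∏ i, x (e i) ∈ 𝒜 (∑ i, δ (e i)) :=
  SetLike.prod_mem_graded 𝒜 (δ ∘ e) (x ∘ e) fun i _ => hx (e i)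

variable (hx : ∀ i, x i ∈ 𝒜 (δ i))

theorem mem_cechDegree_iff {j : ℕ} {d : ℤ} {c : CechCochain x j} :
    c ∈ cechDegree 𝒜 x j d ↔ ∀ e : Fin j ↪o Fin n,
      (Coaction.away (homog_of_mem 𝒜 (prod_comp_mem 𝒜 hx e))).Homog d (c e) := by
  rw [cechDegree, Submodule.mem_pi]
  refine ⟨fun h e => ?_, fun h e _ => ?_⟩
  · exact (mem_localizationDegree_iff 𝒜 (prod_comp_mem 𝒜 hx e) d (c e)).mp (h e trivial)
  · exact (mem_localizationDegree_iff 𝒜 (prod_comp_mem 𝒜 hx e) d (c e)).mpr (h e)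

theorem mem_localCohomologyDegree_iff {j : ℕ} {d : ℤ} {m : LocalCohomology x j} :
    m ∈ localCohomologyDegree 𝒜 x j d ↔
      ∃ v : cocycles x j, IsDeg (homog_family hx) j d v.1 ∧ toCohomology x j v = m := by
  constructor
  · rintro ⟨⟨c, hc⟩, hcd, rfl⟩
    have hcd' := (mem_cechDegree_iff 𝒜 hx).mp (hcd : c ∈ cechDegree 𝒜 x j d)
    have hcard := fun s => ofCech_of_card_ne x c (s := s)
    refine ⟨⟨ofCech x j c, hcard, ?_⟩, ⟨hcard, fun s => ?_⟩, ?_⟩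
    · refine eq_zero_of_toCech_eq_zero x (j := j + 1) (cDiff_of_card x hcard) ?_
      rw [← cechD_toCech, toCech_ofCech]
      exact hc
    · change (locCo (homog_family hx) s).Homog d (ofCech x j c s)
      rw [ofCech]
      split_ifs with h
      · exact homog_away_algHom _ _ (awayCongr _).toAlgHom (hcd' _)
      · exact Coaction.Homog.zero d
    · change Submodule.mkQ _ _ = Submodule.mkQ _ _
      congr 1
      exact Subtype.ext (toCech_ofCech x j c)
  · rintro ⟨v, hv, rfl⟩
    refine ⟨⟨toCech x j v.1, by
      change cechD x j (toCech x j v) = 0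
      rw [cechD_toCech, v.2.2, map_zero]⟩, ?_, rfl⟩
    refine (mem_cechDegree_iff 𝒜 hx).mpr fun e => ?_
    exact homog_away_algHom _ _ (awayCongr _).toAlgHom (hv.homog (img e))

variable (p : ℕ) [Fact p.Prime] [CharP R p]

theorem mem_nilSupport_iff {j : ℕ} {d : ℤ} : d ∈ nilSupportLocalCohomology p 𝒜 x j ↔
    ¬ NilDeg p (homog_family hx) (idealFam x ⊤) (idealFam x ⊥) j d := by
  refine not_congr ⟨fun h c _ hc hdc => ?_, fun h m hm => ?_⟩
  · have hcc : c ∈ cocycles x j := ⟨hc.card, mem_sec_bot.mp hdc⟩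
    exact (toCohomology_mem_orbitClosureZero x p ⟨c, hcc⟩).mp
      (h _ ((mem_localCohomologyDegree_iff 𝒜 hx).mpr ⟨⟨c, hcc⟩, hc, rfl⟩))
  · obtain ⟨v, hv, rfl⟩ := (mem_localCohomologyDegree_iff 𝒜 hx).mp hm
    exact (toCohomology_mem_orbitClosureZero x p v).mpr
      (h v.1 (mem_sec_top _) hv (mem_sec_bot.mpr v.2.2))

end GradedComparison

/-! ### Generalized nilpotence is nilpotence in negative degrees -/

section FiniteLength

variable {k : Type w} [Field k] {R : Type u} [CommRing R] [Algebra k R] [IsNoetherianRing R]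
  {n : ℕ} {x : Fin n → R} {γ : Coaction ℤ R} {δ : Fin n → ℤ} {hδ : ∀ i, γ.Homog (δ i) (x i)}
  {p : ℕ} [Fact p.Prime] [CharP R p]

theorem Nilp.smul {f : Fin n → R} {N N' : Fam f} {c : Cochain f} (hc : Nilp p N N' c) (r : R) :
    Nilp p N N' (r • c) := by
  obtain ⟨e, he⟩ := hc
  refine ⟨e, ?_⟩
  rw [frob_iterate_smul]
  exact Submodule.smul_mem _ _ he

theorem Nilp.cProj {c : Cochain x} (hc : Nilp p (idealFam x ⊤) (idealFam x ⊥) c) (d : ℤ) :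
    Nilp p (idealFam x ⊤) (idealFam x ⊥) (cProj hδ d c) := by
  obtain ⟨e, he⟩ := hc
  obtain ⟨b, hb⟩ := mem_bd_top_bot.mp he
  refine ⟨e, mem_bd_top_bot.mpr ⟨SegreF.cProj hδ (p ^ e * d) b, ?_⟩⟩
  rw [cDiff_cProj, hb]
  funext s
  change (locCo hδ s).proj _ ((frob p)^[e] c s) = (frob p)^[e] (SegreF.cProj hδ d c) s
  rw [frob_iterate_apply, frob_iterate_apply]
  exact Coaction.proj_pow p (natCast_localization p _) e d (c s)

theorem cProj_mem_cocycles {j : ℕ} {v : Cochain x} (hv : v ∈ cocycles x j) (d : ℤ) :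
    cProj hδ d v ∈ cocycles x j := by
  refine ⟨fun s hs => ?_, ?_⟩
  · change (locCo hδ s).proj d (v s) = 0
    rw [hv.1 s hs, map_zero]
  · rw [cDiff_cProj, hv.2, map_zero]

theorem isDeg_of_mem_cocycles {j : ℕ} {v : Cochain x} (hv : v ∈ cocycles x j) (d : ℤ) :
    IsDeg hδ j d (cProj hδ d v) :=
  ⟨(cProj_mem_cocycles hv d).1, fun _ => Coaction.homog_proj _ _⟩

theorem exists_eq_sum_cProj (c : Cochain x) :
    ∃ s : Finset ℤ, c = ∑ d ∈ s, cProj hδ d c := by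
  classical
  have h := fun t => (locCo hδ t).exists_eq_sum_proj (c t)
  choose s hs hs' using h
  refine ⟨Finset.univ.biUnion s, funext fun t => ?_⟩
  rw [Finset.sum_apply]
  change c t = ∑ d ∈ _, (locCo hδ t).proj d (c t)
  conv_lhs => rw [hs' t]
  refine Finset.sum_subset (Finset.subset_biUnion_of_mem s (Finset.mem_univ t)) fun d _ hd => ?_
  exact hs t d hd

/-- Frobenius pushes positive degrees beyond the bound above which cohomology vanishes. -/
theorem nilDeg_of_pos (hk : ∀ c : k, γ.Homog 0 (algebraMap k R c)) (hpos : ∀ i, 0 < δ i)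
    (hdec : ∀ r : R, ∃ c : k, r - algebraMap k R c ∈ Ideal.span (Set.range x)) (j : ℤ) {d : ℤ}
    (hd : 0 < d) : NilDeg p hδ (idealFam x ⊤) (idealFam x ⊥) j d := by
  obtain ⟨⟨n₀, hn₀⟩, -⟩ := relCocycles_finite (hδ := hδ) (hk := hk) hpos stable_top stable_bot
    bot_le hdec
  intro c _ hc hdc
  obtain ⟨e, he⟩ : ∃ e : ℕ, n₀ ≤ p ^ e * d := by
    obtain ⟨e, he⟩ := pow_unbounded_of_one_lt n₀.toNat (Fact.out (p := p.Prime)).one_lt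
    refine ⟨e, (Int.self_le_toNat n₀).trans ?_⟩
    have h1 : (n₀.toNat : ℤ) < p ^ e := by exact_mod_cast he
    nlinarith
  refine ⟨e, hn₀ _ he ⟨mem_sec_top _, cProj_frob_iterate ?_ e, ?_⟩⟩
  · exact funext fun s => (hc.homog s).proj_self
  · rw [cDiff_frob_iterate]
    exact Fam.frob_iterate_mem p hdc e

/-- Modulo nilpotent classes only degree `0` survives; it is finite-dimensional over `k`, so the
quotient is both noetherian and artinian over `R`. -/
theorem isFiniteLength_of_nilDeg (hk : ∀ c : k, γ.Homog 0 (algebraMap k R c))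
    (hpos : ∀ i, 0 < δ i)
    (hdec : ∀ r : R, ∃ c : k, r - algebraMap k R c ∈ Ideal.span (Set.range x)) {j : ℕ}
    (h : ∀ d ≠ 0, NilDeg p hδ (idealFam x ⊤) (idealFam x ⊥) j d) :
    IsGeneralizedNilpotent (localCohomologyFrobenius x p j) := by
  obtain ⟨-, hfin⟩ := relCocycles_finite (hδ := hδ) (hk := hk) hpos stable_top stable_bot
    bot_le hdec
  set N := orbitClosureZero (localCohomologyFrobenius x p j) with hN
  let Z : Submodule k (Cochain x) :=
    relCocycles hδ hk ⊤ ⊥ 0 ⊓ (cocycles x j).restrictScalars k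
  have hZ : FinMod Z (relBd k x ⊤ ⊥) := by
    obtain ⟨E, hE, hE'⟩ := hfin 0
    exact ⟨E, hE, inf_le_left.trans hE'⟩
  let q : cocycles x j →ₗ[R] LocalCohomology x j ⧸ N := N.mkQ ∘ₗ toCohomology x j
  have hq : ∀ v, q v = 0 ↔ Nilp p (idealFam x ⊤) (idealFam x ⊥) v.1 := by
    intro v
    rw [← toCohomology_mem_orbitClosureZero x p v]
    exact Submodule.Quotient.mk_eq_zero _
  have hfinQ : Module.Finite k (LocalCohomology x j ⧸ N) := by
    refine hZ.finite ((q.restrictScalars k) ∘ₗ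
      (Submodule.inclusion (inf_le_right : Z ≤ (cocycles x j).restrictScalars k))) ?_ ?_
    · intro m
      obtain ⟨m, rfl⟩ := N.mkQ_surjective m
      obtain ⟨v, rfl⟩ := toCohomology_surjective x j m
      have hv0 := cProj_mem_cocycles (hδ := hδ) v.2 0
      refine ⟨⟨cProj hδ 0 v.1, ⟨mem_sec_top _, cProj_cProj _ _ _, ?_⟩, hv0⟩, ?_⟩
      · rw [hv0.2]; exact zero_mem _
      · change q ⟨_, hv0⟩ = q v
        rw [← sub_eq_zero, ← map_sub, hq]
        change Nilp p _ _ (cProj hδ 0 v.1 - v.1)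
        obtain ⟨s, hs⟩ := exists_eq_sum_cProj (hδ := hδ) v.1
        -- The finite set `s` need not contain `0`. If it does not, the component of degree `0` is
        -- zero, as shown at the end.
        have h1 : cProj hδ 0 v.1 - v.1 = ∑ d ∈ s.erase 0, -cProj hδ d v.1 +
            if 0 ∈ s then 0 else cProj hδ 0 v.1 := by
          rw [Finset.sum_neg_distrib]
          by_cases h0 : (0 : ℤ) ∈ s
          · rw [← Finset.add_sum_erase _ _ h0] at hs
            rw [if_pos h0, add_zero, sub_eq_iff_eq_add, eq_neg_add_iff_add_eq, add_comm]
            exact hs.symm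
          · rw [if_neg h0, Finset.erase_eq_of_notMem h0, ← hs]
            abel
        rw [h1]
        refine (Nilp.sum fun d hd => ?_).add ?_
        · rw [← neg_one_smul R]
          refine Nilp.smul (h d (Finset.ne_of_mem_erase hd) _ (mem_sec_top _)
            (isDeg_of_mem_cocycles v.2 d) ?_) _
          rw [(cProj_mem_cocycles (hδ := hδ) v.2 d).2]
          exact zero_mem _
        · split_ifs with h0
          · exact Nilp.of_mem (zero_mem _)
          · have h2 : cProj hδ 0 v.1 = 0 := by
              rw [hs, map_sum]
              refine Finset.sum_eq_zero fun d hd => funext fun t => ?_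
              exact (Coaction.homog_proj d (v.1 t)).proj_of_ne fun h => h0 (h ▸ hd)
            rw [h2]
            exact Nilp.of_mem (zero_mem _)
    · rintro ⟨z, hz⟩ hzB
      exact (hq _).mpr (Nilp.of_mem hzB)
  have h1 : IsNoetherian R (LocalCohomology x j ⧸ N) := isNoetherian_of_tower k inferInstance
  have h2 : IsArtinian R (LocalCohomology x j ⧸ N) := isArtinian_of_tower k inferInstance
  exact isFiniteLength_iff_isNoetherian_isArtinian.mpr ⟨h1, h2⟩

theorem cProj_smul_eq_sum (r : R) (c : Cochain x) (d : ℤ) : ∃ s : Finset ℤ,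
    cProj hδ d (r • c) = ∑ g ∈ s, γ.proj g r • cProj hδ (d - g) c := by
  obtain ⟨s, -, hs⟩ := γ.exists_eq_sum_proj r
  refine ⟨s, ?_⟩
  conv_lhs => rw [hs, Finset.sum_smul, map_sum]
  refine Finset.sum_congr rfl fun g _ => ?_
  rw [← cProj_smul hδ (Coaction.homog_proj g r), sub_add_cancel]

variable (hδ p) in
/-- The cocycles whose components of degree less than `a` are nilpotent. -/
def nilBelow (hneg : ∀ n < 0, ∀ a, γ.Homog n a → a = 0) (j : ℕ) (a : ℤ) :
    Submodule R (cocycles x j) where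
  carrier := {v | ∀ i < a, Nilp p (idealFam x ⊤) (idealFam x ⊥) (cProj hδ i v.1)}
  add_mem' := by
    intro v w hv hw i hi
    change Nilp p _ _ (cProj hδ i (v.1 + w.1))
    rw [map_add]
    exact (hv i hi).add (hw i hi)
  zero_mem' := by
    intro i _
    change Nilp p _ _ (cProj hδ i 0)
    rw [map_zero]
    exact Nilp.of_mem (zero_mem _)
  smul_mem' := by
    intro r v hv i hi
    change Nilp p _ _ (cProj hδ i (r • v.1))
    obtain ⟨s, hs⟩ := cProj_smul_eq_sum (hδ := hδ) r v.1 i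
    rw [hs]
    refine Nilp.sum fun g _ => ?_
    -- Elements of the ring have no components of negative degree, so multiplication only brings in
    -- components of `v` of degree at most `i`.
    by_cases hg : g < 0
    · rw [hneg g hg _ (Coaction.homog_proj g r), zero_smul]
      exact Nilp.of_mem (zero_mem _)
    · exact (hv (i - g) (by omega)).smul _

/-- A non-nilpotent class of degree `d < 0` has non-nilpotent iterates in the degrees `p ^ e * d`,
which tend to `-∞`. In a module over a ring without negative degrees this produces a strictly
ascending chain of submodules. -/
theorem nilDeg_of_isGeneralizedNilpotent (hneg : ∀ n < 0, ∀ a, γ.Homog n a → a = 0) {j : ℕ}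
    (h : IsGeneralizedNilpotent (localCohomologyFrobenius x p j)) {d : ℤ} (hd : d < 0) :
    NilDeg p hδ (idealFam x ⊤) (idealFam x ⊥) j d := by
  intro c _ hc hdc
  by_contra hnil
  have hcc : c ∈ cocycles x j := ⟨hc.card, mem_sec_bot.mp hdc⟩
  set N := orbitClosureZero (localCohomologyFrobenius x p j) with hN
  let q : cocycles x j →ₗ[R] LocalCohomology x j ⧸ N := N.mkQ ∘ₗ toCohomology x j
  have hq : ∀ v, q v = 0 ↔ Nilp p (idealFam x ⊤) (idealFam x ⊥) v.1 := by
    intro v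
    rw [← toCohomology_mem_orbitClosureZero x p v]
    exact Submodule.Quotient.mk_eq_zero _
  have : IsNoetherian R (LocalCohomology x j ⧸ N) :=
    (isFiniteLength_iff_isNoetherian_isArtinian.mp h).1
  have hp : (1 : ℤ) < p := by exact_mod_cast (Fact.out (p := p.Prime)).one_lt
  have hanti : ∀ e e' : ℕ, e ≤ e' → (p ^ e' : ℤ) * d ≤ p ^ e * d := fun e e' hee =>
    mul_le_mul_of_nonpos_right (pow_le_pow_right₀ hp.le hee) hd.le
  -- The bounds `p ^ e * d` decrease with `e`, so the condition defining `nilBelow` weakens and the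
  -- chain ascends.
  let F : ℕ →o Submodule R (LocalCohomology x j ⧸ N) :=
    { toFun := fun e => (nilBelow hδ p hneg j (p ^ e * d)).map q
      monotone' := fun e e' hee => Submodule.map_mono fun v hv i hi =>
        hv i (hi.trans_le (hanti e e' hee)) }
  obtain ⟨e, he⟩ := monotone_stabilizes_iff_noetherian.mpr this F
  have hce : ∀ e, IsDeg hδ j (p ^ e * d) ((frob p)^[e] c) := fun e => by
    have := hc.frob_iterate e
    rwa [nsmul_eq_mul, Nat.cast_pow] at this
  have h1 : q ⟨_, frob_iterate_mem_cocycles x p hcc (e + 1)⟩ ∈ F (e + 1) := by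
    refine ⟨_, fun i hi => ?_, rfl⟩
    have : cProj hδ i ((frob p)^[e + 1] c) = 0 :=
      funext fun s => ((hce (e + 1)).homog s).proj_of_ne hi.ne'
    rw [this]
    exact Nilp.of_mem (zero_mem _)
  -- As the chain is stationary, the iterate agrees modulo nilpotents with some `u` all of whose
  -- components below degree `p ^ e * d` are nilpotent. The degree `p ^ (e + 1) * d` of the iterate
  -- is among these.
  rw [← he (e + 1) (Nat.le_succ e)] at h1
  obtain ⟨u, hu, huq⟩ := h1
  rw [← sub_eq_zero, ← map_sub, hq] at huq
  have hlt : (p ^ (e + 1) : ℤ) * d < p ^ e * d :=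
    mul_lt_mul_of_neg_right (pow_lt_pow_right₀ hp (Nat.lt_succ_self e)) hd
  have h2 := huq.cProj (hδ := hδ) (p ^ (e + 1) * d)
  have h3 := (hu _ hlt).add (h2.smul (-1))
  refine hnil (Nilp.of_iterate (e + 1) ?_)
  convert h3 using 1
  have h4 : cProj hδ (p ^ (e + 1) * d) ((frob p)^[e + 1] c) = (frob p)^[e + 1] c :=
    funext fun s => ((hce (e + 1)).homog s).proj_self
  change _ = _ + (-1 : R) • cProj hδ _ (u.1 - (frob p)^[e + 1] c)
  rw [map_sub, h4, neg_one_smul]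
  abel

/-- Local cohomology is generalized nilpotent if and only if it is nilpotent in all negative
degrees. -/
theorem isGeneralizedNilpotent_iff (hk : ∀ c : k, γ.Homog 0 (algebraMap k R c))
    (hpos : ∀ i, 0 < δ i) (hneg : ∀ n < 0, ∀ a, γ.Homog n a → a = 0)
    (hdec : ∀ r : R, ∃ c : k, r - algebraMap k R c ∈ Ideal.span (Set.range x)) {j : ℕ} :
    IsGeneralizedNilpotent (localCohomologyFrobenius x p j) ↔
      ∀ d < 0, NilDeg p hδ (idealFam x ⊤) (idealFam x ⊥) j d := by
  refine ⟨fun h d hd => nilDeg_of_isGeneralizedNilpotent hneg h hd, fun h =>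
    isFiniteLength_of_nilDeg (hδ := hδ) hk hpos hdec fun d hd => ?_⟩
  rcases hd.lt_or_gt with hd | hd
  exacts [h d hd, nilDeg_of_pos hk hpos hdec j hd]

end FiniteLength

/-! ### Localizations and cochains along an embedding of index sets -/

section LocMap

variable {U U' : Type*} [CommRing U] [CommRing U'] {ι ι' : Type*} [LinearOrder ι] [LinearOrder ι']
  {f : ι → U} {f' : ι' → U'} {φ : U →+* U'} {e : ι ↪o ι'}

theorem loc_ringHom_ext {B : Type*} [CommRing B] {s : Finset ι} {g h : Loc f s →+* B}
    (H : ∀ a, g (algebraMap U _ a) = h (algebraMap U _ a)) : g = h :=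
  IsLocalization.ringHom_ext (Submonoid.powers (∏ i ∈ s, f i)) (RingHom.ext H)

theorem map_prod_eq (hφ : ∀ i, φ (f i) = f' (e i)) (s : Finset ι) :
    φ (∏ i ∈ s, f i) = ∏ i ∈ s.map e.toEmbedding, f' i := by
  rw [map_prod, Finset.prod_map]
  exact Finset.prod_congr rfl fun i _ => hφ i

/-- The map of localizations induced by a ring homomorphism that maps the elements `f i` to
elements `f' (e i)`. -/
def locMap (hφ : ∀ i, φ (f i) = f' (e i)) {s : Finset ι} {S : Finset ι'}
    (h : s.map e.toEmbedding ⊆ S) : Loc f s →+* Loc f' S :=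
  IsLocalization.Away.lift (∏ i ∈ s, f i) (g := (algebraMap U' (Loc f' S)).comp φ) (by
    rw [RingHom.comp_apply, map_prod_eq hφ]
    exact isUnit_algebraMap_loc f' h)

variable (hφ : ∀ i, φ (f i) = f' (e i))

theorem locMap_algebraMap {s : Finset ι} {S : Finset ι'} (h : s.map e.toEmbedding ⊆ S) (a : U) :
    locMap hφ h (algebraMap U _ a) = algebraMap U' _ (φ a) :=
  IsLocalization.Away.lift_eq _ _ a

theorem locMap_res {s t : Finset ι} {S : Finset ι'} (hst : s ⊆ t) (h : t.map e.toEmbedding ⊆ S)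
    (h' : s.map e.toEmbedding ⊆ S) (a : Loc f s) :
    locMap hφ h (res f hst a) = locMap hφ h' a :=
  DFunLike.congr_fun (loc_ringHom_ext (g := (locMap hφ h).comp (res f hst).toRingHom)
    (h := locMap hφ h') fun a => by
      change locMap hφ h (res f hst (algebraMap U _ a)) = _
      rw [AlgHom.commutes, locMap_algebraMap, locMap_algebraMap]) a

theorem res_locMap {s : Finset ι} {S S' : Finset ι'} (h : s.map e.toEmbedding ⊆ S) (hS : S ⊆ S')
    (h' : s.map e.toEmbedding ⊆ S') (a : Loc f s) :
    res f' hS (locMap hφ h a) = locMap hφ h' a :=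
  DFunLike.congr_fun (loc_ringHom_ext (g := (res f' hS).toRingHom.comp (locMap hφ h))
    (h := locMap hφ h') fun a => by
      change res f' hS (locMap hφ h (algebraMap U _ a)) = _
      rw [locMap_algebraMap, AlgHom.commutes, locMap_algebraMap]) a

theorem locMap_congr {s s' : Finset ι} (hs : s = s') {S : Finset ι'}
    (h : s.map e.toEmbedding ⊆ S) (h' : s'.map e.toEmbedding ⊆ S) (c : Cochain f) :
    locMap hφ h (c s) = locMap hφ h' (c s') := by
  subst hs
  rfl

theorem locMap_injective (hinj : Function.Injective φ) {s : Finset ι} {S : Finset ι'}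
    (h : s.map e.toEmbedding ⊆ S) (hS : S = s.map e.toEmbedding) :
    Function.Injective (locMap hφ h) := by
  rw [injective_iff_map_eq_zero]
  intro a ha
  obtain ⟨m, r, hr⟩ := IsLocalization.Away.surj (∏ i ∈ s, f i) a
  have h1 : algebraMap U' (Loc f' S) (φ r) = algebraMap U' (Loc f' S) 0 := by
    rw [← locMap_algebraMap hφ h, ← hr, map_mul, ha, zero_mul, map_zero]
  obtain ⟨⟨_, l, rfl⟩, hl⟩ :=
    (IsLocalization.eq_iff_exists (Submonoid.powers (∏ i ∈ S, f' i)) _).mp h1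
  change (∏ i ∈ S, f' i) ^ l * φ r = (∏ i ∈ S, f' i) ^ l * 0 at hl
  rw [mul_zero, hS, ← map_prod_eq hφ, ← map_pow, ← map_mul] at hl
  have h2 := (map_eq_zero_iff φ hinj).mp hl
  have hu := isUnit_algebraMap_loc f (Finset.Subset.refl s)
  have h3 := congrArg (algebraMap U (Loc f s)) h2
  rw [map_mul, map_pow, map_zero, ← hr, (hu.pow l).mul_right_eq_zero] at h3
  exact (hu.pow m).mul_left_eq_zero.mp h3

theorem homog_locMap {G G' : Type*} [AddCommGroup G] [AddCommGroup G'] {γ : Coaction G U}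
    {γ' : Coaction G' U'} {δ : ι → G} {δ' : ι' → G'} (hδ : ∀ i, γ.Homog (δ i) (f i))
    (hδ' : ∀ i, γ'.Homog (δ' i) (f' i)) (θ : G →+ G')
    (hθ : ∀ g a, γ.Homog g a → γ'.Homog (θ g) (φ a)) {s : Finset ι} {S : Finset ι'}
    (h : s.map e.toEmbedding ⊆ S) {g : G} {a : Loc f s} (ha : (locCo hδ s).Homog g a) :
    (locCo hδ' S).Homog (θ g) (locMap hφ h a) := by
  refine Coaction.homog_map_away θ _ (locMap hφ h) (fun g a ha => ?_) ha
  rw [locMap_algebraMap]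
  exact Coaction.homog_algebraMap _ (hθ g a ha)

variable [Fintype ι]

/-- The preimage of a finite set of indices. -/
def pr (e : ι ↪o ι') (S : Finset ι') : Finset ι := Finset.univ.filter fun i => e i ∈ S

theorem mem_pr {S : Finset ι'} {i : ι} : i ∈ pr e S ↔ e i ∈ S := by simp [pr]

theorem map_pr_subset (e : ι ↪o ι') (S : Finset ι') : (pr e S).map e.toEmbedding ⊆ S := by
  intro i hi
  obtain ⟨l, hl, rfl⟩ := Finset.mem_map.mp hi
  exact mem_pr.mp hl

theorem pr_erase (S : Finset ι') (i : ι) : pr e (S.erase (e i)) = (pr e S).erase i := by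
  ext l
  simp [mem_pr]

theorem pr_erase_of_ne {S : Finset ι'} {j : ι'} (hj : ∀ i, e i ≠ j) :
    pr e (S.erase j) = pr e S := by
  ext l
  simp [mem_pr, hj l]

/-- The finite sets of indices in the range of an embedding. -/
def InRange (e : ι ↪o ι') (S : Finset ι') : Prop := ∀ i ∈ S, ∃ l, e l = i

theorem InRange.eq_map {S : Finset ι'} (h : InRange e S) : S = (pr e S).map e.toEmbedding := by
  refine Finset.Subset.antisymm (fun i hi => ?_) (map_pr_subset e S)
  obtain ⟨l, rfl⟩ := h i hi
  exact Finset.mem_map_of_mem _ (mem_pr.mpr hi)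

theorem InRange.card {S : Finset ι'} (h : InRange e S) : (pr e S).card = S.card := by
  conv_rhs => rw [h.eq_map]
  rw [Finset.card_map]

theorem InRange.mono {S S' : Finset ι'} (h : InRange e S') (hS : S ⊆ S') : InRange e S :=
  fun i hi => h i (hS hi)

theorem pr_map (s : Finset ι) : pr e (s.map e.toEmbedding) = s := by
  ext i
  simp [mem_pr]

theorem inRange_map (s : Finset ι) : InRange e (s.map e.toEmbedding) := by
  intro i hi
  obtain ⟨l, -, rfl⟩ := Finset.mem_map.mp hi
  exact ⟨l, rfl⟩

theorem filter_lt_inter_range (S : Finset ι') (l : ι) :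
    ((pr e S).filter (· < l)).map e.toEmbedding = S.filter fun i => i < e l ∧ ∃ a, e a = i := by
  ext i
  simp only [Finset.mem_map, Finset.mem_filter, mem_pr]
  constructor
  · rintro ⟨a, ⟨ha, hal⟩, rfl⟩
    exact ⟨ha, e.lt_iff_lt.mpr hal, a, rfl⟩
  · rintro ⟨hi, hil, a, rfl⟩
    exact ⟨a, ⟨hi, e.lt_iff_lt.mp hil⟩, rfl⟩

theorem sgn_eq_sgn_pr {S : Finset ι'} {l : ι} (h : ∀ i ∈ S, i < e l → ∃ a, e a = i) :
    sgn (e l) S = sgn l (pr e S) := by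
  rw [sgn, sgn]
  simp only [mem_pr]
  split_ifs with hl
  · congr 1
    rw [← Finset.card_map (s := (pr e S).filter (· < l)) e.toEmbedding, filter_lt_inter_range]
    congr 1
    refine Finset.filter_congr fun i hi => ?_
    exact ⟨fun hil => ⟨hil, h i hi hil⟩, fun hil => hil.1⟩
  · rfl

variable [Fintype ι']

/-- The cochain `C` restricts to the image of the cochain `c` on the sets in the range of the
embedding of the indices. -/
def Matches (c : Cochain f) (C : Cochain f') : Prop :=
  ∀ S, InRange e S → C S = locMap hφ (map_pr_subset e S) (c (pr e S))

/-- Sets in the range are closed under erasing indices, so the differential there involves only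
indices from the embedded set, with the same signs. -/
theorem Matches.cDiff {c : Cochain f} {C : Cochain f'} (h : Matches hφ c C) :
    Matches hφ (cDiff f c) (cDiff f' C) := by
  intro S hS
  rw [cDiff_apply, cDiff_apply, map_sum,
    ← Finset.sum_subset (Finset.subset_univ (Finset.univ.map e.toEmbedding)) (fun i _ hi => by
      rw [sgn_of_notMem fun hiS => hi ?_]
      · simp
      · obtain ⟨l, rfl⟩ := hS i hiS
        exact Finset.mem_map_of_mem _ (Finset.mem_univ l)), Finset.sum_map]
  refine Finset.sum_congr rfl fun l _ => ?_
  change (sgn (e l) S : Loc f' S) * res f' (Finset.erase_subset (e l) S) (C (S.erase (e l))) = _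
  rw [map_mul, map_intCast, sgn_eq_sgn_pr fun i hi _ => hS i hi,
    h _ (hS.mono (Finset.erase_subset _ _)),
    res_locMap hφ _ _ ((map_pr_subset e _).trans (Finset.erase_subset _ _)),
    locMap_res hφ _ _ (by
      rw [← pr_erase]
      exact (map_pr_subset e _).trans (Finset.erase_subset _ _))]
  congr 1
  exact locMap_congr hφ (pr_erase S l) _ _ c

theorem Matches.frob_iterate {c : Cochain f} {C : Cochain f'} (h : Matches hφ c C) (p : ℕ)
    [Fact p.Prime] [CharP U p] [CharP U' p] (m : ℕ) :
    Matches hφ ((frob p)^[m] c) ((frob p)^[m] C) := by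
  intro S hS
  rw [frob_iterate_apply, frob_iterate_apply, h S hS, map_pow]

/-- The extension by zero of a cochain. -/
def extendZero (c : Cochain f) : Cochain f' := fun S =>
  open Classical in
  if InRange e S then locMap hφ (map_pr_subset e S) (c (pr e S)) else 0

theorem matches_extendZero (c : Cochain f) : Matches hφ c (extendZero hφ c) := fun _ hS =>
  if_pos hS

end LocMap

/-! ### The bigrading of a tensor product -/

section TensorCoaction

variable {k : Type*} [Field k] {R S : Type*} [CommRing R] [CommRing S] [Algebra k R] [Algebra k S]
  {γ : Coaction ℤ R} {γ' : Coaction ℤ S}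

/-- The first factor of the coaction on a tensor product. -/
def tensorHomLeft (hk : ∀ c : k, γ.Homog 0 (algebraMap k R c)) :
    R →ₐ[k] AddMonoidAlgebra (R ⊗[k] S) (ℤ × ℤ) where
  toRingHom := (AddMonoidAlgebra.mapDomainRingHom (R ⊗[k] S) (AddMonoidHom.inl ℤ ℤ)).comp
    ((AddMonoidAlgebra.mapRingHom ℤ
      (Algebra.TensorProduct.includeLeft : R →ₐ[k] R ⊗[k] S).toRingHom).comp γ.hom)
  commutes' c := by
    have h : γ.hom (algebraMap k R c) = AddMonoidAlgebra.single 0 (algebraMap k R c) := hk c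
    change AddMonoidAlgebra.mapDomainRingHom _ _ (AddMonoidAlgebra.mapRingHom ℤ _ (γ.hom _)) = _
    rw [h, AddMonoidAlgebra.mapRingHom_single, AddMonoidAlgebra.mapDomainRingHom_apply]
    erw [AddMonoidAlgebra.mapDomain_single]
    change AddMonoidAlgebra.single 0
      ((Algebra.TensorProduct.includeLeft : R →ₐ[k] R ⊗[k] S) (algebraMap k R c)) = _
    rw [AlgHom.commutes]
    rfl

theorem tensorHomLeft_of_homog (hk : ∀ c : k, γ.Homog 0 (algebraMap k R c)) {g : ℤ} {a : R}
    (ha : γ.Homog g a) : tensorHomLeft (S := S) hk a =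
      AddMonoidAlgebra.single (g, 0) (a ⊗ₜ[k] (1 : S)) := by
  have h : γ.hom a = AddMonoidAlgebra.single g a := ha
  change AddMonoidAlgebra.mapDomainRingHom _ _ (AddMonoidAlgebra.mapRingHom ℤ _ (γ.hom _)) = _
  rw [h, AddMonoidAlgebra.mapRingHom_single, AddMonoidAlgebra.mapDomainRingHom_apply]
  erw [AddMonoidAlgebra.mapDomain_single]
  rfl

/-- The second factor of the coaction on a tensor product. -/
def tensorHomRight (hk : ∀ c : k, γ'.Homog 0 (algebraMap k S c)) :
    S →ₐ[k] AddMonoidAlgebra (R ⊗[k] S) (ℤ × ℤ) where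
  toRingHom := (AddMonoidAlgebra.mapDomainRingHom (R ⊗[k] S) (AddMonoidHom.inr ℤ ℤ)).comp
    ((AddMonoidAlgebra.mapRingHom ℤ
      (Algebra.TensorProduct.includeRight : S →ₐ[k] R ⊗[k] S).toRingHom).comp γ'.hom)
  commutes' c := by
    have h : γ'.hom (algebraMap k S c) = AddMonoidAlgebra.single 0 (algebraMap k S c) := hk c
    change AddMonoidAlgebra.mapDomainRingHom _ _ (AddMonoidAlgebra.mapRingHom ℤ _ (γ'.hom _)) = _
    rw [h, AddMonoidAlgebra.mapRingHom_single, AddMonoidAlgebra.mapDomainRingHom_apply]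
    erw [AddMonoidAlgebra.mapDomain_single]
    change AddMonoidAlgebra.single 0
      ((Algebra.TensorProduct.includeRight : S →ₐ[k] R ⊗[k] S) (algebraMap k S c)) = _
    rw [AlgHom.commutes]
    rfl

theorem tensorHomRight_of_homog (hk : ∀ c : k, γ'.Homog 0 (algebraMap k S c)) {g : ℤ} {a : S}
    (ha : γ'.Homog g a) : tensorHomRight (R := R) hk a =
      AddMonoidAlgebra.single (0, g) ((1 : R) ⊗ₜ[k] a) := by
  have h : γ'.hom a = AddMonoidAlgebra.single g a := ha
  change AddMonoidAlgebra.mapDomainRingHom _ _ (AddMonoidAlgebra.mapRingHom ℤ _ (γ'.hom _)) = _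
  rw [h, AddMonoidAlgebra.mapRingHom_single, AddMonoidAlgebra.mapDomainRingHom_apply]
  erw [AddMonoidAlgebra.mapDomain_single]
  rfl

variable (hk : ∀ c : k, γ.Homog 0 (algebraMap k R c))
  (hk' : ∀ c : k, γ'.Homog 0 (algebraMap k S c))

theorem productMap_tmul {g h : ℤ} {a : R} {b : S} (ha : γ.Homog g a) (hb : γ'.Homog h b) :
    Algebra.TensorProduct.productMap (tensorHomLeft (S := S) hk) (tensorHomRight (R := R) hk')
      (a ⊗ₜ b) = AddMonoidAlgebra.single (g, h) (a ⊗ₜ[k] b) := by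
  rw [Algebra.TensorProduct.productMap_apply_tmul, tensorHomLeft_of_homog hk ha,
    tensorHomRight_of_homog hk' hb, AddMonoidAlgebra.single_mul_single,
    Algebra.TensorProduct.tmul_mul_tmul, mul_one, one_mul, Prod.mk_add_mk, add_zero, zero_add]

/-- The bigrading of a tensor product of graded rings. -/
def tensorCoaction : Coaction (ℤ × ℤ) (R ⊗[k] S) where
  hom := (Algebra.TensorProduct.productMap (tensorHomLeft hk) (tensorHomRight hk')).toRingHom
  closure_eq_top := by
    rw [eq_top_iff]
    rintro w -
    induction w with
    | zero => exact zero_mem _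
    | add v w hv hw => exact add_mem hv hw
    | tmul a b =>
      induction a using γ.induction with
      | hadd a a' h h' => rw [TensorProduct.add_tmul]; exact add_mem h h'
      | h g a ha =>
        induction b using γ'.induction with
        | hadd b b' h h' => rw [TensorProduct.tmul_add]; exact add_mem h h'
        | h g' b hb => exact AddSubmonoid.subset_closure ⟨(g, g'), productMap_tmul hk hk' ha hb⟩

theorem homog_tmul {g h : ℤ} {a : R} {b : S} (ha : γ.Homog g a) (hb : γ'.Homog h b) :
    (tensorCoaction hk hk').Homog (g, h) (a ⊗ₜ b) := productMap_tmul hk hk' ha hb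

theorem homog_tmul_one {g : ℤ} {a : R} (ha : γ.Homog g a) :
    (tensorCoaction hk hk').Homog (AddMonoidHom.inl ℤ ℤ g) (a ⊗ₜ[k] (1 : S)) :=
  homog_tmul hk hk' ha Coaction.Homog.one

theorem homog_one_tmul {g : ℤ} {b : S} (hb : γ'.Homog g b) :
    (tensorCoaction hk hk').Homog (AddMonoidHom.inr ℤ ℤ g) ((1 : R) ⊗ₜ[k] b) :=
  homog_tmul hk hk' Coaction.Homog.one hb

theorem proj_tmul (g h : ℤ) (a : R) (b : S) :
    (tensorCoaction hk hk').proj (g, h) (a ⊗ₜ b) = γ.proj g a ⊗ₜ γ'.proj h b := by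
  induction a using γ.induction with
  | hadd a a' ha ha' => rw [TensorProduct.add_tmul, map_add, ha, ha', map_add,
      TensorProduct.add_tmul]
  | h i a ha =>
    induction b using γ'.induction with
    | hadd b b' hb hb' => rw [TensorProduct.tmul_add, map_add, hb, hb', map_add,
        TensorProduct.tmul_add]
    | h j b hb =>
      rw [(homog_tmul hk hk' ha hb).proj_eq_ite, ha.proj_eq_ite, hb.proj_eq_ite]
      simp only [Prod.mk.injEq]
      split_ifs with h1 h2 h3 h3 <;> simp_all

variable {hk hk'} in
theorem eq_zero_of_homog_tensor (hneg : ∀ n < 0, ∀ a, γ.Homog n a → a = 0)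
    (hneg' : ∀ n < 0, ∀ a, γ'.Homog n a → a = 0) {g h : ℤ} (hgh : g < 0 ∨ h < 0)
    {w : R ⊗[k] S} (hw : (tensorCoaction hk hk').Homog (g, h) w) : w = 0 := by
  rw [← hw.proj_self]
  induction w with
  | zero => exact map_zero _
  | tmul a b =>
    rw [proj_tmul]
    rcases hgh with hg | hh
    · rw [hneg g hg _ (Coaction.homog_proj g a), TensorProduct.zero_tmul]
    · rw [hneg' h hh _ (Coaction.homog_proj h b), TensorProduct.tmul_zero]
  | add v w hv hw =>
    have h1 : ∀ v, (tensorCoaction hk hk').proj (g, h) v = 0 := by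
      intro v
      induction v with
      | zero => exact map_zero _
      | tmul a b =>
        rw [proj_tmul]
        rcases hgh with hg | hh
        · rw [hneg g hg _ (Coaction.homog_proj g a), TensorProduct.zero_tmul]
        · rw [hneg' h hh _ (Coaction.homog_proj h b), TensorProduct.tmul_zero]
      | add v w hv hw => rw [map_add, hv, hw, add_zero]
    exact h1 _

end TensorCoaction

/-! ### The Segre product as the diagonal of the bigrading -/

section SegreCoaction

variable {k : Type*} [Field k] {R S : Type*} [CommRing R] [CommRing S] [Algebra k R]
  [Algebra k S] (𝒜 : ℕ → Submodule k R) (ℬ : ℕ → Submodule k S) [GradedAlgebra 𝒜]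
  [GradedAlgebra ℬ]

/-- The bigrading of the tensor product of two graded algebras. -/
def bigrading : Coaction (ℤ × ℤ) (R ⊗[k] S) :=
  tensorCoaction (homog_zero_algebraMap 𝒜) (homog_zero_algebraMap ℬ)

theorem mem_segrePiece_of_homog {n : ℕ} {w : R ⊗[k] S}
    (hw : (bigrading 𝒜 ℬ).Homog ((n : ℤ), (n : ℤ)) w) : w ∈ segrePiece 𝒜 ℬ n := by
  have h : ∀ w, (bigrading 𝒜 ℬ).proj ((n : ℤ), (n : ℤ)) w ∈ segrePiece 𝒜 ℬ n := by
    intro w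
    induction w with
    | zero => rw [map_zero]; exact zero_mem _
    | add v w hv hw => rw [map_add]; exact add_mem hv hw
    | tmul a b =>
      rw [bigrading, proj_tmul, segrePiece_eq_span]
      exact Submodule.subset_span ⟨_, mem_of_homog 𝒜 (Coaction.homog_proj _ a), _,
        mem_of_homog ℬ (Coaction.homog_proj _ b), rfl⟩
  rw [← hw.proj_self]
  exact h w

/-- The diagonal. -/
def diagHom : ℤ →+ ℤ × ℤ := (AddMonoidHom.id ℤ).prod (AddMonoidHom.id ℤ)

theorem homog_of_mem_segrePiece {n : ℕ} {w : R ⊗[k] S} (hw : w ∈ segrePiece 𝒜 ℬ n) :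
    (bigrading 𝒜 ℬ).Homog (diagHom n) w := by
  rw [segrePiece_eq_span] at hw
  induction hw using Submodule.span_induction with
  | mem w hw =>
    obtain ⟨a, ha, b, hb, rfl⟩ := hw
    exact homog_tmul _ _ (homog_of_mem 𝒜 ha) (homog_of_mem ℬ hb)
  | zero => exact Coaction.Homog.zero _
  | add v w _ _ hv hw => exact hv.add hw
  | smul c w _ hw =>
    rw [Algebra.smul_def]
    have h : (bigrading 𝒜 ℬ).Homog 0 (algebraMap k (R ⊗[k] S) c) := by
      rw [Algebra.TensorProduct.algebraMap_apply]
      exact homog_tmul _ _ (homog_zero_algebraMap 𝒜 c) Coaction.Homog.one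
    have := h.mul hw
    rwa [zero_add] at this

theorem homog_segreProduct {n : ℤ} {t : segreProduct 𝒜 ℬ}
    (ht : (gradedCoaction (segreGrading 𝒜 ℬ)).Homog n t) :
    (bigrading 𝒜 ℬ).Homog (diagHom n) (t : R ⊗[k] S) := by
  by_cases hn : n < 0
  · rw [eq_zero_of_homog_neg _ hn ht]
    exact Coaction.Homog.zero _
  · lift n to ℕ using by omega
    have h : t ∈ segreGrading 𝒜 ℬ n := mem_of_homog (segreGrading 𝒜 ℬ) ht
    exact homog_of_mem_segrePiece 𝒜 ℬ h

theorem exists_homog_segreProduct {n : ℤ} {w : R ⊗[k] S}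
    (hw : (bigrading 𝒜 ℬ).Homog (diagHom n) w) :
    ∃ t : segreProduct 𝒜 ℬ, (gradedCoaction (segreGrading 𝒜 ℬ)).Homog n t ∧ (t : R ⊗[k] S) = w := by
  by_cases hn : n < 0
  · refine ⟨0, Coaction.Homog.zero _, ?_⟩
    rw [eq_zero_of_homog_tensor (fun _ h _ => eq_zero_of_homog_neg 𝒜 h)
      (fun _ h _ => eq_zero_of_homog_neg ℬ h) (Or.inl hn) hw]
    rfl
  · lift n to ℕ using by omega
    have h := mem_segrePiece_of_homog 𝒜 ℬ hw
    have h' : (⟨w, segrePiece_le 𝒜 ℬ n h⟩ : segreProduct 𝒜 ℬ) ∈ segreGrading 𝒜 ℬ n := h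
    exact ⟨⟨w, segrePiece_le 𝒜 ℬ n h⟩, homog_of_mem (segreGrading 𝒜 ℬ) h', rfl⟩

end SegreCoaction

/-! ### Subsets of an ordered union of three index sets -/

section Index

variable (X Y Z : Type*) [LinearOrder X] [LinearOrder Y] [LinearOrder Z]

/-- The ordered sum of three index sets. -/
abbrev Idx : Type _ := X ⊕ₗ (Y ⊕ₗ Z)

variable {X Y Z}

/-- The inclusion of the first index set. -/
def eX : X ↪o Idx X Y Z := OrderEmbedding.ofMapLEIff (fun i => toLex (Sum.inl i)) (by simp)

/-- The inclusion of the second index set. -/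
def eY : Y ↪o Idx X Y Z :=
  OrderEmbedding.ofMapLEIff (fun i => toLex (Sum.inr (toLex (Sum.inl i)))) (by simp)

/-- The inclusion of the third index set. -/
def eZ : Z ↪o Idx X Y Z :=
  OrderEmbedding.ofMapLEIff (fun i => toLex (Sum.inr (toLex (Sum.inr i)))) (by simp)

theorem idx_cases {p : Idx X Y Z → Prop} (hX : ∀ i, p (eX i)) (hY : ∀ i, p (eY i))
    (hZ : ∀ i, p (eZ i)) (i : Idx X Y Z) : p i := by
  rcases i with i | i | i
  exacts [hX i, hY i, hZ i]

theorem eX_lt_eY (i : X) (j : Y) : (eX i : Idx X Y Z) < eY j := Sum.Lex.sep _ _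

theorem eX_lt_eZ (i : X) (j : Z) : (eX i : Idx X Y Z) < eZ j := Sum.Lex.sep _ _

theorem eY_lt_eZ (i : Y) (j : Z) : (eY i : Idx X Y Z) < eZ j :=
  Sum.Lex.inr (Sum.Lex.sep _ _)

theorem sum_idx [Fintype X] [Fintype Y] [Fintype Z] {M : Type*} [AddCommMonoid M]
    (F : Idx X Y Z → M) : ∑ i, F i = ∑ i, F (eX i) + (∑ i, F (eY i) + ∑ i, F (eZ i)) := by
  have h1 := Fintype.sum_sum_type (f := fun i : X ⊕ (Y ⊕ₗ Z) => F i)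
  have h2 := Fintype.sum_sum_type (f := fun i : Y ⊕ Z => F (toLex (Sum.inr i)))
  exact h1.trans (congrArg _ h2)

/-- The set contains an index of the first kind. -/
def HasX (S : Finset (Idx X Y Z)) : Prop := ∃ i, eX i ∈ S

/-- The set contains an index of the second kind. -/
def HasY (S : Finset (Idx X Y Z)) : Prop := ∃ i, eY i ∈ S

/-- The set contains an index of the third kind. -/
def HasZ (S : Finset (Idx X Y Z)) : Prop := ∃ i, eZ i ∈ S

theorem HasX.mono {s t : Finset (Idx X Y Z)} (h : s ⊆ t) (hs : HasX s) : HasX t :=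
  hs.imp fun _ hi => h hi

theorem HasY.mono {s t : Finset (Idx X Y Z)} (h : s ⊆ t) (hs : HasY s) : HasY t :=
  hs.imp fun _ hi => h hi

theorem HasZ.mono {s t : Finset (Idx X Y Z)} (h : s ⊆ t) (hs : HasZ s) : HasZ t :=
  hs.imp fun _ hi => h hi

/-- The sets with indices of both the first and the second kind. -/
def PN (S : Finset (Idx X Y Z)) : Prop := HasX S ∧ HasY S

/-- The sets with an index of the third kind or with indices of both other kinds. -/
def PQ (S : Finset (Idx X Y Z)) : Prop := HasZ S ∨ PN S

/-- The sets with indices of two kinds. -/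
def PA (S : Finset (Idx X Y Z)) : Prop := PN S ∨ (HasZ S ∧ (HasX S ∨ HasY S))

/-- The sets with indices of the second kind and of another kind. -/
def PAY (S : Finset (Idx X Y Z)) : Prop := PN S ∨ (HasZ S ∧ HasY S)

/-- The sets with indices of the first kind and of another kind. -/
def PAX (S : Finset (Idx X Y Z)) : Prop := PN S ∨ (HasZ S ∧ HasX S)

theorem PN.mono {s t : Finset (Idx X Y Z)} (h : s ⊆ t) (hs : PN s) : PN t :=
  ⟨hs.1.mono h, hs.2.mono h⟩

theorem PQ.mono {s t : Finset (Idx X Y Z)} (h : s ⊆ t) (hs : PQ s) : PQ t :=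
  hs.imp (HasZ.mono h) (PN.mono h)

theorem PA.mono {s t : Finset (Idx X Y Z)} (h : s ⊆ t) (hs : PA s) : PA t :=
  hs.imp (PN.mono h) (And.imp (HasZ.mono h) (Or.imp (HasX.mono h) (HasY.mono h)))

theorem PAY.mono {s t : Finset (Idx X Y Z)} (h : s ⊆ t) (hs : PAY s) : PAY t :=
  hs.imp (PN.mono h) (And.imp (HasZ.mono h) (HasY.mono h))

theorem PAX.mono {s t : Finset (Idx X Y Z)} (h : s ⊆ t) (hs : PAX s) : PAX t :=
  hs.imp (PN.mono h) (And.imp (HasZ.mono h) (HasX.mono h))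

end Index

/-! ### Comparison of subquotients on the three index sets -/

section Chain

variable {X Y Z : Type*} [LinearOrder X] [LinearOrder Y] [LinearOrder Z]
  {U : Type*} [CommRing U] (f : Idx X Y Z → U)

/-- The cochains supported on the sets with an index of the third kind. -/
def famU : Fam f := suppFam f HasZ HasZ.mono

/-- The cochains supported on the sets with indices of both the first and the second kind. -/
def famN : Fam f := suppFam f PN PN.mono

/-- The cochains supported on `PQ`. -/
def famQ : Fam f := suppFam f PQ PQ.mono

/-- The cochains supported on `PA`. -/
def famA : Fam f := suppFam f PA PA.mono

/-- The cochains supported on `PAY`. -/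
def famAY : Fam f := suppFam f PAY PAY.mono

/-- The cochains supported on `PAX`. -/
def famAX : Fam f := suppFam f PAX PAX.mono

/-- The zero family. -/
def famZero : Fam f := suppFam f (fun _ => False) fun _ h => h

variable {f}

theorem sec_suppFam_mono {ι : Type*} [LinearOrder ι] {f : ι → U} {P P' : Finset ι → Prop}
    {hP : ∀ {s t}, s ⊆ t → P s → P t} {hP' : ∀ {s t}, s ⊆ t → P' s → P' t} (h : ∀ s, P s → P' s) :
    (suppFam f P hP).sec ≤ (suppFam f P' hP').sec := fun _ hc s hs => hc s fun hs' => hs (h s hs')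

theorem hasX_of_sdiff {s t : Finset (Idx X Y Z)} {e : Finset (Idx X Y Z)} (h : s \ e = t \ e)
    (he : ∀ i, eX i ∉ e) (hs : HasX s) : HasX t := by
  obtain ⟨i, hi⟩ := hs
  have : eX i ∈ t \ e := h ▸ Finset.mem_sdiff.mpr ⟨hi, he i⟩
  exact ⟨i, (Finset.mem_sdiff.mp this).1⟩

theorem hasY_of_sdiff {s t : Finset (Idx X Y Z)} {e : Finset (Idx X Y Z)} (h : s \ e = t \ e)
    (he : ∀ i, eY i ∉ e) (hs : HasY s) : HasY t := by
  obtain ⟨i, hi⟩ := hs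
  have : eY i ∈ t \ e := h ▸ Finset.mem_sdiff.mpr ⟨hi, he i⟩
  exact ⟨i, (Finset.mem_sdiff.mp this).1⟩

theorem hasZ_of_sdiff {s t : Finset (Idx X Y Z)} {e : Finset (Idx X Y Z)} (h : s \ e = t \ e)
    (he : ∀ i, eZ i ∉ e) (hs : HasZ s) : HasZ t := by
  obtain ⟨i, hi⟩ := hs
  have : eZ i ∈ t \ e := h ▸ Finset.mem_sdiff.mpr ⟨hi, he i⟩
  exact ⟨i, (Finset.mem_sdiff.mp this).1⟩

variable [Fintype X] [Fintype Y] [Fintype Z]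

/-- All indices of the first kind. -/
def allX : Finset (Idx X Y Z) := Finset.univ.map eX.toEmbedding

/-- All indices of the second kind. -/
def allY : Finset (Idx X Y Z) := Finset.univ.map eY.toEmbedding

/-- All indices of the third kind. -/
def allZ : Finset (Idx X Y Z) := Finset.univ.map eZ.toEmbedding

theorem mem_allX {i : Idx X Y Z} : i ∈ (allX : Finset (Idx X Y Z)) ↔ ∃ a, eX a = i := by
  simp [allX]

theorem mem_allY {i : Idx X Y Z} : i ∈ (allY : Finset (Idx X Y Z)) ↔ ∃ a, eY a = i := by
  simp [allY]

theorem mem_allZ {i : Idx X Y Z} : i ∈ (allZ : Finset (Idx X Y Z)) ↔ ∃ a, eZ a = i := by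
  simp [allZ]

theorem eX_notMem_allY (i : X) : (eX i : Idx X Y Z) ∉ (allY : Finset (Idx X Y Z)) := fun h => by
  obtain ⟨a, ha⟩ := mem_allY.mp h
  exact (eX_lt_eY i a).ne' ha

theorem eX_notMem_allZ (i : X) : (eX i : Idx X Y Z) ∉ (allZ : Finset (Idx X Y Z)) := fun h => by
  obtain ⟨a, ha⟩ := mem_allZ.mp h
  exact (eX_lt_eZ i a).ne' ha

theorem eY_notMem_allX (i : Y) : (eY i : Idx X Y Z) ∉ (allX : Finset (Idx X Y Z)) := fun h => by
  obtain ⟨a, ha⟩ := mem_allX.mp h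
  exact (eX_lt_eY a i).ne ha

theorem eY_notMem_allZ (i : Y) : (eY i : Idx X Y Z) ∉ (allZ : Finset (Idx X Y Z)) := fun h => by
  obtain ⟨a, ha⟩ := mem_allZ.mp h
  exact (eY_lt_eZ i a).ne' ha

theorem eZ_notMem_allX (i : Z) : (eZ i : Idx X Y Z) ∉ (allX : Finset (Idx X Y Z)) := fun h => by
  obtain ⟨a, ha⟩ := mem_allX.mp h
  exact (eX_lt_eZ a i).ne ha

theorem eZ_notMem_allY (i : Z) : (eZ i : Idx X Y Z) ∉ (allY : Finset (Idx X Y Z)) := fun h => by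
  obtain ⟨a, ha⟩ := mem_allY.mp h
  exact (eY_lt_eZ a i).ne ha

theorem prod_mem_radical {s : Finset (Idx X Y Z)} {I : Ideal U} {i : Idx X Y Z} (hi : i ∈ s)
    (h : f i ∈ I.radical) : ∏ i ∈ s, f i ∈ I.radical := by
  obtain ⟨a, ha⟩ := Finset.dvd_prod_of_mem f hi
  rw [ha]
  exact Ideal.mul_mem_right _ _ h

theorem prod_mem_radical_of_mul {ι : Type*} [LinearOrder ι] {f : ι → U} {s : Finset ι}
    {I : Ideal U} {i j : ι} (hij : i ≠ j) (hi : i ∈ s) (hj : j ∈ s) (h : f i * f j ∈ I.radical) :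
    ∏ i ∈ s, f i ∈ I.radical := by
  rw [← Finset.mul_prod_erase _ _ hi,
    ← Finset.mul_prod_erase _ _ (Finset.mem_erase.mpr ⟨hij.symm, hj⟩), ← mul_assoc]
  exact Ideal.mul_mem_right _ _ h

/-- The comparison of relative cohomology groups that relates the Čech complex of a Segre product
with that of the tensor product. -/
theorem nilDeg_chain (hX : ∀ l, f (eZ l) ∈ (Ideal.span (f '' ↑(allX : Finset (Idx X Y Z)))).radical)
    (hY : ∀ l, f (eZ l) ∈ (Ideal.span (f '' ↑(allY : Finset (Idx X Y Z)))).radical)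
    (hZ : ∀ i j, f (eX i) * f (eY j) ∈ (Ideal.span (f '' ↑(allZ : Finset (Idx X Y Z)))).radical)
    {G : Type*} [AddCommGroup G] {γ : Coaction G U} {δ : Idx X Y Z → G}
    (hδ : ∀ i, γ.Homog (δ i) (f i)) (p : ℕ) [Fact p.Prime] [CharP U p] (j : ℤ) (g : G) :
    NilDeg p hδ (famQ f) (famA f) j g ↔ NilDeg p hδ (famQ f) (famU f) (j + 1) g := by
  -- In each of the four acyclic pairs, the sets in the difference may be freely enlarged by the
  -- indices of one kind: first for `famU` and `famQ / famAY`, second for `famQ / famAX`, third for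
  -- `famN`. The hypotheses put the product over the other indices into the radical of the ideal of
  -- that kind, as `acyclic_rows` requires.
  have hU0 : Acyclic (famU f) (famZero f) := by
    refine acyclic_rows allX _ _ (fun s h => h.elim) (fun s t hst h => ?_) (fun s hs _ => ?_)
    · exact ⟨hasZ_of_sdiff hst eZ_notMem_allX h.1, id⟩
    · obtain ⟨l, hl⟩ := hs
      exact prod_mem_radical (Finset.mem_sdiff.mpr ⟨hl, eZ_notMem_allX l⟩) (hX l)
  have hN0 : Acyclic (famN f) (famZero f) := by
    refine acyclic_rows allZ _ _ (fun s h => h.elim) (fun s t hst h => ?_) (fun s hs _ => ?_)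
    · exact ⟨⟨hasX_of_sdiff hst eX_notMem_allZ h.1.1, hasY_of_sdiff hst eY_notMem_allZ h.1.2⟩, id⟩
    · obtain ⟨⟨a, ha⟩, b, hb⟩ := hs
      exact prod_mem_radical_of_mul (eX_lt_eY a b).ne
        (Finset.mem_sdiff.mpr ⟨ha, eX_notMem_allZ a⟩)
        (Finset.mem_sdiff.mpr ⟨hb, eY_notMem_allZ b⟩) (hZ a b)
  have hQX : Acyclic (famQ f) (famAX f) := by
    refine acyclic_rows allY _ _ (fun s h => ?_) (fun s t hst h => ?_) (fun s hs hs' => ?_)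
    · exact h.elim Or.inr fun h => Or.inl h.1
    · have h1 := hasZ_of_sdiff hst eZ_notMem_allY
      have h2 := hasX_of_sdiff hst.symm eX_notMem_allY
      unfold PQ PAX PN at *
      tauto
    · obtain ⟨l, hl⟩ : HasZ s := by
        unfold PQ PAX at *
        tauto
      exact prod_mem_radical (Finset.mem_sdiff.mpr ⟨hl, eZ_notMem_allY l⟩) (hY l)
  have hQY : Acyclic (famQ f) (famAY f) := by
    refine acyclic_rows allX _ _ (fun s h => ?_) (fun s t hst h => ?_) (fun s hs hs' => ?_)
    · exact h.elim Or.inr fun h => Or.inl h.1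
    · have h1 := hasZ_of_sdiff hst eZ_notMem_allX
      have h2 := hasY_of_sdiff hst.symm eY_notMem_allX
      unfold PQ PAY PN at *
      tauto
    · obtain ⟨l, hl⟩ : HasZ s := by
        unfold PQ PAY at *
        tauto
      exact prod_mem_radical (Finset.mem_sdiff.mpr ⟨hl, eZ_notMem_allX l⟩) (hX l)
  have hom : ∀ {P : Finset (Idx X Y Z) → Prop} {hP : ∀ {s t}, s ⊆ t → P s → P t},
      (suppFam f P hP).Homog hδ := homog_suppFam
  -- The chain is `Q / A`, `A / AX`, `AY / N`, `Q / N`, `Q / 0`, `Q / U`. Only this first step is a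
  -- connecting map and raises the cohomological degree.
  have h1 : NilDeg p hδ (famQ f) (famA f) j g ↔ NilDeg p hδ (famA f) (famAX f) (j + 1) g :=
    nilDeg_iff_of_acyclic_total (sec_suppFam_mono fun s h => by unfold PA PQ at *; tauto)
      (sec_suppFam_mono fun s h => by unfold PA PAX at *; tauto) hom hom hQX j g
  have h3 : NilDeg p hδ (famAY f) (famN f) (j + 1) g ↔ NilDeg p hδ (famQ f) (famN f) (j + 1) g :=
    nilDeg_iff_of_acyclic_quot (sec_suppFam_mono fun s h => by unfold PAY PQ at *; tauto)
      (sec_suppFam_mono fun s h => by unfold PAY at *; tauto) hom hom hQY (j + 1) g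
  have h4 : NilDeg p hδ (famQ f) (famZero f) (j + 1) g ↔
      NilDeg p hδ (famQ f) (famN f) (j + 1) g :=
    nilDeg_iff_of_acyclic_sub (sec_suppFam_mono fun s h => by unfold PQ at *; tauto)
      (sec_suppFam_mono fun s h => by tauto) hom hom hN0 (j + 1) g
  have h5 : NilDeg p hδ (famQ f) (famZero f) (j + 1) g ↔
      NilDeg p hδ (famQ f) (famU f) (j + 1) g :=
    nilDeg_iff_of_acyclic_sub (sec_suppFam_mono fun s h => by unfold PQ at *; tauto)
      (sec_suppFam_mono fun s h => by tauto) hom hom hU0 (j + 1) g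
  rw [h1, ← h5, h4, ← h3]
  symm
  -- Excision applies since `PA` is the union of `PAY` and `PAX`, and their intersection is `PN`.
  refine nilDeg_iff_of_excision (sec_suppFam_mono fun s h => by unfold PA PAY at *; tauto)
    (sec_suppFam_mono fun s h => by unfold PAX at *; tauto) ?_ ?_ hom hom (j + 1) g
  · intro c hc hc' s hs
    by_cases h1 : PAY s
    · refine hc' s fun h2 => hs ?_
      unfold PAY PAX PN at *
      tauto
    · exact hc s h1
  · intro c hc
    classical
    refine ⟨fun s => if PAY s then c s else 0, fun s hs => if_neg hs, fun s hs => ?_⟩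
    rw [Pi.sub_apply]
    split_ifs with h
    · exact sub_self _
    · rw [sub_zero]
      refine hc s ?_
      unfold PA PAY PAX at *
      tauto

end Chain

/-! ### Descending cochains to a subring -/

section Matching

variable {U U' : Type*} [CommRing U] [CommRing U'] {ι ι' : Type*} [LinearOrder ι] [LinearOrder ι']
  [Fintype ι] [Fintype ι'] {f : ι → U} {f' : ι' → U'} {φ : U →+* U'} {e : ι ↪o ι'}
  {hφ : ∀ i, φ (f i) = f' (e i)}

theorem matches_of_map {c : Cochain f} {C : Cochain f'}
    (h : ∀ s, C (s.map e.toEmbedding) = locMap hφ (Finset.Subset.refl _) (c s)) :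
    Matches hφ c C := by
  intro S hS
  have key : ∀ S' (_ : S' = S) (h' : (pr e S).map e.toEmbedding ⊆ S'),
      C S' = locMap hφ h' (c (pr e S)) → C S = locMap hφ (map_pr_subset e S) (c (pr e S)) := by
    rintro _ rfl h' h
    exact h
  exact key _ hS.eq_map.symm _ (h (pr e S))

theorem Matches.map {c : Cochain f} {C : Cochain f'} (h : Matches hφ c C) (s : Finset ι) :
    C (s.map e.toEmbedding) = locMap hφ (Finset.Subset.refl _) (c s) :=
  (h _ (inRange_map s)).trans (locMap_congr hφ (pr_map s) _ _ c)

theorem Matches.eq_of_map_eq {c c' : Cochain f} {C C' : Cochain f'} (h : Matches hφ c C)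
    (h' : Matches hφ c' C') (hinj : Function.Injective φ) {s : Finset ι}
    (hs : C (s.map e.toEmbedding) = C' (s.map e.toEmbedding)) : c s = c' s := by
  rw [h.map, h'.map] at hs
  exact locMap_injective hφ hinj _ rfl hs

theorem matches_zero : Matches hφ (0 : Cochain f) (0 : Cochain f') := fun _ _ =>
  (map_zero _).symm

variable {G G' : Type*} [AddCommGroup G] [AddCommGroup G'] {γ : Coaction G U}
  {γ' : Coaction G' U'} {δ : ι → G} {δ' : ι' → G'} {hδ : ∀ i, γ.Homog (δ i) (f i)}
  {hδ' : ∀ i, γ'.Homog (δ' i) (f' i)} {θ : G →+ G'}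

/-- The denominators have degrees in the image of `θ`, so the numerator has one too and comes from
the subring by `hsurj`. -/
theorem exists_locMap_eq (hφ : ∀ i, φ (f i) = f' (e i)) (hδθ : ∀ i, δ' (e i) = θ (δ i))
    (hsurj : ∀ g w, γ'.Homog (θ g) w → ∃ u, γ.Homog g u ∧ φ u = w) {s : Finset ι} {g : G}
    {w : Loc f' (s.map e.toEmbedding)}
    (hw : (locCo hδ' (s.map e.toEmbedding)).Homog (θ g) w) :
    ∃ a : Loc f s, (locCo hδ s).Homog g a ∧ locMap hφ (Finset.Subset.refl _) a = w := by
  obtain ⟨m, u, hu, huw⟩ := Coaction.exists_homog_of_homog_away _ hw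
  have h1 : ∑ i ∈ s.map e.toEmbedding, δ' i = θ (∑ i ∈ s, δ i) := by
    rw [Finset.sum_map, map_sum]
    exact Finset.sum_congr rfl fun i _ => hδθ i
  rw [h1, ← map_nsmul, ← map_add] at hu
  obtain ⟨r, hr, rfl⟩ := hsurj _ _ hu
  obtain ⟨t, ht⟩ := (isUnit_algebraMap_loc f (Finset.Subset.refl s)).pow m
  have h2 : algebraMap U (Loc f s) r * ↑t⁻¹ * algebraMap U _ (∏ i ∈ s, f i) ^ m =
      algebraMap U _ r := by rw [← ht, Units.inv_mul_cancel_right]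
  refine ⟨algebraMap U _ r * ↑t⁻¹, Coaction.homog_of_mul_eq _ hr h2, ?_⟩
  have h3 := congrArg (locMap hφ (Finset.Subset.refl (s.map e.toEmbedding))) h2
  rw [map_mul, map_pow, locMap_algebraMap, locMap_algebraMap, map_prod_eq hφ, ← huw] at h3
  exact ((isUnit_algebraMap_loc f' (Finset.Subset.refl _)).pow m).mul_left_injective h3

theorem exists_matches (hφ : ∀ i, φ (f i) = f' (e i)) (hδθ : ∀ i, δ' (e i) = θ (δ i))
    (hsurj : ∀ g w, γ'.Homog (θ g) w → ∃ u, γ.Homog g u ∧ φ u = w) {g : G} {C : Cochain f'}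
    (hC : ∀ S, (locCo hδ' S).Homog (θ g) (C S)) :
    ∃ c : Cochain f, Matches hφ c C ∧ ∀ s, (locCo hδ s).Homog g (c s) := by
  have h : ∀ s, ∃ a : Loc f s, (locCo hδ s).Homog g a ∧
      locMap hφ (Finset.Subset.refl _) a = C (s.map e.toEmbedding) := fun s =>
    exists_locMap_eq (hδ := hδ) (hδ' := hδ') (w := C (s.map e.toEmbedding)) hφ hδθ hsurj (hC _)
  choose c hc hc' using h
  exact ⟨c, matches_of_map fun s => (hc' s).symm, hc⟩

end Matching

/-! ### From the Čech complex of the subring to the pair `famQ / famA` -/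

section SegreComparison

variable {X Y Z : Type*} [LinearOrder X] [LinearOrder Y] [LinearOrder Z] [Fintype X] [Fintype Y]
  [Fintype Z] {U U' : Type*} [CommRing U] [CommRing U'] {z : Z → U} {f : Idx X Y Z → U'}
  {φ : U →+* U'}

theorem inRange_eZ_iff {S : Finset (Idx X Y Z)} :
    InRange (eZ : Z ↪o Idx X Y Z) S ↔ ¬ HasX S ∧ ¬ HasY S := by
  constructor
  · intro h
    refine ⟨fun ⟨i, hi⟩ => ?_, fun ⟨i, hi⟩ => ?_⟩
    · obtain ⟨l, hl⟩ := h _ hi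
      exact (eX_lt_eZ i l).ne' hl
    · obtain ⟨l, hl⟩ := h _ hi
      exact (eY_lt_eZ i l).ne' hl
  · rintro ⟨hX, hY⟩
    exact idx_cases (fun i hi => absurd ⟨i, hi⟩ hX) (fun i hi => absurd ⟨i, hi⟩ hY)
      fun i _ => ⟨i, rfl⟩

theorem not_PA_of_inRange {S : Finset (Idx X Y Z)} (h : InRange (eZ : Z ↪o Idx X Y Z) S) :
    ¬ PA S := by
  have := inRange_eZ_iff.mp h
  unfold PA PN
  tauto

/-- With `not_PA_of_inRange` this shows that the quotient `famQ / famA` lives exactly on the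
nonempty sets of indices of the third kind. -/
theorem not_PQ_of_not_inRange {S : Finset (Idx X Y Z)} (h : ¬ InRange (eZ : Z ↪o Idx X Y Z) S)
    (hA : ¬ PA S) : ¬ PQ S := by
  have := mt inRange_eZ_iff.mpr h
  unfold PQ PA PN at *
  tauto

theorem pr_eq_empty_of_not_PQ {S : Finset (Idx X Y Z)} (h : ¬ PQ S) :
    pr (eZ : Z ↪o Idx X Y Z) S = ∅ := by
  rw [Finset.eq_empty_iff_forall_notMem]
  intro l hl
  exact h (Or.inl ⟨l, mem_pr.mp hl⟩)

theorem extendZero_mem_famQ {hφ : ∀ l, φ (z l) = f (eZ l)} {c : Cochain z}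
    (hc : c ∅ = 0) : extendZero hφ c ∈ (famQ f).sec := by
  intro S hS
  rw [extendZero]
  split_ifs
  · have key : ∀ s (_ : s = ∅), c s = 0 := by
      rintro s rfl
      exact hc
    rw [key _ (pr_eq_empty_of_not_PQ hS), map_zero]
  · rfl

variable {γ : Coaction ℤ U} {G : Type*} [AddCommGroup G] {γ' : Coaction G U'} {δ : Z → ℤ}
  {δ' : Idx X Y Z → G} {hδ : ∀ i, γ.Homog (δ i) (z i)} {hδ' : ∀ i, γ'.Homog (δ' i) (f i)}
  {θ : ℤ →+ G} (p : ℕ) [Fact p.Prime] [CharP U p] [CharP U' p]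

/-- The cohomology of the relative Čech complex on the third index set in the degrees of a
subring. -/
theorem nilDeg_subring_iff (hφ : ∀ l, φ (z l) = f (eZ l)) (hinj : Function.Injective φ)
    (hneg : ∀ n < 0, ∀ a, γ.Homog n a → a = 0) (hδθ : ∀ l, δ' (eZ l) = θ (δ l))
    (hθ : ∀ g a, γ.Homog g a → γ'.Homog (θ g) (φ a))
    (hsurj : ∀ g w, γ'.Homog (θ g) w → ∃ u, γ.Homog g u ∧ φ u = w) (j : ℤ) {n : ℤ} (hn : n < 0) :
    NilDeg p hδ (idealFam z ⊤) (idealFam z ⊥) j n ↔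
      NilDeg p hδ' (famQ f) (famA f) j (θ n) := by
  constructor
  · intro H C hC hdeg hdC
    obtain ⟨c, hcC, hc⟩ := exists_matches (hδ := hδ) hφ hδθ hsurj hdeg.homog
    have hdc : cDiff z c = 0 := by
      funext s
      by_cases hs : s = ∅
      · subst hs
        exact cDiff_empty c
      · exact (hcC.cDiff hφ).eq_of_map_eq (matches_zero (hφ := hφ)) hinj
          (hdC _ (not_PA_of_inRange (inRange_map s)))
    obtain ⟨m, hm⟩ := H c (mem_sec_top _) ⟨fun s hs => hcC.eq_of_map_eq
      (matches_zero (hφ := hφ)) hinj (hdeg.card _ (by rwa [Finset.card_map])), hc⟩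
      (mem_sec_bot.mpr hdc)
    obtain ⟨b, hb⟩ := mem_bd_top_bot.mp hm
    have hcm := cProj_frob_iterate (p := p) (hδ := hδ) (funext fun s => (hc s).proj_self) m
    rw [← hb, ← cDiff_cProj] at hcm
    have hpm : (p ^ m : ℤ) * n < 0 :=
      mul_neg_of_pos_of_neg (by exact_mod_cast pow_pos (pos_of_prime p) m) hn
    -- Projecting to a negative degree kills the component at `∅`; otherwise the extension by zero
    -- would not lie in `famQ`.
    set b' := cProj hδ (p ^ m * n) b with hb'
    have hB := extendZero_mem_famQ (hφ := hφ) (c := b')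
      (loc_empty_eq_zero hneg hpm (Coaction.homog_proj _ (b ∅)))
    refine ⟨m, mem_bd.mpr ⟨_, hB, (frob p)^[m] C - cDiff f (extendZero hφ b'), ?_,
      add_sub_cancel _ _⟩⟩
    intro S hS
    rw [Pi.sub_apply]
    by_cases hr : InRange eZ S
    · rw [(matches_extendZero hφ b').cDiff hφ S hr, hcC.frob_iterate hφ p m S hr, hcm, hb, sub_self]
    · have hS' := not_PQ_of_not_inRange hr hS
      rw [Fam.frob_iterate_mem p hC m S hS', Fam.cDiff_mem hB S hS', sub_self]
  · intro H c _ hdeg hdc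
    have hc0 : c ∅ = 0 := loc_empty_eq_zero hneg hn (hdeg.homog ∅)
    have hC := extendZero_mem_famQ (hφ := hφ) hc0
    have hCm := matches_extendZero hφ c
    have hdeg' : IsDeg hδ' j (θ n) (extendZero hφ c) := by
      refine ⟨fun S hS => ?_, fun S => ?_⟩
      · rw [extendZero]
        split_ifs with hr
        · rw [hdeg.card _ (by rwa [hr.card]), map_zero]
        · rfl
      · rw [extendZero]
        split_ifs with hr
        · exact homog_locMap hφ hδ hδ' θ hθ _ (hdeg.homog _)
        · exact Coaction.Homog.zero _
    have hdc0 := mem_sec_bot.mp hdc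
    obtain ⟨m, hm⟩ := H _ hC hdeg' (by
      intro S hS
      by_cases hr : InRange eZ S
      · rw [hCm.cDiff hφ S hr, hdc0]
        exact map_zero _
      · exact Fam.cDiff_mem hC S (not_PQ_of_not_inRange hr hS))
    obtain ⟨B, hB, A, hA, hBA⟩ := mem_bd.mp hm
    have hfro := hdeg'.frob_iterate m
    rw [← map_nsmul] at hfro
    -- Only cochains whose degree is in the image of `θ` descend to the subring, so the equation is
    -- first projected to such a degree.
    have h1 : cDiff f (cProj hδ' (θ (p ^ m • n)) B) + cProj hδ' (θ (p ^ m • n)) A =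
        (frob p)^[m] (extendZero hφ c) := by
      rw [cDiff_cProj, ← map_add, hBA]
      exact funext fun S => (hfro.homog S).proj_self
    have hA' : cProj hδ' (θ (p ^ m • n)) A ∈ (famA f).sec := homog_suppFam.cProj_mem hA _
    obtain ⟨b, hbB, -⟩ := exists_matches (hδ := hδ) hφ hδθ hsurj
      (C := cProj hδ' (θ (p ^ m • n)) B) (fun S => Coaction.homog_proj _ (B S))
    refine ⟨m, mem_bd_top_bot.mpr ⟨b, funext fun s => ?_⟩⟩
    by_cases hs : s = ∅
    · subst hs
      rw [cDiff_empty, frob_iterate_apply, hc0, zero_pow (pow_pos (pos_of_prime p) m).ne']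
    · refine (hbB.cDiff hφ).eq_of_map_eq (hCm.frob_iterate hφ p m) hinj ?_
      rw [← h1, Pi.add_apply, hA' _ (not_PA_of_inRange (inRange_map s)), add_zero]

end SegreComparison

/-! ### Künneth for complexes of vector spaces -/

section KunnethAlgebra

variable {k : Type*} [Field k] {A B : Type*} [AddCommGroup A] [AddCommGroup B] [Module k A]
  [Module k B]

/-- A linear endomorphism of a vector space has a generalized inverse. -/
theorem exists_generalizedInverse (d : A →ₗ[k] A) : ∃ h : A →ₗ[k] A, ∀ a, d (h (d a)) = d a := by
  obtain ⟨g, hg⟩ := d.rangeRestrict.exists_rightInverse_of_surjective d.range_rangeRestrict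
  obtain ⟨h, hh⟩ := LinearMap.exists_extend g
  refine ⟨h, fun a => ?_⟩
  have h1 := DFunLike.congr_fun hh ⟨d a, a, rfl⟩
  have h2 := congrArg Subtype.val (DFunLike.congr_fun hg ⟨d a, a, rfl⟩)
  change h (d a) = _ at h1
  rw [h1]
  exact h2

/-- The differential of the tensor product of two complexes. -/
def tensorDiff (dA sA : A →ₗ[k] A) (dB : B →ₗ[k] B) : A ⊗[k] B →ₗ[k] A ⊗[k] B :=
  TensorProduct.map dA LinearMap.id + TensorProduct.map sA dB

theorem tensorDiff_tmul (dA sA : A →ₗ[k] A) (dB : B →ₗ[k] B) (a : A) (b : B) :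
    tensorDiff dA sA dB (a ⊗ₜ b) = dA a ⊗ₜ b + sA a ⊗ₜ dB b := rfl

/-- If `a` is not a boundary, some functional is nonzero at `a` and vanishes on boundaries.
Contracting the first factor with it turns the equation into one that exhibits `b` as a boundary. -/
theorem mem_range_of_tmul_eq {dA sA : A →ₗ[k] A} {dB : B →ₗ[k] B} {a : A} {b : B}
    {u : A ⊗[k] B} (h : tensorDiff dA sA dB u = a ⊗ₜ b) : (∃ a', dA a' = a) ∨ ∃ b', dB b' = b := by
  by_cases ha : a ∈ LinearMap.range dA
  · exact Or.inl ha
  · right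
    obtain ⟨l, hla, hl⟩ := Submodule.exists_le_ker_of_notMem ha
    let L : (A →ₗ[k] k) → A ⊗[k] B →ₗ[k] B := fun l =>
      (TensorProduct.lid k B).toLinearMap ∘ₗ TensorProduct.map l LinearMap.id
    have hL : ∀ u, L l (tensorDiff dA sA dB u) = dB (L (l ∘ₗ sA) u) := by
      intro u
      induction u with
      | zero => simp
      | add u v hu hv => rw [map_add, map_add, hu, hv, map_add, map_add]
      | tmul a b =>
        have h0 : l (dA a) = 0 := hl ⟨a, rfl⟩
        simp [L, tensorDiff_tmul, h0]
    refine ⟨(l a)⁻¹ • L (l ∘ₗ sA) u, ?_⟩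
    rw [map_smul, ← hL, h]
    simp [L, smul_smul, hla]

/-- Over a field each complex is homotopic to one with zero differential. Applying the homotopies in
the two factors successively moves a cycle, up to a boundary, into sums of tensors of cocycles. -/
theorem exists_eq_cocycles_add {dA sA eA : A →ₗ[k] A} {dB : B →ₗ[k] B} (hdA : ∀ a, dA (dA a) = 0)
    (hdB : ∀ b, dB (dB b) = 0) (hee : ∀ a, eA (eA a) = eA a) (hs : ∀ a, sA a = eA a + eA a - a)
    (hed : ∀ a, eA (dA a) + dA (eA a) = dA a) {u : A ⊗[k] B} (hu : tensorDiff dA sA dB u = 0) :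
    ∃ t ∈ AddSubmonoid.closure {t : A ⊗[k] B | ∃ a b, dA a = 0 ∧ dB b = 0 ∧ a ⊗ₜ b = t},
      ∃ w, u = t + tensorDiff dA sA dB w := by
  obtain ⟨h₀, hh₀⟩ := exists_generalizedInverse dA
  obtain ⟨g, hg⟩ := exists_generalizedInverse dB
  -- The parity-reversing part of `h₀`: it is still a generalized inverse and anticommutes with the
  -- sign `sA`. Using the even projection `eA` avoids dividing by `2`.
  let h : A →ₗ[k] A := eA ∘ₗ h₀ ∘ₗ (LinearMap.id - eA) + (LinearMap.id - eA) ∘ₗ h₀ ∘ₗ eA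
  have hh : ∀ a, h a = eA (h₀ (a - eA a)) + (h₀ (eA a) - eA (h₀ (eA a))) := fun a => rfl
  have hde : ∀ a, dA (eA a) = dA a - eA (dA a) := fun a => eq_sub_of_add_eq' (hed a)
  have hdhd : ∀ a, dA (h (dA a)) = dA a := by
    intro a
    have h1 : dA (h₀ (eA (dA a))) = eA (dA a) := by
      have h2 : eA (dA a) = dA (a - eA a) := by rw [map_sub, hde]; abel
      rw [h2, hh₀]
    simp only [hh, map_add, map_sub, hde, h1, hh₀, hee]
    abel
  have hsh : ∀ a, sA (h a) + h (sA a) = 0 := by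
    intro a
    simp only [hs, hh, map_add, map_sub, hee]
    abel
  have hss : ∀ a, sA (sA a) = a := by
    intro a
    simp only [hs, map_add, map_sub, hee]
    abel
  have hsd : ∀ a, sA (dA a) + dA (sA a) = 0 := by
    intro a
    simp only [hs, map_add, map_sub, hde]
    abel
  let P : A →ₗ[k] A := LinearMap.id - dA ∘ₗ h - h ∘ₗ dA
  let Q : B →ₗ[k] B := LinearMap.id - dB ∘ₗ g - g ∘ₗ dB
  have hP : ∀ a, P a = a - dA (h a) - h (dA a) := fun a => rfl
  have hQ : ∀ b, Q b = b - dB (g b) - g (dB b) := fun b => rfl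
  have hdP : ∀ a, dA (P a) = 0 := by
    intro a
    rw [hP, map_sub, map_sub, hdA, hdhd]
    abel
  have hdQ : ∀ b, dB (Q b) = 0 := by
    intro b
    rw [hQ, map_sub, map_sub, hdB, hg]
    abel
  have hDD : ∀ u, tensorDiff dA sA dB (tensorDiff dA sA dB u) = 0 := by
    intro u
    induction u with
    | zero => simp
    | add u v hu hv => rw [map_add, map_add, hu, hv, add_zero]
    | tmul a b =>
      rw [tensorDiff_tmul, map_add, tensorDiff_tmul, tensorDiff_tmul, hdA, hdB,
        TensorProduct.zero_tmul, TensorProduct.tmul_zero, zero_add, add_zero,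
        ← TensorProduct.add_tmul, hsd, TensorProduct.zero_tmul]
  -- The maps `h ⊗ 1` here and `sA ⊗ g` in `h3` are homotopies from the identity to `P ⊗ 1` and `1 ⊗
  -- Q`; `P` and `Q` take values in cocycles.
  have h1 : ∀ u, u = TensorProduct.map P LinearMap.id u +
      tensorDiff dA sA dB (TensorProduct.map h LinearMap.id u) +
      TensorProduct.map h LinearMap.id (tensorDiff dA sA dB u) := by
    intro u
    induction u with
    | zero => simp
    | add u v hu hv =>
      conv_lhs => rw [hu, hv]
      simp only [map_add]
      abel
    | tmul a b =>
      have h2 := hsh a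
      rw [add_eq_zero_iff_eq_neg] at h2
      simp only [TensorProduct.map_tmul, tensorDiff_tmul, LinearMap.id_apply, map_add, hP, h2,
        TensorProduct.sub_tmul, TensorProduct.neg_tmul]
      abel
  have h3 : ∀ u, u = TensorProduct.map LinearMap.id Q u +
      tensorDiff dA sA dB (TensorProduct.map sA g u) +
      TensorProduct.map sA g (tensorDiff dA sA dB u) := by
    intro u
    induction u with
    | zero => simp
    | add u v hu hv =>
      conv_lhs => rw [hu, hv]
      simp only [map_add]
      abel
    | tmul a b =>
      have h2 := hsd a
      rw [add_eq_zero_iff_eq_neg] at h2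
      simp only [TensorProduct.map_tmul, tensorDiff_tmul, LinearMap.id_apply, map_add, hQ, h2,
        TensorProduct.tmul_sub, TensorProduct.neg_tmul, hss]
      abel
  have hPu : tensorDiff dA sA dB (TensorProduct.map P LinearMap.id u) = 0 := by
    have h4 := congrArg (tensorDiff dA sA dB) (h1 u)
    rwa [map_add, map_add, hDD, hu, map_zero, map_zero, add_zero, add_zero, eq_comm] at h4
  have h5 := h3 (TensorProduct.map P LinearMap.id u)
  rw [hPu, map_zero, add_zero] at h5
  refine ⟨TensorProduct.map LinearMap.id Q (TensorProduct.map P LinearMap.id u), ?_,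
    TensorProduct.map sA g (TensorProduct.map P LinearMap.id u) +
      TensorProduct.map h LinearMap.id u, ?_⟩
  · clear hu hPu h5
    induction u with
    | zero => simp
    | add u v hu hv => rw [map_add, map_add]; exact add_mem hu hv
    | tmul a b => exact AddSubmonoid.subset_closure ⟨P a, Q b, hdP a, hdQ b, rfl⟩
  · have h6 := h1 u
    rw [hu, map_zero, add_zero] at h6
    rw [map_add, ← add_assoc, ← h5]
    exact h6

end KunnethAlgebra

/-! ### Localizations of a tensor product -/

section LocTensor

variable {k : Type*} [Field k] {R S W : Type*} [CommRing R] [CommRing S] [CommRing W] [Algebra k R]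
  [Algebra k S] [Algebra k W] {X Y Z : Type*} [LinearOrder X] [LinearOrder Y] [LinearOrder Z]
  [Fintype X] [Fintype Y] [Fintype Z] {x : X → R} {y : Y → S} {f : Idx X Y Z → W}
  {iL : R →ₐ[k] W} {iR : S →ₐ[k] W}

theorem locMap_algebraMap_field {φ : R →ₐ[k] S} {ι ι' : Type*} [LinearOrder ι] [LinearOrder ι']
    {g : ι → R} {g' : ι' → S} {e : ι ↪o ι'} (hφ : ∀ i, φ.toRingHom (g i) = g' (e i))
    {s : Finset ι} {s' : Finset ι'} (h : s.map e.toEmbedding ⊆ s') (c : k) :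
    locMap hφ h (algebraMap k (Loc g s) c) = algebraMap k (Loc g' s') c := by
  rw [IsScalarTower.algebraMap_apply k R (Loc g s), locMap_algebraMap,
    IsScalarTower.algebraMap_apply k S (Loc g' s')]
  exact congrArg _ (φ.commutes c)

/-- The indices of the first kind in a set. -/
abbrev prX (s : Finset (Idx X Y Z)) : Finset X := pr (eX : X ↪o Idx X Y Z) s

/-- The indices of the second kind in a set. -/
abbrev prY (s : Finset (Idx X Y Z)) : Finset Y := pr (eY : Y ↪o Idx X Y Z) s

theorem mem_prX {s : Finset (Idx X Y Z)} {i : X} : i ∈ prX s ↔ eX i ∈ s :=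
  mem_pr (e := (eX : X ↪o Idx X Y Z))

theorem mem_prY {s : Finset (Idx X Y Z)} {i : Y} : i ∈ prY s ↔ eY i ∈ s :=
  mem_pr (e := (eY : Y ↪o Idx X Y Z))

variable (hfX : ∀ i, iL.toRingHom (x i) = f (eX i)) (hfY : ∀ j, iR.toRingHom (y j) = f (eY j))

/-- The map from a localization of the first factor. -/
def locX (s : Finset (Idx X Y Z)) : Loc x (prX s) →ₐ[k] Loc f s where
  toRingHom := locMap (e := (eX : X ↪o Idx X Y Z)) hfX (map_pr_subset (eX : X ↪o Idx X Y Z) s)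
  commutes' c := locMap_algebraMap_field hfX _ c

/-- The map from a localization of the second factor. -/
def locY (s : Finset (Idx X Y Z)) : Loc y (prY s) →ₐ[k] Loc f s where
  toRingHom := locMap (e := (eY : Y ↪o Idx X Y Z)) hfY (map_pr_subset (eY : Y ↪o Idx X Y Z) s)
  commutes' c := locMap_algebraMap_field hfY _ c

theorem locX_algebraMap (s : Finset (Idx X Y Z)) (a : R) :
    locX hfX s (algebraMap R _ a) = algebraMap _ _ (iL a) :=
  locMap_algebraMap (e := (eX : X ↪o Idx X Y Z)) hfX
    (map_pr_subset (eX : X ↪o Idx X Y Z) s) a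

theorem locY_algebraMap (s : Finset (Idx X Y Z)) (b : S) :
    locY hfY s (algebraMap S _ b) = algebraMap _ _ (iR b) :=
  locMap_algebraMap (e := (eY : Y ↪o Idx X Y Z)) hfY
    (map_pr_subset (eY : Y ↪o Idx X Y Z) s) b

/-- The map from the tensor product of localizations. -/
def locTensor (s : Finset (Idx X Y Z)) : Loc x (prX s) ⊗[k] Loc y (prY s) →ₐ[k] Loc f s :=
  Algebra.TensorProduct.productMap (locX hfX s) (locY hfY s)

theorem locTensor_tmul (s : Finset (Idx X Y Z)) (a : Loc x (prX s)) (b : Loc y (prY s)) :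
    locTensor hfX hfY s (a ⊗ₜ b) = locX hfX s a * locY hfY s b :=
  Algebra.TensorProduct.productMap_apply_tmul _ _ _ _

variable (hW : Function.Bijective (Algebra.TensorProduct.productMap iL iR))

/-- The map from the ambient ring to the tensor product of localizations. -/
def toLocTensor (x : X → R) (y : Y → S) (s : Finset (Idx X Y Z)) :
    W →ₐ[k] Loc x (prX s) ⊗[k] Loc y (prY s) :=
  (Algebra.TensorProduct.productMap
    (Algebra.TensorProduct.includeLeft.comp (IsScalarTower.toAlgHom k R (Loc x (prX s))))
    (Algebra.TensorProduct.includeRight.comp (IsScalarTower.toAlgHom k S (Loc y (prY s))))).comp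
    (AlgEquiv.ofBijective _ hW).symm.toAlgHom

theorem toLocTensor_apply (s : Finset (Idx X Y Z)) (a : R) (b : S) :
    toLocTensor hW x y s (iL a * iR b) =
      algebraMap R (Loc x (prX s)) a ⊗ₜ algebraMap S (Loc y (prY s)) b := by
  have h : (AlgEquiv.ofBijective _ hW).symm (iL a * iR b) = a ⊗ₜ b := by
    rw [AlgEquiv.symm_apply_eq]
    exact (Algebra.TensorProduct.productMap_apply_tmul _ _ _ _).symm
  change Algebra.TensorProduct.productMap _ _ ((AlgEquiv.ofBijective _ hW).symm _) = _
  rw [h, Algebra.TensorProduct.productMap_apply_tmul]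
  change (algebraMap R (Loc x (prX s)) a ⊗ₜ[k] (1 : Loc y (prY s))) *
    ((1 : Loc x (prX s)) ⊗ₜ algebraMap S (Loc y (prY s)) b) = _
  rw [Algebra.TensorProduct.tmul_mul_tmul, mul_one, one_mul]

theorem toLocTensor_left (s : Finset (Idx X Y Z)) (a : R) :
    toLocTensor hW x y s (iL a) = algebraMap R (Loc x (prX s)) a ⊗ₜ 1 := by
  have := toLocTensor_apply hW (x := x) (y := y) s a 1
  rwa [map_one, mul_one, map_one] at this

theorem toLocTensor_right (s : Finset (Idx X Y Z)) (b : S) :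
    toLocTensor hW x y s (iR b) = 1 ⊗ₜ algebraMap S (Loc y (prY s)) b := by
  have := toLocTensor_apply hW (x := x) (y := y) s 1 b
  rwa [map_one, one_mul, map_one] at this

theorem isUnit_toLocTensor (hfX : ∀ i, iL.toRingHom (x i) = f (eX i))
    (hfY : ∀ j, iR.toRingHom (y j) = f (eY j)) {s : Finset (Idx X Y Z)} (hs : ¬ HasZ s) :
    IsUnit (toLocTensor hW x y s (∏ i ∈ s, f i)) := by
  rw [map_prod, IsUnit.prod_iff]
  refine idx_cases (fun i hi => ?_) (fun i hi => ?_) fun i hi => absurd ⟨i, hi⟩ hs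
  · rw [← hfX]
    change IsUnit (toLocTensor hW x y s (iL (x i)))
    rw [toLocTensor_left]
    exact (isUnit_algebraMap_loc_of_mem x (mem_pr.mpr hi)).map
      (Algebra.TensorProduct.includeLeft :
        Loc x (prX s) →ₐ[k] Loc x (prX s) ⊗[k] Loc y (prY s))
  · rw [← hfY]
    change IsUnit (toLocTensor hW x y s (iR (y i)))
    rw [toLocTensor_right]
    exact (isUnit_algebraMap_loc_of_mem y (mem_pr.mpr hi)).map
      (Algebra.TensorProduct.includeRight :
        Loc y (prY s) →ₐ[k] Loc x (prX s) ⊗[k] Loc y (prY s))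

/-- Without indices of the third kind, every `f i` with `i ∈ s` becomes a unit in the tensor product
of the localizations, so the universal property gives the inverse. -/
theorem bijective_locTensor
    (hW : Function.Bijective (Algebra.TensorProduct.productMap iL iR)) {s : Finset (Idx X Y Z)} (hs : ¬ HasZ s) :
    Function.Bijective (locTensor hfX hfY s) := by
  let g : Loc f s →+* Loc x (prX s) ⊗[k] Loc y (prY s) :=
    IsLocalization.Away.lift (∏ i ∈ s, f i) (g := (toLocTensor hW x y s).toRingHom)
      (isUnit_toLocTensor hW hfX hfY hs)
  have hg : ∀ w, g (algebraMap _ _ w) = toLocTensor hW x y s w :=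
    IsLocalization.Away.lift_eq _ _
  have h1 : ∀ a, g (locX hfX s a) = a ⊗ₜ 1 := fun a =>
    DFunLike.congr_fun (loc_ringHom_ext (g := g.comp (locX hfX s).toRingHom)
      (h := (Algebra.TensorProduct.includeLeft :
        Loc x (prX s) →ₐ[k] Loc x (prX s) ⊗[k] Loc y (prY s)).toRingHom) fun r => by
        change g (locX hfX s _) = algebraMap R _ r ⊗ₜ 1
        rw [locX_algebraMap, hg, toLocTensor_left]) a
  have h2 : ∀ b, g (locY hfY s b) = 1 ⊗ₜ b := fun b =>
    DFunLike.congr_fun (loc_ringHom_ext (g := g.comp (locY hfY s).toRingHom)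
      (h := (Algebra.TensorProduct.includeRight :
        Loc y (prY s) →ₐ[k] Loc x (prX s) ⊗[k] Loc y (prY s)).toRingHom) fun r => by
        change g (locY hfY s _) = 1 ⊗ₜ algebraMap S _ r
        rw [locY_algebraMap, hg, toLocTensor_right]) b
  have h3 : ∀ w, locTensor hfX hfY s (toLocTensor hW x y s w) = algebraMap _ _ w := by
    intro w
    obtain ⟨v, rfl⟩ := hW.2 w
    induction v with
    | zero => simp only [map_zero]
    | add v w hv hw => simp only [map_add, hv, hw]
    | tmul a b =>
      rw [Algebra.TensorProduct.productMap_apply_tmul, toLocTensor_apply, locTensor_tmul,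
        locX_algebraMap, locY_algebraMap, ← map_mul]
  refine Function.bijective_iff_has_inverse.mpr ⟨g, fun v => ?_, fun w => ?_⟩
  · induction v with
    | zero => simp only [map_zero]
    | add v w hv hw => simp only [map_add, hv, hw]
    | tmul a b =>
      rw [locTensor_tmul, map_mul, h1, h2, Algebra.TensorProduct.tmul_mul_tmul, mul_one, one_mul]
  · exact DFunLike.congr_fun (loc_ringHom_ext (g := (locTensor hfX hfY s).toRingHom.comp g)
      (h := RingHom.id _) fun r => by
        change locTensor hfX hfY s (g (algebraMap _ _ r)) = _
        rw [hg, h3]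
        rfl) w

/-- The localization of a tensor product is the tensor product of the localizations. -/
def locTensorEquiv {s : Finset (Idx X Y Z)} (hs : ¬ HasZ s) :
    Loc x (prX s) ⊗[k] Loc y (prY s) ≃ₗ[k] Loc f s :=
  LinearEquiv.ofBijective (locTensor hfX hfY s).toLinearMap (bijective_locTensor hfX hfY hW hs)

open Classical in
/-- The map from the tensor product of the cochains. -/
def fromTensor : Cochain x ⊗[k] Cochain y →ₗ[k] Cochain f :=
  LinearMap.pi fun s => if HasZ s then 0 else (locTensor hfX hfY s).toLinearMap ∘ₗ
    TensorProduct.map (LinearMap.proj (prX s)) (LinearMap.proj (prY s))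

theorem fromTensor_apply {s : Finset (Idx X Y Z)} (hs : ¬ HasZ s) (v : Cochain x ⊗[k] Cochain y) :
    fromTensor hfX hfY v s = locTensor hfX hfY s
      (TensorProduct.map (LinearMap.proj (prX s)) (LinearMap.proj (prY s)) v) := by
  rw [fromTensor, LinearMap.pi_apply, if_neg hs]
  rfl

theorem fromTensor_tmul {s : Finset (Idx X Y Z)} (hs : ¬ HasZ s) (c : Cochain x) (c' : Cochain y) :
    fromTensor hfX hfY (c ⊗ₜ[k] c') s = locX hfX s (c (prX s)) * locY hfY s (c' (prY s)) := by
  rw [fromTensor_apply hfX hfY hs, TensorProduct.map_tmul, locTensor_tmul]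
  rfl

theorem fromTensor_of_hasZ {s : Finset (Idx X Y Z)} (hs : HasZ s) (v : Cochain x ⊗[k] Cochain y) :
    fromTensor hfX hfY v s = 0 := by
  rw [fromTensor, LinearMap.pi_apply, if_pos hs]
  rfl

open Classical in
/-- The map to the tensor product of the cochains. -/
def toTensor : Cochain f →ₗ[k] Cochain x ⊗[k] Cochain y :=
  ∑ s, if hs : HasZ s then 0 else
    TensorProduct.map (LinearMap.single k (fun s => Loc x s) (prX s))
        (LinearMap.single k (fun s => Loc y s) (prY s)) ∘ₗ
      (locTensorEquiv hfX hfY hW hs).symm.toLinearMap ∘ₗ LinearMap.proj s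

theorem ext_of_pr {s t : Finset (Idx X Y Z)} (hs : ¬ HasZ s) (ht : ¬ HasZ t)
    (hX : prX s = prX t) (hY : prY s = prY t) : s = t := by
  ext i
  revert i
  refine idx_cases (fun i => ?_) (fun i => ?_) fun i => ?_
  · rw [← mem_prX, ← mem_prX, hX]
  · rw [← mem_prY, ← mem_prY, hY]
  · exact ⟨fun h => absurd ⟨i, h⟩ hs, fun h => absurd ⟨i, h⟩ ht⟩

theorem exists_pr_eq (s : Finset X) (t : Finset Y) :
    ∃ u : Finset (Idx X Y Z), ¬ HasZ u ∧ prX u = s ∧ prY u = t := by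
  classical
  refine ⟨s.map eX.toEmbedding ∪ t.map eY.toEmbedding, ?_, ?_, ?_⟩
  · rintro ⟨l, hl⟩
    rcases Finset.mem_union.mp hl with h | h
    · obtain ⟨a, -, ha⟩ := Finset.mem_map.mp h
      exact (eX_lt_eZ a l).ne ha
    · obtain ⟨a, -, ha⟩ := Finset.mem_map.mp h
      exact (eY_lt_eZ a l).ne ha
  · ext i
    rw [mem_pr, Finset.mem_union]
    constructor
    · rintro (h | h)
      · obtain ⟨a, ha, hai⟩ := Finset.mem_map.mp h
        rwa [← eX.injective hai]
      · obtain ⟨a, -, ha⟩ := Finset.mem_map.mp h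
        exact absurd ha (eX_lt_eY i a).ne'
    · exact fun h => Or.inl (Finset.mem_map_of_mem _ h)
  · ext i
    rw [mem_pr, Finset.mem_union]
    constructor
    · rintro (h | h)
      · obtain ⟨a, -, ha⟩ := Finset.mem_map.mp h
        exact absurd ha (eX_lt_eY a i).ne
      · obtain ⟨a, ha, hai⟩ := Finset.mem_map.mp h
        rwa [← eY.injective hai]
    · exact fun h => Or.inr (Finset.mem_map_of_mem _ h)

/-- Sets without indices of the third kind correspond to pairs of sets `(prX s, prY s)`. Together
with `fromTensor_toTensor` this identifies the tensor product of the cochains with the cochains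
modulo `famU`. -/
theorem toTensor_fromTensor (v : Cochain x ⊗[k] Cochain y) :
    toTensor hfX hfY hW (fromTensor hfX hfY v) = v := by
  classical
  induction v with
  | zero => simp only [map_zero]
  | add v w hv hw => simp only [map_add, hv, hw]
  | tmul c c' =>
    have h1 : ∀ s : Finset (Idx X Y Z), (if hs : HasZ s then (0 : Cochain f →ₗ[k] _) else
        TensorProduct.map (LinearMap.single k (fun s => Loc x s) (prX s))
          (LinearMap.single k (fun s => Loc y s) (prY s)) ∘ₗ
        (locTensorEquiv hfX hfY hW hs).symm.toLinearMap ∘ₗ LinearMap.proj s)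
          (fromTensor hfX hfY (c ⊗ₜ[k] c')) =
        if ¬ HasZ s then LinearMap.single k (fun s => Loc x s) (prX s) (c (prX s)) ⊗ₜ
          LinearMap.single k (fun s => Loc y s) (prY s) (c' (prY s)) else 0 := by
      intro s
      by_cases hs : HasZ s
      · rw [dif_pos hs, if_neg (not_not_intro hs)]
        rfl
      · rw [dif_neg hs, if_pos hs]
        have h2 : (locTensorEquiv hfX hfY hW hs).symm (fromTensor hfX hfY (c ⊗ₜ[k] c') s) =
            c (prX s) ⊗ₜ c' (prY s) := by
          rw [LinearEquiv.symm_apply_eq, fromTensor_tmul hfX hfY hs]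
          exact (locTensor_tmul hfX hfY s _ _).symm
        change TensorProduct.map _ _ ((locTensorEquiv hfX hfY hW hs).symm _) = _
        rw [LinearMap.proj_apply, h2, TensorProduct.map_tmul]
    rw [toTensor, LinearMap.sum_apply, Finset.sum_congr rfl fun s _ => h1 s, ← Finset.sum_filter,
      Finset.sum_bij (t := Finset.univ) (g := fun st : Finset X × Finset Y =>
        LinearMap.single k (fun s => Loc x s) st.1 (c st.1) ⊗ₜ[k]
          LinearMap.single k (fun s => Loc y s) st.2 (c' st.2))
        (fun s _ => (prX s, prY s)) (fun _ _ => Finset.mem_univ _) ?_ ?_ ?_]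
    · rw [← Finset.univ_product_univ, Finset.sum_product]
      have h3 : ∀ c : Cochain x, ∑ s, LinearMap.single k (fun s => Loc x s) s (c s) = c :=
        fun c => Finset.univ_sum_single c
      have h4 : ∀ c : Cochain y, ∑ s, LinearMap.single k (fun s => Loc y s) s (c s) = c :=
        fun c => Finset.univ_sum_single c
      conv_rhs => rw [← h3 c, ← h4 c', TensorProduct.sum_tmul]
      exact Finset.sum_congr rfl fun s _ => by rw [TensorProduct.tmul_sum]
    · intro s hs t ht hst
      exact ext_of_pr (Finset.mem_filter.mp hs).2 (Finset.mem_filter.mp ht).2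
        (congrArg Prod.fst hst) (congrArg Prod.snd hst)
    · rintro ⟨s, t⟩ -
      obtain ⟨u, hu, rfl, rfl⟩ := exists_pr_eq (Z := Z) s t
      exact ⟨u, by simp [hu], rfl⟩
    · intro s _
      rfl

theorem toTensor_eq_zero {C : Cochain f} (hC : C ∈ (famU f).sec) : toTensor hfX hfY hW C = 0 := by
  rw [toTensor, LinearMap.sum_apply]
  refine Finset.sum_eq_zero fun s _ => ?_
  split_ifs with hs
  · rfl
  · change TensorProduct.map _ _ ((locTensorEquiv hfX hfY hW hs).symm (C s)) = 0
    rw [hC s hs, map_zero, map_zero]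

theorem fromTensor_toTensor (C : Cochain f) :
    C - fromTensor hfX hfY (toTensor hfX hfY hW C) ∈ (famU f).sec := by
  classical
  intro s hs
  rw [Pi.sub_apply, sub_eq_zero, toTensor, LinearMap.sum_apply, map_sum, Finset.sum_apply,
    Finset.sum_eq_single s]
  · rw [dif_neg hs, fromTensor_apply hfX hfY hs]
    change _ = locTensor hfX hfY s (TensorProduct.map _ _ (TensorProduct.map _ _
      ((locTensorEquiv hfX hfY hW hs).symm (C s))))
    rw [TensorProduct.map_map, LinearMap.proj_comp_single_same, LinearMap.proj_comp_single_same,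
      TensorProduct.map_id]
    exact ((locTensorEquiv hfX hfY hW hs).apply_symm_apply (C s)).symm
  · intro t _ hts
    split_ifs with ht
    · rw [LinearMap.zero_apply, map_zero]
      rfl
    · rw [fromTensor_apply hfX hfY hs]
      change locTensor hfX hfY s (TensorProduct.map _ _ (TensorProduct.map _ _
        ((locTensorEquiv hfX hfY hW ht).symm (C t)))) = 0
      rw [TensorProduct.map_map]
      by_cases hX : prX t = prX s
      · have hY : prY t ≠ prY s := fun hY => hts (ext_of_pr ht hs hX hY)
        rw [LinearMap.proj_comp_single_ne _ _ _ _ hY.symm, TensorProduct.map_zero_right,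
          LinearMap.zero_apply, map_zero]
      · rw [LinearMap.proj_comp_single_ne _ _ _ _ (Ne.symm hX), TensorProduct.map_zero_left,
          LinearMap.zero_apply, map_zero]
  · exact fun h => absurd (Finset.mem_univ s) h

end LocTensor

/-! ### Parity and signs on cochains -/

section Parity

variable {k : Type*} [Field k] {R : Type*} [CommRing R] [Algebra k R] {ι : Type*} [LinearOrder ι]

variable (k) in
/-- The sign given by the cohomological degree. -/
def cSign (x : ι → R) : Cochain x →ₗ[k] Cochain x :=
  LinearMap.pi fun s => ((-1 : k) ^ s.card) • LinearMap.proj s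

variable (k) in
/-- The projection onto the even cohomological degrees. -/
def cEven (x : ι → R) : Cochain x →ₗ[k] Cochain x :=
  LinearMap.pi fun s => if Even s.card then LinearMap.proj s else 0

variable {x : ι → R}

theorem cSign_apply (c : Cochain x) (s : Finset ι) :
    cSign k x c s = ((-1 : k) ^ s.card) • c s := rfl

theorem cEven_apply (c : Cochain x) (s : Finset ι) :
    cEven k x c s = if Even s.card then c s else 0 := by
  change (if Even s.card then (LinearMap.proj s : Cochain x →ₗ[k] Loc x s) else 0) c = _
  split_ifs <;> rfl

theorem cEven_cEven (c : Cochain x) : cEven k x (cEven k x c) = cEven k x c := by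
  funext s
  rw [cEven_apply, cEven_apply]
  split_ifs <;> rfl

theorem cSign_eq (c : Cochain x) : cSign k x c = cEven k x c + cEven k x c - c := by
  funext s
  rw [Pi.sub_apply, Pi.add_apply, cSign_apply, cEven_apply]
  split_ifs with h
  · rw [h.neg_one_pow, one_smul, add_sub_cancel_right]
  · rw [(Nat.not_even_iff_odd.mp h).neg_one_pow, neg_smul, one_smul, add_zero, zero_sub]

variable [Fintype ι]

variable (k) in
/-- The differential as a linear map over the base field. -/
def kDiff (x : ι → R) : Cochain x →ₗ[k] Cochain x := (cDiff x).restrictScalars k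

theorem kDiff_apply (c : Cochain x) : kDiff k x c = cDiff x c := rfl

theorem cEven_kDiff (c : Cochain x) :
    cEven k x (kDiff k x c) + kDiff k x (cEven k x c) = kDiff k x c := by
  funext s
  rw [Pi.add_apply, cEven_apply, kDiff_apply, kDiff_apply, cDiff_apply, cDiff_apply]
  split_ifs with h
  · rw [add_eq_left]
    refine Finset.sum_eq_zero fun i _ => ?_
    by_cases hi : i ∈ s
    · rw [cEven_apply, if_neg, map_zero, mul_zero]
      rw [Finset.card_erase_of_mem hi]
      exact Nat.not_even_iff_odd.mpr (Nat.Even.sub_odd (Finset.card_pos.mpr ⟨i, hi⟩) h odd_one)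
    · rw [sgn_of_notMem hi, Int.cast_zero, zero_mul]
  · rw [zero_add]
    refine Finset.sum_congr rfl fun i _ => ?_
    by_cases hi : i ∈ s
    · rw [cEven_apply, if_pos]
      rw [Finset.card_erase_of_mem hi]
      exact Nat.Odd.sub_odd (Nat.not_even_iff_odd.mp h) odd_one
    · rw [sgn_of_notMem hi, Int.cast_zero, zero_mul, zero_mul]

theorem kDiff_kDiff (c : Cochain x) : kDiff k x (kDiff k x c) = 0 := cDiff_cDiff c

end Parity

/-! ### Compatibility with the differentials -/

section ChainMap

variable {k : Type*} [Field k] {R S W : Type*} [CommRing R] [CommRing S] [CommRing W] [Algebra k R]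
  [Algebra k S] [Algebra k W] {X Y Z : Type*} [LinearOrder X] [LinearOrder Y] [LinearOrder Z]
  [Fintype X] [Fintype Y] [Fintype Z] {x : X → R} {y : Y → S} {f : Idx X Y Z → W}
  {iL : R →ₐ[k] W} {iR : S →ₐ[k] W}

theorem sgn_eX (s : Finset (Idx X Y Z)) (i : X) : sgn (eX i) s = sgn i (prX s) :=
  sgn_eq_sgn_pr (e := (eX : X ↪o Idx X Y Z)) <| idx_cases (fun a _ _ => ⟨a, rfl⟩)
    (fun _ _ h => absurd h (eX_lt_eY _ _).not_gt) fun _ _ h => absurd h (eX_lt_eZ _ _).not_gt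

/-- Every index of the first kind precedes those of the second kind, which produces the Koszul sign
of the tensor product of complexes. -/
theorem sgn_eY (s : Finset (Idx X Y Z)) (j : Y) :
    sgn (eY j) s = (-1) ^ (prX s).card * sgn j (prY s) := by
  classical
  rw [sgn, sgn]
  simp only [mem_prY, mul_ite, mul_zero]
  refine if_congr Iff.rfl ?_ rfl
  rw [← pow_add]
  congr 1
  have h1 := filter_lt_inter_range (e := (eY : Y ↪o Idx X Y Z)) s j
  have h2 : (prX s).map (eX : X ↪o Idx X Y Z).toEmbedding =
      s.filter fun i => i < (eY : Y ↪o Idx X Y Z) j ∧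
        ¬ ∃ a, (eY : Y ↪o Idx X Y Z) a = i := by
    ext i
    simp only [Finset.mem_map, Finset.mem_filter, mem_prX]
    constructor
    · rintro ⟨a, ha, rfl⟩
      exact ⟨ha, eX_lt_eY a j, fun ⟨b, hb⟩ => (eX_lt_eY a b).ne' hb⟩
    · revert i
      refine idx_cases (fun a h => ⟨a, h.1, rfl⟩) (fun a h => absurd ⟨a, rfl⟩ h.2.2)
        fun a h => absurd h.2.1 (eY_lt_eZ j a).not_gt
  rw [← Finset.card_map (s := prX s) (eX : X ↪o Idx X Y Z).toEmbedding, h2,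
    ← Finset.card_map (s := (prY s).filter (· < j)) (eY : Y ↪o Idx X Y Z).toEmbedding, h1,
    ← Finset.card_filter_add_card_filter_not (s := s.filter (· < (eY : Y ↪o Idx X Y Z) j))
      fun i => ∃ a, (eY : Y ↪o Idx X Y Z) a = i, Finset.filter_filter, Finset.filter_filter,
    add_comm]
  congr!

theorem sgn_eZ {s : Finset (Idx X Y Z)} (hs : ¬ HasZ s) (l : Z) : sgn (eZ l) s = 0 :=
  sgn_of_notMem fun h => hs ⟨l, h⟩

theorem prX_erase_eX (s : Finset (Idx X Y Z)) (i : X) : prX (@Finset.erase _ LinearOrder.toDecidableEq s (eX i)) = (prX s).erase i :=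
  pr_erase (e := (eX : X ↪o Idx X Y Z)) s i

theorem prY_erase_eX (s : Finset (Idx X Y Z)) (i : X) : prY (@Finset.erase _ LinearOrder.toDecidableEq s (eX i)) = prY s :=
  pr_erase_of_ne (e := (eY : Y ↪o Idx X Y Z)) fun a => (eX_lt_eY i a).ne'

theorem prX_erase_eY (s : Finset (Idx X Y Z)) (j : Y) : prX (@Finset.erase _ LinearOrder.toDecidableEq s (eY j)) = prX s :=
  pr_erase_of_ne (e := (eX : X ↪o Idx X Y Z)) fun a => (eX_lt_eY a j).ne

theorem prY_erase_eY (s : Finset (Idx X Y Z)) (j : Y) : prY (@Finset.erase _ LinearOrder.toDecidableEq s (eY j)) = (prY s).erase j :=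
  pr_erase (e := (eY : Y ↪o Idx X Y Z)) s j

variable (hfX : ∀ i, iL.toRingHom (x i) = f (eX i)) (hfY : ∀ j, iR.toRingHom (y j) = f (eY j))

theorem res_locX {s t : Finset (Idx X Y Z)} (h : s ⊆ t) {r : Finset X} (hr : prX s = r)
    (hrt : r ⊆ prX t) (c : Cochain x) :
    res f h (locX hfX s (c (prX s))) = locX hfX t (res x hrt (c r)) := by
  subst hr
  have h1 := (map_pr_subset (eX : X ↪o Idx X Y Z) s).trans h
  exact (res_locMap (e := (eX : X ↪o Idx X Y Z)) hfX (map_pr_subset (eX : X ↪o Idx X Y Z) s) h h1 _).trans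
    (locMap_res (e := (eX : X ↪o Idx X Y Z)) hfX hrt (map_pr_subset (eX : X ↪o Idx X Y Z) t) h1 _).symm

theorem res_locY {s t : Finset (Idx X Y Z)} (h : s ⊆ t) {r : Finset Y} (hr : prY s = r)
    (hrt : r ⊆ prY t) (c : Cochain y) :
    res f h (locY hfY s (c (prY s))) = locY hfY t (res y hrt (c r)) := by
  subst hr
  have h1 := (map_pr_subset (eY : Y ↪o Idx X Y Z) s).trans h
  exact (res_locMap (e := (eY : Y ↪o Idx X Y Z)) hfY (map_pr_subset (eY : Y ↪o Idx X Y Z) s) h h1 _).trans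
    (locMap_res (e := (eY : Y ↪o Idx X Y Z)) hfY hrt (map_pr_subset (eY : Y ↪o Idx X Y Z) t) h1 _).symm

variable (k x y) in
/-- The differential on the tensor product of the cochains. -/
abbrev tDiff : Cochain x ⊗[k] Cochain y →ₗ[k] Cochain x ⊗[k] Cochain y :=
  tensorDiff (kDiff k x) (cSign k x) (kDiff k y)

theorem cDiff_fromTensor_tmul {s : Finset (Idx X Y Z)} (hs : ¬ HasZ s) (c : Cochain x)
    (c' : Cochain y) : cDiff f (fromTensor hfX hfY (c ⊗ₜ[k] c')) s =
      fromTensor hfX hfY (tDiff k x y (c ⊗ₜ c')) s := by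
  have he : ∀ {t}, t ⊆ s → ¬ HasZ t := fun h h' => hs (h'.mono h)
  rw [tensorDiff_tmul, map_add, Pi.add_apply, fromTensor_tmul hfX hfY hs,
    fromTensor_tmul hfX hfY hs, cSign_apply, kDiff_apply, kDiff_apply, cDiff_apply, cDiff_apply,
    cDiff_apply, sum_idx]
  congr 1
  · rw [map_sum, Finset.sum_mul]
    refine Finset.sum_congr rfl fun i _ => ?_
    rw [fromTensor_tmul hfX hfY (he (@Finset.erase_subset _ LinearOrder.toDecidableEq _ s)), map_mul,
      res_locX hfX _ (prX_erase_eX s i) (Finset.erase_subset _ _),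
      res_locY hfY _ (prY_erase_eX s i) (Finset.Subset.refl _), res_self, map_mul, map_intCast,
      sgn_eX, mul_assoc]
  · rw [Finset.sum_eq_zero (s := Finset.univ) (f := fun l : Z => _) fun l _ => by
      rw [sgn_eZ hs, Int.cast_zero, zero_mul], add_zero, map_sum, Finset.mul_sum]
    refine Finset.sum_congr rfl fun j _ => ?_
    rw [fromTensor_tmul hfX hfY (he (@Finset.erase_subset _ LinearOrder.toDecidableEq _ s)), map_mul,
      res_locX hfX _ (prX_erase_eY s j) (Finset.Subset.refl _),
      res_locY hfY _ (prY_erase_eY s j) (Finset.erase_subset _ _), res_self, map_mul, map_intCast,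
      sgn_eY, map_smul, Algebra.smul_def, map_pow, map_neg, map_one]
    push_cast
    ring

theorem cDiff_fromTensor {s : Finset (Idx X Y Z)} (hs : ¬ HasZ s) (v : Cochain x ⊗[k] Cochain y) :
    cDiff f (fromTensor hfX hfY v) s = fromTensor hfX hfY (tDiff k x y v) s := by
  induction v with
  | zero => simp only [map_zero]
  | add v w hv hw => simp only [map_add, Pi.add_apply, hv, hw]
  | tmul c c' => exact cDiff_fromTensor_tmul hfX hfY hs c c'

theorem cDiff_fromTensor_sub_mem (v : Cochain x ⊗[k] Cochain y) :
    cDiff f (fromTensor hfX hfY v) - fromTensor hfX hfY (tDiff k x y v) ∈ (famU f).sec :=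
  fun s hs => by rw [Pi.sub_apply, cDiff_fromTensor hfX hfY hs, sub_self]

/-- Formal from the same property of `fromTensor`: both composites are identities modulo `famU`, a
subcomplex which `toTensor` kills. -/
theorem toTensor_cDiff (hW : Function.Bijective (Algebra.TensorProduct.productMap iL iR))
    (C : Cochain f) :
    toTensor hfX hfY hW (cDiff f C) = tDiff k x y (toTensor hfX hfY hW C) := by
  have h1 := toTensor_eq_zero hfX hfY hW (Fam.cDiff_mem (fromTensor_toTensor hfX hfY hW C))
  have h2 := toTensor_eq_zero hfX hfY hW
    (cDiff_fromTensor_sub_mem hfX hfY (toTensor hfX hfY hW C))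
  rw [map_sub, map_sub, sub_eq_zero] at h1
  rw [map_sub, sub_eq_zero, toTensor_fromTensor] at h2
  rw [h1, h2]

end ChainMap

/-! ### The sign operator on cocycles -/

section Sign

variable {k : Type*} [Field k] {R : Type*} [CommRing R] [Algebra k R] {ι : Type*} [LinearOrder ι]
  {x : ι → R}

theorem cSign_cSign (c : Cochain x) : cSign k x (cSign k x c) = c := by
  funext s
  rw [cSign_apply, cSign_apply, smul_smul, ← mul_pow, neg_one_mul, neg_neg, one_pow, one_smul]

theorem kDiff_cSign [Fintype ι] {c : Cochain x} (hc : kDiff k x c = 0) :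
    kDiff k x (cSign k x c) = 0 := by
  have h := cEven_kDiff (k := k) c
  rw [hc, map_zero, zero_add] at h
  rw [cSign_eq, map_sub, map_add, h, hc, add_zero, sub_zero]

end Sign

/-! ### Künneth formula in negative degrees, with Frobenius -/

section Kunneth

variable {k : Type*} [Field k] {R S W : Type*} [CommRing R] [CommRing S] [CommRing W] [Algebra k R]
  [Algebra k S] [Algebra k W] {X Y Z : Type*} [LinearOrder X] [LinearOrder Y] [LinearOrder Z]
  [Fintype X] [Fintype Y] [Fintype Z] {x : X → R} {y : Y → S} {f : Idx X Y Z → W}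
  {iL : R →ₐ[k] W} {iR : S →ₐ[k] W}

theorem card_eq_add {s : Finset (Idx X Y Z)} (hs : ¬ HasZ s) :
    s.card = (prX s).card + (prY s).card := by
  classical
  have h : ∀ t : Finset (Idx X Y Z), t.card = ∑ i, if i ∈ t then 1 else 0 := fun t => by simp
  have hz : ∀ l : Z, eZ l ∉ s := fun l hl => hs ⟨l, hl⟩
  rw [h, sum_idx, prX, prY, pr, pr, Finset.card_filter, Finset.card_filter]
  simp only [hz, if_false, Finset.sum_const_zero, add_zero]
  congr!

variable (hfX : ∀ i, iL.toRingHom (x i) = f (eX i)) (hfY : ∀ j, iR.toRingHom (y j) = f (eY j))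

/-- A set outside `PQ` lacks indices of the first or of the second kind, and there one factor is
evaluated at `∅`. -/
theorem fromTensor_mem_famQ {v : Cochain x} {w : Cochain y} (hv : v ∅ = 0) (hw : w ∅ = 0) :
    fromTensor hfX hfY (v ⊗ₜ[k] w) ∈ (famQ f).sec := by
  intro s hs
  have hZ : ¬ HasZ s := fun h => hs (Or.inl h)
  rw [fromTensor_tmul hfX hfY hZ]
  by_cases hX : prX s = ∅
  · have h0 : v (prX s) = 0 := by rw [hX, hv]
    rw [h0, map_zero, zero_mul]
  · obtain ⟨i, hi⟩ := Finset.nonempty_iff_ne_empty.mpr hX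
    have hY : prY s = ∅ := Finset.eq_empty_of_forall_notMem fun j hj =>
      hs (Or.inr ⟨⟨i, mem_prX.mp hi⟩, j, mem_prY.mp hj⟩)
    have h0 : w (prY s) = 0 := by rw [hY, hw]
    rw [h0, map_zero, mul_zero]

theorem frob_iterate_fromTensor (p : ℕ) [Fact p.Prime] [CharP R p] [CharP S p] [CharP W p] (e : ℕ)
    (c : Cochain x) (c' : Cochain y) : (frob p)^[e] (fromTensor hfX hfY (c ⊗ₜ[k] c')) =
      fromTensor hfX hfY (((frob p)^[e] c) ⊗ₜ[k] ((frob p)^[e] c')) := by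
  funext s
  rw [frob_iterate_apply]
  by_cases hs : HasZ s
  · rw [fromTensor_of_hasZ hfX hfY hs, fromTensor_of_hasZ hfX hfY hs,
      zero_pow (pow_pos (pos_of_prime p) e).ne']
  · rw [fromTensor_tmul hfX hfY hs, fromTensor_tmul hfX hfY hs, frob_iterate_apply,
      frob_iterate_apply, mul_pow, map_pow, map_pow]

variable {γ : Coaction ℤ R} {γ' : Coaction ℤ S} {Γ : Coaction (ℤ × ℤ) W} {δ : X → ℤ} {δ' : Y → ℤ}
  {Δ : Idx X Y Z → ℤ × ℤ} (hδ : ∀ i, γ.Homog (δ i) (x i)) (hδ' : ∀ i, γ'.Homog (δ' i) (y i))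
  (hΔ : ∀ i, Γ.Homog (Δ i) (f i))
  (hL : ∀ g a, γ.Homog g a → Γ.Homog (AddMonoidHom.inl ℤ ℤ g) (iL a))
  (hR : ∀ g a, γ'.Homog g a → Γ.Homog (AddMonoidHom.inr ℤ ℤ g) (iR a))

include hL hR in
theorem homog_locX_mul_locY {s : Finset (Idx X Y Z)} {g h : ℤ} {a : Loc x (prX s)}
    {b : Loc y (prY s)} (ha : (locCo hδ (prX s)).Homog g a) (hb : (locCo hδ' (prY s)).Homog h b) :
    (locCo hΔ s).Homog (g, h) (locX hfX s a * locY hfY s b) := by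
  have h1 := homog_locMap (e := (eX : X ↪o Idx X Y Z)) hfX hδ hΔ (AddMonoidHom.inl ℤ ℤ) hL
    (map_pr_subset (eX : X ↪o Idx X Y Z) s) ha
  have h2 := homog_locMap (e := (eY : Y ↪o Idx X Y Z)) hfY hδ' hΔ (AddMonoidHom.inr ℤ ℤ) hR
    (map_pr_subset (eY : Y ↪o Idx X Y Z) s) hb
  have h3 := h1.mul h2
  rwa [AddMonoidHom.inl_apply, AddMonoidHom.inr_apply, Prod.mk_add_mk, add_zero, zero_add] at h3

include hL hR in
theorem proj_locX_mul_locY {s : Finset (Idx X Y Z)} (g h : ℤ) (a : Loc x (prX s))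
    (b : Loc y (prY s)) : (locCo hΔ s).proj (g, h) (locX hfX s a * locY hfY s b) =
      locX hfX s ((locCo hδ (prX s)).proj g a) * locY hfY s ((locCo hδ' (prY s)).proj h b) := by
  induction a using (locCo hδ (prX s)).induction with
  | hadd a a' ha ha' => rw [map_add, add_mul, map_add, ha, ha', map_add, map_add, add_mul]
  | h g' a ha =>
    induction b using (locCo hδ' (prY s)).induction with
    | hadd b b' hb hb' => rw [map_add, mul_add, map_add, hb, hb', map_add, map_add, mul_add]
    | h h' b hb =>
      rw [(homog_locX_mul_locY hfX hfY hδ hδ' hΔ hL hR ha hb).proj_eq_ite, ha.proj_eq_ite,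
        hb.proj_eq_ite]
      by_cases h1 : g' = g
      · by_cases h2 : h' = h
        · rw [if_pos h1, if_pos h2, if_pos (by rw [h1, h2])]
        · rw [if_neg h2, map_zero, mul_zero, if_neg fun h3 => h2 (Prod.mk.inj h3).2]
      · rw [if_neg h1, map_zero, zero_mul, if_neg fun h3 => h1 (Prod.mk.inj h3).1]

include hL hR in
theorem cDeg_fromTensor_tmul (j g h : ℤ) (c : Cochain x) (c' : Cochain y) :
    cDeg hΔ j (g, h) (fromTensor hfX hfY (c ⊗ₜ[k] c')) =
      ∑ i ∈ Finset.range (Fintype.card X + 1),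
        fromTensor hfX hfY (cDeg hδ (i : ℤ) g c ⊗ₜ[k] cDeg hδ' (j - i) h c') := by
  funext s
  rw [cDeg_apply, Finset.sum_apply]
  by_cases hs : HasZ s
  · simp only [fromTensor_of_hasZ hfX hfY hs, map_zero, ite_self, Finset.sum_const_zero]
  · simp only [fromTensor_tmul hfX hfY hs, cDeg_apply]
    rw [Finset.sum_eq_single (prX s).card, proj_locX_mul_locY hfX hfY hδ hδ' hΔ hL hR, if_pos rfl]
    · rw [card_eq_add hs]
      push_cast
      by_cases hj : ((prX s).card : ℤ) + (prY s).card = j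
      · rw [if_pos hj, if_pos (by omega)]
      · rw [if_neg hj, if_neg (by omega), map_zero, mul_zero]
    · intro i _ hi
      rw [if_neg (by exact_mod_cast hi.symm), map_zero, zero_mul]
    · intro h1
      exact absurd (Finset.mem_range.mpr (Nat.lt_succ_of_le (Finset.card_le_univ _))) h1

variable (hneg : ∀ n < 0, ∀ a, γ.Homog n a → a = 0) (hneg' : ∀ n < 0, ∀ a, γ'.Homog n a → a = 0)

include hneg in
theorem IsDeg.apply_empty {j n : ℤ} (hn : n < 0) {c : Cochain x} (hc : IsDeg hδ j n c) : c ∅ = 0 :=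
  loc_empty_eq_zero hneg hn (hc.homog ∅)

include hδ hδ' hL hR hneg hneg' in
-- In negative degrees both factors vanish at `∅`. So the requirement that cochains lie in `famQ`
-- costs nothing in these degrees.
theorem cDeg_fromTensor_mem_famQ (j : ℤ) {n : ℤ} (hn : n < 0) (w : Cochain x ⊗[k] Cochain y) :
    cDeg hΔ j (n, n) (fromTensor hfX hfY w) ∈ (famQ f).sec := by
  induction w with
  | zero => rw [map_zero, map_zero]; exact zero_mem _
  | add v w hv hw => rw [map_add, map_add]; exact add_mem hv hw
  | tmul c c' =>
    rw [cDeg_fromTensor_tmul hfX hfY hδ hδ' hΔ hL hR]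
    exact sum_mem fun i _ => fromTensor_mem_famQ hfX hfY
      ((isDeg_cDeg _ _ _).apply_empty hδ hneg hn) ((isDeg_cDeg _ _ _).apply_empty hδ' hneg' hn)

variable {p : ℕ} [Fact p.Prime] [CharP R p] [CharP S p] [CharP W p]

include hneg in
/-- A nilpotent cocycle of negative degree becomes a coboundary of a cochain without constant
component. -/
theorem Nilp.exists_cDiff_eq {j n : ℤ} (hn : n < 0) {c : Cochain x} (hc : IsDeg hδ j n c)
    (h : Nilp p (idealFam x ⊤) (idealFam x ⊥) c) :
    ∃ (e : ℕ) (b : Cochain x), b ∅ = 0 ∧ cDiff x b = (frob p)^[e] c := by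
  obtain ⟨e, he⟩ := h
  obtain ⟨b, hb⟩ := mem_bd_top_bot.mp he
  refine ⟨e, cDeg hδ (j - 1) (p ^ e • n) b, (isDeg_cDeg _ _ _).apply_empty hδ hneg ?_, ?_⟩
  · rw [nsmul_eq_mul]
    exact mul_neg_of_pos_of_neg (by exact_mod_cast pow_pos (pos_of_prime p) e) hn
  · rw [cDiff_cDeg, sub_add_cancel, hb, (hc.frob_iterate e).cDeg_eq]

/-- If an iterate of one factor is the coboundary of `b`, then `b` tensored with the same iterate of
the other cocycle is a primitive modulo `famU`. -/
theorem nilp_fromTensor_left {c : Cochain x} {c' : Cochain y} {e : ℕ} {b : Cochain x}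
    (hb : b ∅ = 0) (hbc : cDiff x b = (frob p)^[e] c) (hc' : c' ∅ = 0) (hdc' : cDiff y c' = 0) :
    Nilp p (famQ f) (famU f) (fromTensor hfX hfY (c ⊗ₜ[k] c')) := by
  refine ⟨e, mem_bd.mpr ⟨fromTensor hfX hfY (b ⊗ₜ[k] (frob p)^[e] c'),
    fromTensor_mem_famQ hfX hfY hb ?_, _, ?_, add_sub_cancel _ _⟩⟩
  · rw [frob_iterate_apply, hc', zero_pow (pow_pos (pos_of_prime p) e).ne']
  · have h := neg_mem (cDiff_fromTensor_sub_mem hfX hfY (b ⊗ₜ[k] (frob p)^[e] c'))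
    rw [neg_sub, tensorDiff_tmul, kDiff_apply, kDiff_apply, hbc, cDiff_frob_iterate, hdc',
      iterate_map_zero, TensorProduct.tmul_zero, add_zero] at h
    rwa [frob_iterate_fromTensor]

theorem nilp_fromTensor_right {c : Cochain x} {c' : Cochain y} {e : ℕ} {b : Cochain y}
    (hb : b ∅ = 0) (hbc : cDiff y b = (frob p)^[e] c') (hc : c ∅ = 0) (hdc : cDiff x c = 0) :
    Nilp p (famQ f) (famU f) (fromTensor hfX hfY (c ⊗ₜ[k] c')) := by
  refine ⟨e, mem_bd.mpr ⟨fromTensor hfX hfY (cSign k x ((frob p)^[e] c) ⊗ₜ[k] b),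
    fromTensor_mem_famQ hfX hfY ?_ hb, _, ?_, add_sub_cancel _ _⟩⟩
  · rw [cSign_apply, frob_iterate_apply, hc, zero_pow (pow_pos (pos_of_prime p) e).ne', smul_zero]
  · have h1 : kDiff k x ((frob p)^[e] c) = 0 := by
      rw [kDiff_apply, cDiff_frob_iterate, hdc, iterate_map_zero]
    have h := neg_mem (cDiff_fromTensor_sub_mem hfX hfY (cSign k x ((frob p)^[e] c) ⊗ₜ[k] b))
    rw [neg_sub, tensorDiff_tmul, kDiff_cSign h1, cSign_cSign, TensorProduct.zero_tmul, zero_add,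
      kDiff_apply, hbc] at h
    rwa [frob_iterate_fromTensor]

variable (hW : Function.Bijective (Algebra.TensorProduct.productMap iL iR))

include hfX hfY hL hR hneg hneg' hW in
/-- The Künneth formula, for the nilpotence of the cohomology in negative degrees. -/
theorem nilDeg_tensor_iff (j : ℤ) {n : ℤ} (hn : n < 0) :
    NilDeg p hΔ (famQ f) (famU f) j (n, n) ↔ ∀ a b : ℕ, (a : ℤ) + b = j →
      NilDeg p hδ (idealFam x ⊤) (idealFam x ⊥) a n ∨
        NilDeg p hδ' (idealFam y ⊤) (idealFam y ⊥) b n := by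
  constructor
  · intro H a b hab
    by_contra! hcon
    obtain ⟨h1, h2⟩ := hcon
    unfold NilDeg at h1 h2
    push Not at h1 h2
    obtain ⟨c, -, hc, hdc, hcn⟩ := h1
    obtain ⟨c', -, hc', hdc', hcn'⟩ := h2
    rw [mem_sec_bot] at hdc hdc'
    obtain ⟨e, he⟩ := H (fromTensor hfX hfY (c ⊗ₜ[k] c'))
      (fromTensor_mem_famQ hfX hfY (hc.apply_empty hδ hneg hn) (hc'.apply_empty hδ' hneg' hn))
      { card := fun s hs => by
          by_cases hZ : HasZ s
          · exact fromTensor_of_hasZ hfX hfY hZ _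
          · rw [fromTensor_tmul hfX hfY hZ]
            rw [card_eq_add hZ] at hs
            push_cast at hs
            by_cases hX : ((prX s).card : ℤ) = a
            · rw [hc'.card (prY s) fun h => hs (by omega), map_zero, mul_zero]
            · rw [hc.card _ hX, map_zero, zero_mul]
        homog := fun s => by
          by_cases hZ : HasZ s
          · rw [fromTensor_of_hasZ hfX hfY hZ]
            exact Coaction.Homog.zero _
          · rw [fromTensor_tmul hfX hfY hZ]
            exact homog_locX_mul_locY hfX hfY hδ hδ' hΔ hL hR (hc.homog _) (hc'.homog _) }
      (by
        have h := cDiff_fromTensor_sub_mem hfX hfY (c ⊗ₜ[k] c')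
        rwa [tensorDiff_tmul, kDiff_apply, kDiff_apply, hdc, hdc', TensorProduct.tmul_zero,
          TensorProduct.zero_tmul, add_zero, map_zero, sub_zero] at h)
    obtain ⟨b, -, u, hu, hbu⟩ := mem_bd.mp he
    rw [frob_iterate_fromTensor] at hbu
    -- Applying `toTensor` removes the error in `famU`, so the tensor of the iterates is a boundary
    -- in the tensor product of complexes and `mem_range_of_tmul_eq` applies.
    have h := congrArg (toTensor hfX hfY hW) hbu
    rw [map_add, toTensor_eq_zero hfX hfY hW hu, add_zero, toTensor_cDiff, toTensor_fromTensor] at h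
    rcases mem_range_of_tmul_eq h with ⟨b, hb⟩ | ⟨b, hb⟩
    · exact hcn ⟨e, mem_bd_top_bot.mpr ⟨b, hb⟩⟩
    · exact hcn' ⟨e, mem_bd_top_bot.mpr ⟨b, hb⟩⟩
  · intro H C _ hdeg hdC
    have hU : (famU f).Homog hΔ := homog_suppFam
    have hd : tDiff k x y (toTensor hfX hfY hW C) = 0 := by
      rw [← toTensor_cDiff, toTensor_eq_zero hfX hfY hW hdC]
    -- The cocycles in `t` are not homogeneous, and the image of `w` need not lie in `famQ`.
    -- Projecting the whole decomposition to the bidegree `j`, `(n, n)` repairs both.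
    obtain ⟨t, ht, w, hw⟩ := exists_eq_cocycles_add (kDiff_kDiff (k := k) (x := x))
      (kDiff_kDiff (k := k) (x := y)) cEven_cEven cSign_eq cEven_kDiff hd
    have hC : C = (C - fromTensor hfX hfY (toTensor hfX hfY hW C)) + fromTensor hfX hfY t +
        (cDiff f (fromTensor hfX hfY w) -
          (cDiff f (fromTensor hfX hfY w) - fromTensor hfX hfY (tDiff k x y w))) := by
      conv_lhs => rw [← sub_add_cancel C (fromTensor hfX hfY (toTensor hfX hfY hW C))]
      conv_lhs => rhs; rw [hw, map_add]
      abel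
    rw [← hdeg.cDeg_eq, hC, map_add, map_add, map_sub (cDeg hΔ j (n, n)) (cDiff f _)]
    refine ((Nilp.of_mem ?_).add ?_).add (Nilp.of_mem (sub_mem ?_ ?_))
    · exact Submodule.mem_sup_right (hU.cDeg_mem (fromTensor_toTensor hfX hfY hW C) _ _)
    · clear hC hw
      induction ht using AddSubmonoid.closure_induction with
      | zero => rw [map_zero, map_zero]; exact Nilp.of_mem (zero_mem _)
      | add t t' _ _ ht ht' => rw [map_add, map_add]; exact ht.add ht'
      | mem t ht =>
        obtain ⟨c, c', hc, hc', rfl⟩ := ht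
        rw [cDeg_fromTensor_tmul hfX hfY hδ hδ' hΔ hL hR]
        refine Nilp.sum fun i _ => ?_
        have hi := isDeg_cDeg (hδ := hδ) (i : ℤ) n c
        have hi' := isDeg_cDeg (hδ := hδ') (j - i : ℤ) n c'
        have hdi : cDiff x (cDeg hδ (i : ℤ) n c) = 0 := by
          rw [cDiff_cDeg, ← kDiff_apply (k := k), hc, map_zero]
        have hdi' : cDiff y (cDeg hδ' (j - i : ℤ) n c') = 0 := by
          rw [cDiff_cDeg, ← kDiff_apply (k := k), hc', map_zero]
        -- The hypothesis concerns cohomological degrees in `ℕ`; a component of negative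
        -- cohomological degree is zero.
        by_cases hij : j - i < 0
        · have h0 : cDeg hδ' (j - i : ℤ) n c' = 0 := by
            funext s
            exact hi'.card s (by omega)
          rw [h0, TensorProduct.tmul_zero, map_zero]
          exact Nilp.of_mem (zero_mem _)
        · obtain ⟨b, hb⟩ := Int.eq_ofNat_of_zero_le (not_lt.mp hij)
          rcases H i b (by omega) with h | h
          · obtain ⟨e, β, hβ, hβc⟩ := (h _ (mem_sec_top _) hi
              (mem_sec_bot.mpr hdi)).exists_cDiff_eq hδ hneg hn hi
            exact nilp_fromTensor_left hfX hfY hβ hβc (hi'.apply_empty hδ' hneg' hn) hdi'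
          · obtain ⟨e, β, hβ, hβc⟩ := (h _ (mem_sec_top _) (hb ▸ hi')
              (mem_sec_bot.mpr (hb ▸ hdi'))).exists_cDiff_eq hδ' hneg' hn (hb ▸ hi')
            rw [hb]
            exact nilp_fromTensor_right hfX hfY hβ hβc (hi.apply_empty hδ hneg hn) hdi
    · have h := cDiff_cDeg (hδ := hΔ) (j - 1) (n, n) (fromTensor hfX hfY w)
      rw [sub_add_cancel] at h
      rw [← h]
      exact Submodule.mem_sup_left ⟨_, cDeg_fromTensor_mem_famQ hfX hfY hδ hδ' hΔ hL hR hneg hneg'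
        _ hn w, rfl⟩
    · exact Submodule.mem_sup_right (hU.cDeg_mem (cDiff_fromTensor_sub_mem hfX hfY w) _ _)

end Kunneth

/-! ### Positive degrees for generators of the maximal ideal -/

section MaximalIdeal

variable {k : Type*} [Field k] {R : Type*} [CommRing R] [Algebra k R] {𝒜 : ℕ → Submodule k R}
  [GradedAlgebra 𝒜] {n : ℕ} {x : Fin n → R}

theorem mem_span_of_mem (hx : GeneratesMaximalIdeal 𝒜 x) {d : ℕ} (hd : 0 < d) {a : R}
    (ha : a ∈ 𝒜 d) : a ∈ Ideal.span (Set.range x) := by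
  rw [hx.span_eq]
  exact HomogeneousIdeal.mem_irrelevant_of_mem 𝒜 hd ha

theorem exists_pos_degree (hx : GeneratesMaximalIdeal 𝒜 x) :
    ∃ δ : Fin n → ℕ, (∀ i, 0 < δ i) ∧ ∀ i, x i ∈ 𝒜 (δ i) := by
  have h : ∀ i, ∃ d : ℕ, 0 < d ∧ x i ∈ 𝒜 d := by
    intro i
    obtain ⟨d, hd⟩ := hx.isHomogeneous i
    -- A generator of degree `0` in the irrelevant ideal is zero, hence also homogeneous of degree
    -- `1`.
    rcases Nat.eq_zero_or_pos d with rfl | hd0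
    · refine ⟨1, one_pos, ?_⟩
      have h1 : x i ∈ (HomogeneousIdeal.irrelevant 𝒜).toIdeal :=
        hx.span_eq ▸ Ideal.subset_span ⟨i, rfl⟩
      have h2 : (DirectSum.decompose 𝒜 (x i) 0 : R) = 0 := h1
      rw [DirectSum.decompose_of_mem_same 𝒜 hd] at h2
      rw [h2]
      exact zero_mem _
    · exact ⟨d, hd0, hd⟩
  choose δ hδ using h
  exact ⟨δ, fun i => (hδ i).1, fun i => (hδ i).2⟩

end MaximalIdeal

/-! ### Nil-support of the local cohomology of the Segre product -/

section Segre

/-- A family on the sum of three index sets. -/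
def idxElim {X Y Z M : Type*} (a : X → M) (b : Y → M) (c : Z → M) : Idx X Y Z → M :=
  fun i => Sum.elim a (fun i => Sum.elim b c (ofLex i)) (ofLex i)

theorem charP_tensorProduct (k : Type*) [Field k] (R S : Type*) [CommRing R] [CommRing S]
    [Algebra k R] [Algebra k S] (p : ℕ) [Fact p.Prime] [CharP R p] [CharP S p] :
    CharP (R ⊗[k] S) p := by
  have : Nontrivial R := CharP.nontrivial_of_char_ne_one (Fact.out (p := p.Prime)).ne_one
  have : Nontrivial S := CharP.nontrivial_of_char_ne_one (Fact.out (p := p.Prime)).ne_one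
  have : CharP k p :=
    (RingHom.charP_iff (algebraMap k R) (algebraMap k R).injective p).mpr inferInstance
  exact charP_of_injective_algebraMap (algebraMap k (R ⊗[k] S)).injective p

variable {k : Type*} [Field k] {R S : Type*} [CommRing R] [CommRing S] [Algebra k R]
  [Algebra k S] {𝒜 : ℕ → Submodule k R} [GradedAlgebra 𝒜] {ℬ : ℕ → Submodule k S}
  [GradedAlgebra ℬ] {l m n : ℕ} {x : Fin l → R} {y : Fin m → S} {z : Fin n → segreProduct 𝒜 ℬ}

/-- The elements of the tensor product given by families in the factors and in the Segre product. -/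
def segreFamily (x : Fin l → R) (y : Fin m → S) (z : Fin n → segreProduct 𝒜 ℬ) :
    Idx (Fin l) (Fin m) (Fin n) → R ⊗[k] S :=
  idxElim (fun i => x i ⊗ₜ 1) (fun j => 1 ⊗ₜ y j) fun l => (z l : R ⊗[k] S)

theorem segreFamily_eX (i : Fin l) : segreFamily x y z (eX i) = x i ⊗ₜ 1 := rfl

theorem segreFamily_eY (j : Fin m) : segreFamily x y z (eY j) = 1 ⊗ₜ y j := rfl

theorem segrePiece_le_span_left (hx : GeneratesMaximalIdeal 𝒜 x) {d : ℕ} (hd : 0 < d)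
    {w : R ⊗[k] S} (hw : w ∈ segrePiece 𝒜 ℬ d) : w ∈ Ideal.span
      (segreFamily x y z '' ↑(allX : Finset (Idx (Fin l) (Fin m) (Fin n)))) := by
  have h1 : Ideal.span (Set.range x) ≤ (Ideal.span (segreFamily x y z ''
      ↑(allX : Finset (Idx (Fin l) (Fin m) (Fin n))))).comap
        (Algebra.TensorProduct.includeLeft : R →ₐ[k] R ⊗[k] S) := by
    rw [Ideal.span_le]
    rintro _ ⟨i, rfl⟩
    exact Ideal.subset_span ⟨eX i, Finset.mem_coe.mpr (mem_allX.mpr ⟨i, rfl⟩), rfl⟩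
  rw [segrePiece_eq_span] at hw
  induction hw using Submodule.span_induction with
  | zero => exact zero_mem _
  | add _ _ _ _ h h' => exact add_mem h h'
  | smul c w _ h =>
    rw [Algebra.smul_def]
    exact Ideal.mul_mem_left _ _ h
  | mem w hw =>
    obtain ⟨a, ha, b, hb, rfl⟩ := hw
    have h2 : a ⊗ₜ[k] b = ((1 : R) ⊗ₜ b) * (a ⊗ₜ (1 : S)) := by
      rw [Algebra.TensorProduct.tmul_mul_tmul, one_mul, mul_one]
    rw [h2]
    exact Ideal.mul_mem_left _ _ (h1 (mem_span_of_mem hx hd ha))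

theorem segrePiece_le_span_right (hy : GeneratesMaximalIdeal ℬ y) {d : ℕ} (hd : 0 < d)
    {w : R ⊗[k] S} (hw : w ∈ segrePiece 𝒜 ℬ d) : w ∈ Ideal.span
      (segreFamily x y z '' ↑(allY : Finset (Idx (Fin l) (Fin m) (Fin n)))) := by
  have h1 : Ideal.span (Set.range y) ≤ (Ideal.span (segreFamily x y z ''
      ↑(allY : Finset (Idx (Fin l) (Fin m) (Fin n))))).comap
        (Algebra.TensorProduct.includeRight : S →ₐ[k] R ⊗[k] S) := by
    rw [Ideal.span_le]
    rintro _ ⟨i, rfl⟩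
    exact Ideal.subset_span ⟨eY i, Finset.mem_coe.mpr (mem_allY.mpr ⟨i, rfl⟩), rfl⟩
  rw [segrePiece_eq_span] at hw
  induction hw using Submodule.span_induction with
  | zero => exact zero_mem _
  | add _ _ _ _ h h' => exact add_mem h h'
  | smul c w _ h =>
    rw [Algebra.smul_def]
    exact Ideal.mul_mem_left _ _ h
  | mem w hw =>
    obtain ⟨a, ha, b, hb, rfl⟩ := hw
    have h2 : a ⊗ₜ[k] b = (a ⊗ₜ (1 : S)) * ((1 : R) ⊗ₜ b) := by
      rw [Algebra.TensorProduct.tmul_mul_tmul, one_mul, mul_one]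
    rw [h2]
    exact Ideal.mul_mem_left _ _ (h1 (mem_span_of_mem hy hd hb))

theorem segrePiece_le_span (hz : GeneratesMaximalIdeal (segreGrading 𝒜 ℬ) z) {d : ℕ} (hd : 0 < d)
    {w : R ⊗[k] S} (hw : w ∈ segrePiece 𝒜 ℬ d) : w ∈ Ideal.span
      (segreFamily x y z '' ↑(allZ : Finset (Idx (Fin l) (Fin m) (Fin n)))) := by
  have h1 : Ideal.span (Set.range z) ≤ (Ideal.span (segreFamily x y z ''
      ↑(allZ : Finset (Idx (Fin l) (Fin m) (Fin n))))).comap (segreProduct 𝒜 ℬ).val := by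
    rw [Ideal.span_le]
    rintro _ ⟨i, rfl⟩
    exact Ideal.subset_span ⟨eZ i, Finset.mem_coe.mpr (mem_allZ.mpr ⟨i, rfl⟩), rfl⟩
  have h2 : (⟨w, segrePiece_le 𝒜 ℬ d hw⟩ : segreProduct 𝒜 ℬ) ∈ segreGrading 𝒜 ℬ d := hw
  exact h1 (mem_span_of_mem hz hd h2)

/-- The nil-support of the local cohomology of a Segre product, in negative degrees. -/
theorem mem_nilSupport_segreProduct_iff (p : ℕ) [Fact p.Prime] [CharP R p] [CharP S p]
    (hx : GeneratesMaximalIdeal 𝒜 x) (hy : GeneratesMaximalIdeal ℬ y)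
    (hz : GeneratesMaximalIdeal (segreGrading 𝒜 ℬ) z) {j : ℕ} {d : ℤ} (hd : d < 0) :
    d ∈ nilSupportLocalCohomology p (segreGrading 𝒜 ℬ) z j ↔
      ∃ a b : ℕ, a + b = j + 1 ∧ d ∈ nilSupportLocalCohomology p 𝒜 x a ∧
        d ∈ nilSupportLocalCohomology p ℬ y b := by
  have := charP_tensorProduct k R S p
  obtain ⟨δ, hδ, hxδ⟩ := exists_pos_degree hx
  obtain ⟨δ', hδ', hyδ⟩ := exists_pos_degree hy
  obtain ⟨ε, hε, hzε⟩ := exists_pos_degree hz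
  have hk := homog_zero_algebraMap 𝒜
  have hk' := homog_zero_algebraMap ℬ
  let Δ : Idx (Fin l) (Fin m) (Fin n) → ℤ × ℤ :=
    idxElim (fun i => AddMonoidHom.inl ℤ ℤ (δ i)) (fun j => AddMonoidHom.inr ℤ ℤ (δ' j))
      fun l => diagHom (ε l)
  have hΔ : ∀ i, (bigrading 𝒜 ℬ).Homog (Δ i) (segreFamily x y z i) :=
    idx_cases (fun i => homog_tmul_one _ _ (homog_of_mem 𝒜 (hxδ i)))
      (fun j => homog_one_tmul _ _ (homog_of_mem ℬ (hyδ j)))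
      fun l => homog_of_mem_segrePiece 𝒜 ℬ (hzε l)
  have h1 := nilDeg_subring_iff (hδ := homog_family hzε) (hδ' := hΔ) (θ := diagHom) p
    (φ := (segreProduct 𝒜 ℬ).val.toRingHom) (fun _ => rfl) Subtype.val_injective
    (fun _ h _ => eq_zero_of_homog_neg (segreGrading 𝒜 ℬ) h) (fun _ => rfl)
    (fun _ _ => homog_segreProduct 𝒜 ℬ) (fun _ _ => exists_homog_segreProduct 𝒜 ℬ) j hd
  have h2 := nilDeg_chain (f := segreFamily x y z)
    (fun l => Ideal.le_radical (segrePiece_le_span_left hx (hε l) (hzε l)))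
    (fun l => Ideal.le_radical (segrePiece_le_span_right hy (hε l) (hzε l)))
    (fun i j => by
      -- With this exponent the power splits off `x i ^ δ' j ⊗ y j ^ δ i`, whose two factors both
      -- have degree `δ i * δ' j`; it thus lies in the irrelevant ideal of the Segre product.
      refine ⟨δ i + δ' j, ?_⟩
      have h : (segreFamily x y z (eX i) * segreFamily x y z (eY j)) ^ (δ i + δ' j) =
          ((x i ^ δ i) ⊗ₜ[k] (y j ^ δ' j)) * ((x i ^ δ' j) ⊗ₜ[k] (y j ^ δ i)) := by
        rw [segreFamily_eX, segreFamily_eY, Algebra.TensorProduct.tmul_mul_tmul, mul_one, one_mul,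
          Algebra.TensorProduct.tmul_pow, Algebra.TensorProduct.tmul_mul_tmul, ← pow_add,
          ← pow_add, add_comm (δ' j)]
      rw [h]
      refine Ideal.mul_mem_left _ _
        (segrePiece_le_span hz (Nat.mul_pos (hδ' j) (hδ i)) ?_)
      rw [segrePiece_eq_span]
      refine Submodule.subset_span ⟨_, ?_, _, ?_, rfl⟩
      · simpa using SetLike.pow_mem_graded (δ' j) (hxδ i)
      · simpa [mul_comm] using SetLike.pow_mem_graded (δ i) (hyδ j))
    hΔ p j (diagHom d)
  have hW : Function.Bijective (Algebra.TensorProduct.productMap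
      (Algebra.TensorProduct.includeLeft : R →ₐ[k] R ⊗[k] S)
      (Algebra.TensorProduct.includeRight : S →ₐ[k] R ⊗[k] S)) := by
    have h : Algebra.TensorProduct.productMap
        (Algebra.TensorProduct.includeLeft : R →ₐ[k] R ⊗[k] S)
        (Algebra.TensorProduct.includeRight : S →ₐ[k] R ⊗[k] S) = AlgHom.id k _ := by
      ext <;> simp
    rw [h]
    exact Function.bijective_id
  have h3 := nilDeg_tensor_iff (p := p) (f := segreFamily x y z)
    (iL := (Algebra.TensorProduct.includeLeft : R →ₐ[k] R ⊗[k] S))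
    (iR := (Algebra.TensorProduct.includeRight : S →ₐ[k] R ⊗[k] S)) (fun _ => rfl) (fun _ => rfl)
    (homog_family hxδ) (homog_family hyδ) hΔ (fun _ _ => homog_tmul_one hk hk')
    (fun _ _ => homog_one_tmul hk hk') (fun _ h _ => eq_zero_of_homog_neg 𝒜 h)
    (fun _ h _ => eq_zero_of_homog_neg ℬ h) hW (j + 1) hd
  rw [mem_nilSupport_iff _ hzε, h1, h2]
  refine (not_congr h3).trans ?_
  push Not
  simp only [mem_nilSupport_iff 𝒜 hxδ, mem_nilSupport_iff ℬ hyδ]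
  exact exists₂_congr fun a b => and_congr_left fun _ => by omega

end Segre

/-! ### Consequences of generators and of positive depth -/

section Generators

variable {k : Type*} [Field k] {R : Type*} [CommRing R] [Algebra k R] {𝒜 : ℕ → Submodule k R}
  [GradedAlgebra 𝒜] {n : ℕ} {x : Fin n → R}

theorem exists_sub_algebraMap_mem (hx : GeneratesMaximalIdeal 𝒜 x)
    (h0 : ∀ a ∈ 𝒜 0, ∃ c : k, algebraMap k R c = a) (r : R) :
    ∃ c : k, r - algebraMap k R c ∈ Ideal.span (Set.range x) := by
  obtain ⟨c, hc⟩ := h0 _ (DirectSum.decompose 𝒜 r 0).2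
  refine ⟨c, ?_⟩
  rw [hx.span_eq, hc]
  change (DirectSum.decompose 𝒜 (r - DirectSum.decompose 𝒜 r 0) 0 : R) = 0
  rw [DirectSum.decompose_sub, DirectSum.decompose_coe, DirectSum.sub_apply,
    DirectSum.of_eq_same, sub_self]
  rfl

/-- Induction on the degree: a homogeneous `a` of positive degree is a combination of the `x i`, and
projecting to its degree makes the coefficients homogeneous of smaller degree. -/
theorem adjoin_range_eq_top (hx : GeneratesMaximalIdeal 𝒜 x)
    (h0 : ∀ a ∈ 𝒜 0, ∃ c : k, algebraMap k R c = a) : Algebra.adjoin k (Set.range x) = ⊤ := by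
  obtain ⟨δ, hδ, hxδ⟩ := exists_pos_degree hx
  have key : ∀ d : ℕ, ∀ a ∈ 𝒜 d, a ∈ Algebra.adjoin k (Set.range x) := by
    intro d
    induction d using Nat.strong_induction_on with
    | _ d ih =>
      intro a ha
      rcases Nat.eq_zero_or_pos d with rfl | hd
      · obtain ⟨c, rfl⟩ := h0 a ha
        exact Subalgebra.algebraMap_mem _ c
      · obtain ⟨r, hr⟩ := Ideal.mem_span_range_iff_exists_fun.mp (mem_span_of_mem hx hd ha)
        have h1 := (homog_of_mem 𝒜 ha).proj_self
        rw [← hr, map_sum, hr] at h1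
        rw [← h1]
        refine sum_mem fun i _ => ?_
        rw [mul_comm, proj_mul' (homog_of_mem 𝒜 (hxδ i))]
        refine mul_mem (Algebra.subset_adjoin ⟨i, rfl⟩) ?_
        by_cases hi : (d : ℤ) - δ i < 0
        · rw [proj_eq_zero_of_neg 𝒜 hi]
          exact zero_mem _
        · refine ih (d - δ i) (Nat.sub_lt hd (hδ i)) _ (mem_of_homog 𝒜 ?_)
          rw [Nat.cast_sub (by omega)]
          exact Coaction.homog_proj _ _
  classical
  rw [eq_top_iff]
  rintro a -
  rw [← DirectSum.sum_support_decompose 𝒜 a]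
  exact sum_mem fun d _ => key d _ (SetLike.coe_mem _)

theorem finiteType_of_generatesMaximalIdeal (hx : GeneratesMaximalIdeal 𝒜 x)
    (h0 : ∀ a ∈ 𝒜 0, ∃ c : k, algebraMap k R c = a) : Algebra.FiniteType k R :=
  ⟨(Set.finite_range x).toFinset, by
    rw [Set.Finite.coe_toFinset]
    exact adjoin_range_eq_top hx h0⟩

/-- A graded ring of positive depth has a nonzerodivisor in the homogeneous maximal ideal. -/
theorem exists_isSMulRegular (h : 1 ≤ gradedDepth 𝒜) :
    ∃ r ∈ (HomogeneousIdeal.irrelevant 𝒜).toIdeal, IsSMulRegular R r := by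
  by_contra! hcon
  have h1 : gradedDepth 𝒜 ≤ 0 := by
    refine iSup₂_le fun rs hrs => ?_
    cases rs with
    | nil => simp
    | cons r rs =>
      have h2 := ((RingTheory.Sequence.isWeaklyRegular_cons_iff R r rs).mp
        hrs.1.toIsWeaklyRegular).1
      exact absurd h2 (hcon r (hrs.2 r (by simp)))
  exact absurd (h.trans h1) (by simp)

/-- Otherwise the irrelevant ideal would consist of nilpotents, yet positive depth provides a
nonzerodivisor in it. -/
theorem exists_not_isNilpotent [Nontrivial R] (hx : GeneratesMaximalIdeal 𝒜 x)
    (h : 1 ≤ gradedDepth 𝒜) : ∃ l, ¬ IsNilpotent (x l) := by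
  by_contra! hcon
  obtain ⟨r, hr, hreg⟩ := exists_isSMulRegular h
  have h1 : Ideal.span (Set.range x) ≤ nilradical R := by
    rw [Ideal.span_le]
    rintro _ ⟨l, rfl⟩
    exact hcon l
  obtain ⟨m, hm⟩ : IsNilpotent r := h1 (hx.span_eq ▸ hr)
  have h2 := hreg.pow m
  rw [hm] at h2
  exact one_ne_zero (h2 (by simp : (0 : R) • (1 : R) = (0 : R) • (0 : R)))

theorem exists_algebraMap_eq_of_isStandardGraded (h : IsStandardGraded 𝒜) :
    ∀ a ∈ 𝒜 0, ∃ c : k, algebraMap k R c = a := by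
  intro a ha
  obtain ⟨c, hc⟩ := h.bijective_algebraMap.2 ⟨a, ha⟩
  exact ⟨c, congrArg Subtype.val hc⟩

variable {S : Type*} [CommRing S] [Algebra k S] {ℬ : ℕ → Submodule k S} [GradedAlgebra ℬ]

theorem exists_algebraMap_eq_of_mem_segreGrading (h : ∀ a ∈ 𝒜 0, ∃ c : k, algebraMap k R c = a)
    (h' : ∀ a ∈ ℬ 0, ∃ c : k, algebraMap k S c = a) :
    ∀ t ∈ segreGrading 𝒜 ℬ 0, ∃ c : k, algebraMap k (segreProduct 𝒜 ℬ) c = t := by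
  intro t ht
  have ht' : (t : R ⊗[k] S) ∈ segrePiece 𝒜 ℬ 0 := ht
  suffices hw : ∀ w ∈ segrePiece 𝒜 ℬ 0, ∃ c : k, algebraMap k (R ⊗[k] S) c = w by
    obtain ⟨c, hc⟩ := hw _ ht'
    exact ⟨c, Subtype.ext hc⟩
  intro w hw
  rw [segrePiece_eq_span] at hw
  induction hw using Submodule.span_induction with
  | zero => exact ⟨0, map_zero _⟩
  | add v w _ _ hv hw =>
    obtain ⟨c, rfl⟩ := hv
    obtain ⟨d, rfl⟩ := hw
    exact ⟨c + d, map_add _ _ _⟩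
  | smul c w _ hw =>
    obtain ⟨d, rfl⟩ := hw
    exact ⟨c * d, by rw [map_mul, Algebra.smul_def]⟩
  | mem w hw =>
    obtain ⟨a, ha, b, hb, rfl⟩ := hw
    obtain ⟨c, rfl⟩ := h a ha
    obtain ⟨d, rfl⟩ := h' b hb
    refine ⟨c * d, ?_⟩
    rw [map_mul, Algebra.TensorProduct.algebraMap_apply, Algebra.TensorProduct.algebraMap_apply']
    rw [Algebra.TensorProduct.tmul_mul_tmul, mul_one, one_mul]

end Generators

/-! ### Krull dimension and integral extensions -/

section Dimension

theorem ringKrullDim_le_of_isIntegral (A B : Type*) [CommRing A] [CommRing B] [Algebra A B]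
    [Algebra.IsIntegral A B] : ringKrullDim B ≤ ringKrullDim A :=
  Order.krullDim_le_of_strictMono (PrimeSpectrum.comap (algebraMap A B)) fun I J h =>
    Ideal.IsIntegral.comap_lt_comap (I := I.asIdeal) (J := J.asIdeal) h

/-- Lying over starts a chain of primes above a given one, and going up extends it. -/
theorem le_ringKrullDim_of_isIntegral (A B : Type*) [CommRing A] [CommRing B] [Algebra A B]
    [Algebra.IsIntegral A B] (h : Function.Injective (algebraMap A B)) :
    ringKrullDim A ≤ ringKrullDim B := by
  have key : ∀ p : LTSeries (PrimeSpectrum A), ∃ q : LTSeries (PrimeSpectrum B),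
      q.length = p.length ∧ q.last.asIdeal.comap (algebraMap A B) = p.last.asIdeal := by
    intro p
    induction p using RelSeries.inductionOn' with
    | singleton P =>
      obtain ⟨Q, -, hQ, hQP⟩ := Ideal.exists_ideal_over_prime_of_isIntegral P.asIdeal (⊥ : Ideal B)
        (by rw [Ideal.comap_bot_of_injective _ h]; exact bot_le)
      exact ⟨RelSeries.singleton _ ⟨Q, hQ⟩, rfl, hQP⟩
    | snoc p P hP ih =>
      obtain ⟨q, hq, hqp⟩ := ih
      have hlt : p.last.asIdeal < P.asIdeal := hP
      obtain ⟨Q, hqQ, hQ, hQP⟩ := Ideal.exists_ideal_over_prime_of_isIntegral P.asIdeal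
        q.last.asIdeal (by rw [hqp]; exact hlt.le)
      have hlt' : q.last.asIdeal < Q := by
        refine lt_of_le_of_ne hqQ fun h => hlt.ne ?_
        rw [← hqp, h, hQP]
      refine ⟨q.snoc ⟨Q, hQ⟩ hlt', ?_, ?_⟩
      · rw [RelSeries.snoc_length, RelSeries.snoc_length, hq]
      · rw [RelSeries.last_snoc, RelSeries.last_snoc]
        exact hQP
  refine iSup_le fun p => ?_
  obtain ⟨q, hq, -⟩ := key p
  rw [← hq]
  exact le_iSup (fun q : LTSeries (PrimeSpectrum B) => ((q.length : ℕ∞) : WithBot ℕ∞)) q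

/-- Noether normalization by a polynomial ring in as many variables as the dimension. -/
theorem exists_integral_injective (k R : Type*) [Field k] [CommRing R] [Nontrivial R] [Algebra k R]
    [Algebra.FiniteType k R] : ∃ (r : ℕ) (g : MvPolynomial (Fin r) k →ₐ[k] R),
      ringKrullDim R = r ∧ Function.Injective g ∧ g.toRingHom.IsIntegral := by
  obtain ⟨r, g, hg, hfin⟩ := exists_integral_inj_algHom_of_fg k R
  refine ⟨r, g, ?_, hg, hfin⟩
  let _ : Algebra (MvPolynomial (Fin r) k) R := g.toRingHom.toAlgebra
  have : Algebra.IsIntegral (MvPolynomial (Fin r) k) R := ⟨hfin⟩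
  have h1 : ringKrullDim (MvPolynomial (Fin r) k) = r := by
    rw [MvPolynomial.ringKrullDim_of_isNoetherianRing, ringKrullDim_eq_zero_of_field, zero_add,
      Nat.card_fin]
  rw [← h1]
  exact le_antisymm (ringKrullDim_le_of_isIntegral _ _) (le_ringKrullDim_of_isIntegral _ _ hg)

/-- After passing to a suitable domain, the left side is bounded by its transcendence degree over
`k`, and the domain is integral over a subalgebra generated by the images of the `τ`-variables. -/
theorem card_le_card_of_isIntegral {k U : Type*} [Field k] [CommRing U] [Algebra k U]
    {σ τ : Type} [Fintype σ] [Fintype τ] (f : MvPolynomial σ k →ₐ[k] U)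
    (hf : Function.Injective f) (g : MvPolynomial τ k →ₐ[k] U) (hg : g.toRingHom.IsIntegral) :
    Fintype.card σ ≤ Fintype.card τ := by
  classical
  have hbot : (⊥ : Ideal (MvPolynomial σ k)) ∈ minimalPrimes (MvPolynomial σ k) := by
    rw [IsDomain.minimalPrimes_eq_singleton_bot]
    exact rfl
  -- `U` need not be a domain. The zero ideal of the polynomial ring is a minimal prime, so it is
  -- contracted from a prime `Q`, and `f` remains injective modulo `Q`.
  obtain ⟨Q, hQ, hQf⟩ := Ideal.exists_comap_eq_of_mem_minimalPrimes_of_injective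
    (f := f.toRingHom) hf ⊥ hbot
  let π : U →ₐ[k] U ⧸ Q := Ideal.Quotient.mkₐ k Q
  have hinj : Function.Injective (π.comp f) := by
    rw [injective_iff_map_eq_zero]
    intro a ha
    have h1 : f a ∈ Q := Ideal.Quotient.eq_zero_iff_mem.mp ha
    have h : a ∈ Q.comap f.toRingHom := h1
    rwa [hQf] at h
  let v : τ → U ⧸ Q := fun i => π (g (MvPolynomial.X i))
  have hv : ∀ a, π (g a) ∈ Algebra.adjoin k (Set.range v) := by
    intro a
    induction a using MvPolynomial.induction_on with
    | C c =>
      have h : π (g (MvPolynomial.C c)) = algebraMap k _ c := (π.comp g).commutes c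
      rw [h]
      exact Subalgebra.algebraMap_mem _ c
    | add a b ha hb => rw [map_add, map_add]; exact add_mem ha hb
    | mul_X a i ha =>
      rw [map_mul, map_mul]
      exact mul_mem ha (Algebra.subset_adjoin ⟨i, rfl⟩)
  have hint : (π.comp g).toRingHom.IsIntegral :=
    hg.trans _ _ (RingHom.isIntegral_of_surjective _ (Ideal.Quotient.mkₐ_surjective k Q))
  have : Algebra.IsIntegral (Algebra.adjoin k (Set.range v)) (U ⧸ Q) :=
    ⟨RingHom.IsIntegral.tower_top ((π.comp g).codRestrict _ hv).toRingHom
      (algebraMap (Algebra.adjoin k (Set.range v)) (U ⧸ Q)) hint⟩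
  have h1 := Algebra.IsAlgebraic.trdeg_le_cardinalMk k (Set.range v)
  have h2 := lift_trdeg_le_of_injective (π.comp f) hinj
  rw [MvPolynomial.trdeg_of_isDomain] at h2
  have h3 : Cardinal.mk (Set.range v) ≤ Fintype.card τ := by
    rw [Cardinal.mk_fintype]
    exact_mod_cast Fintype.card_range_le v
  have h4 := h2.trans (Cardinal.lift_le.mpr (h1.trans h3))
  simpa using h4

end Dimension

/-! ### The dimension of the Segre product -/

section Segre

variable {k : Type*} [Field k] {R S : Type*} [CommRing R] [CommRing S] [Algebra k R] [Algebra k S]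

theorem isIntegralElem_of_comp {A B C : Type*} [CommRing A] [CommRing B] [CommRing C] (ρ : A →+* B)
    (g : B →+* C) {c : C} (h : (g.comp ρ).IsIntegralElem c) : g.IsIntegralElem c := by
  obtain ⟨P, hP, hc⟩ := h
  exact ⟨P.map ρ, hP.map ρ, by rwa [Polynomial.eval₂_map]⟩

theorem isIntegralElem_map {A B C : Type*} [CommRing A] [CommRing B] [CommRing C] (g : A →+* B)
    (φ : B →+* C) {b : B} (h : g.IsIntegralElem b) : (φ.comp g).IsIntegralElem (φ b) := by
  obtain ⟨P, hP, hb⟩ := h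
  exact ⟨P, hP, by rw [← Polynomial.hom_eval₂, hb, map_zero]⟩

theorem exists_isIntegral_tensorProduct {r s : ℕ} {g : MvPolynomial (Fin r) k →ₐ[k] R}
    {h : MvPolynomial (Fin s) k →ₐ[k] S} (hg : g.toRingHom.IsIntegral)
    (hh : h.toRingHom.IsIntegral) :
    ∃ G : MvPolynomial (Fin r ⊕ Fin s) k →ₐ[k] R ⊗[k] S, G.toRingHom.IsIntegral := by
  let G : MvPolynomial (Fin r ⊕ Fin s) k →ₐ[k] R ⊗[k] S := MvPolynomial.aeval
    (Sum.elim (fun i => g (MvPolynomial.X i) ⊗ₜ 1) fun i => 1 ⊗ₜ h (MvPolynomial.X i))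
  have h1 : G.comp (MvPolynomial.rename Sum.inl) =
      (Algebra.TensorProduct.includeLeft : R →ₐ[k] R ⊗[k] S).comp g := by
    ext i
    simp [G]
  have h2 : G.comp (MvPolynomial.rename Sum.inr) =
      (Algebra.TensorProduct.includeRight : S →ₐ[k] R ⊗[k] S).comp h := by
    ext i
    simp [G]
  refine ⟨G, fun w => ?_⟩
  induction w with
  | zero => exact G.toRingHom.isIntegralElem_zero
  | add v w hv hw => exact RingHom.IsIntegralElem.add _ hv hw
  | tmul a b =>
    have e : a ⊗ₜ[k] b = (a ⊗ₜ (1 : S)) * ((1 : R) ⊗ₜ b) := by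
      rw [Algebra.TensorProduct.tmul_mul_tmul, one_mul, mul_one]
    rw [e]
    refine RingHom.IsIntegralElem.mul _ ?_ ?_
    · refine isIntegralElem_of_comp (MvPolynomial.rename Sum.inl :
        MvPolynomial (Fin r) k →ₐ[k] MvPolynomial (Fin r ⊕ Fin s) k).toRingHom _ ?_
      have h3 := isIntegralElem_map _
        (Algebra.TensorProduct.includeLeft : R →ₐ[k] R ⊗[k] S).toRingHom (hg a)
      have h4 := congrArg AlgHom.toRingHom h1
      change (G.comp (MvPolynomial.rename Sum.inl)).toRingHom.IsIntegralElem _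
      rw [h4]
      exact h3
    · refine isIntegralElem_of_comp (MvPolynomial.rename Sum.inr :
        MvPolynomial (Fin s) k →ₐ[k] MvPolynomial (Fin r ⊕ Fin s) k).toRingHom _ ?_
      have h3 := isIntegralElem_map _
        (Algebra.TensorProduct.includeRight : S →ₐ[k] R ⊗[k] S).toRingHom (hh b)
      have h4 := congrArg AlgHom.toRingHom h2
      change (G.comp (MvPolynomial.rename Sum.inr)).toRingHom.IsIntegralElem _
      rw [h4]
      exact h3

variable (𝒜 : ℕ → Submodule k R) [GradedAlgebra 𝒜] (ℬ : ℕ → Submodule k S) [GradedAlgebra ℬ]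

theorem coe_proj_segreProduct (m : ℤ) (t : segreProduct 𝒜 ℬ) :
    ((gradedCoaction (segreGrading 𝒜 ℬ)).proj m t : R ⊗[k] S) =
      (bigrading 𝒜 ℬ).proj (diagHom m) (t : R ⊗[k] S) := by
  induction t using (gradedCoaction (segreGrading 𝒜 ℬ)).induction with
  | hadd t t' ht ht' => rw [map_add, Subalgebra.coe_add, Subalgebra.coe_add, map_add, ht, ht']
  | h g t ht =>
    rw [ht.proj_eq_ite, (homog_segreProduct 𝒜 ℬ ht).proj_eq_ite]
    by_cases hgm : g = m
    · rw [if_pos hgm, if_pos (by rw [hgm])]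
    · rw [if_neg hgm, if_neg fun h : diagHom g = diagHom m => hgm (congrArg Prod.fst h)]
      rfl

variable {𝒜} in
-- The Segre product lies on the diagonal, while `a ⊗ 1` has only components of bidegree `(i, 0)`
-- with `i > 0`; the product has no diagonal component.
theorem proj_coe_mul_tmul_one {a : R} (ha : a ∈ (HomogeneousIdeal.irrelevant 𝒜).toIdeal) (m : ℤ)
    (t : segreProduct 𝒜 ℬ) :
    (bigrading 𝒜 ℬ).proj (diagHom m) ((t : R ⊗[k] S) * (a ⊗ₜ (1 : S))) = 0 := by
  induction t using (gradedCoaction (segreGrading 𝒜 ℬ)).induction with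
  | hadd t t' ht ht' => rw [Subalgebra.coe_add, add_mul, map_add, ht, ht', add_zero]
  | h g t ht =>
    rw [proj_mul' (homog_segreProduct 𝒜 ℬ ht), ← map_sub]
    have h1 : (bigrading 𝒜 ℬ).proj (diagHom (m - g)) (a ⊗ₜ[k] (1 : S)) =
        (gradedCoaction 𝒜).proj (m - g) a ⊗ₜ (gradedCoaction ℬ).proj (m - g) 1 :=
      proj_tmul _ _ _ _ _ _
    rw [h1, Coaction.Homog.one.proj_eq_ite]
    split_ifs with h
    · have h2 : (gradedCoaction 𝒜).proj ((0 : ℕ) : ℤ) a = 0 := by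
        rw [proj_gradedCoaction]
        exact ha
      rw [← h]
      rw [Nat.cast_zero] at h2
      rw [h2, TensorProduct.zero_tmul, mul_zero]
    · rw [TensorProduct.tmul_zero, mul_zero]

/-- A nonzerodivisor stays one after tensoring with `S`, since `S` is flat over the field `k`. -/
theorem mul_tmul_one_injective (S : Type*) [CommRing S] [Algebra k S] {r : R}
    (hr : IsSMulRegular R r) {w : R ⊗[k] S} (hw : w * (r ⊗ₜ (1 : S)) = 0) : w = 0 := by
  have h1 : Function.Injective (LinearMap.mulLeft k r) := hr
  have h2 := Module.Flat.rTensor_preserves_injective_linearMap (M := S) (LinearMap.mulLeft k r) h1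
  have h3 : ∀ w : R ⊗[k] S, LinearMap.rTensor S (LinearMap.mulLeft k r) w =
      w * (r ⊗ₜ (1 : S)) := by
    intro w
    induction w with
    | zero => rw [map_zero, zero_mul]
    | add v w hv hw => rw [map_add, add_mul, hv, hw]
    | tmul a b =>
      rw [LinearMap.rTensor_tmul, LinearMap.mulLeft_apply, Algebra.TensorProduct.tmul_mul_tmul,
        mul_one, mul_comm]
  exact h2 (by rw [h3, hw, map_zero])

variable {𝒜} in
/-- A nonzerodivisor in the maximal ideal of a factor is transcendental over the Segre product. -/
theorem injective_aeval_tmul_one {r : R} (hr : r ∈ (HomogeneousIdeal.irrelevant 𝒜).toIdeal)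
    (hreg : IsSMulRegular R r) : Function.Injective
      (Polynomial.aeval (R := segreProduct 𝒜 ℬ) (r ⊗ₜ[k] (1 : S))) := by
  have hdiag : ∀ (q : Polynomial (segreProduct 𝒜 ℬ)) (m : ℤ), (bigrading 𝒜 ℬ).proj (diagHom m)
      (Polynomial.aeval (r ⊗ₜ[k] (1 : S)) q * (r ⊗ₜ (1 : S))) = 0 := by
    intro q m
    induction q using Polynomial.induction_on' with
    | add q q' hq hq' => rw [map_add, add_mul, map_add, hq, hq', add_zero]
    | monomial i t =>
      rw [Polynomial.aeval_monomial, mul_assoc, ← pow_succ, Algebra.TensorProduct.tmul_pow, one_pow]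
      exact proj_coe_mul_tmul_one ℬ (Ideal.pow_mem_of_mem _ hr _ (Nat.succ_pos i)) m t
  rw [injective_iff_map_eq_zero]
  -- By `hdiag` the diagonal part of the value of `q` is its constant coefficient, which is
  -- therefore zero. Then the nonzerodivisor `r ⊗ 1` can be cancelled and the degree drops.
  have key : ∀ N : ℕ, ∀ q : Polynomial (segreProduct 𝒜 ℬ), q.natDegree < N →
      Polynomial.aeval (r ⊗ₜ[k] (1 : S)) q = 0 → q = 0 := by
    intro N
    induction N with
    | zero => exact fun q hq => absurd hq (by omega)
    | succ N ih =>
      intro q hq h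
      have h1 := q.divX_mul_X_add
      have h2 : Polynomial.aeval (r ⊗ₜ[k] (1 : S)) q.divX * (r ⊗ₜ (1 : S)) +
          ((q.coeff 0 : segreProduct 𝒜 ℬ) : R ⊗[k] S) = 0 := by
        rw [← h]
        conv_rhs => rw [← h1, map_add, map_mul, Polynomial.aeval_X, Polynomial.aeval_C]
        rfl
      have h3 : q.coeff 0 = 0 := by
        refine (gradedCoaction (segreGrading 𝒜 ℬ)).eq_zero_of_proj fun m => Subtype.ext ?_
        rw [coe_proj_segreProduct]
        have h4 := congrArg ((bigrading 𝒜 ℬ).proj (diagHom m)) h2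
        rw [map_add, hdiag, zero_add, map_zero] at h4
        exact h4
      rw [h3] at h2 h1
      have h5 : Polynomial.aeval (r ⊗ₜ[k] (1 : S)) q.divX = 0 := by
        refine mul_tmul_one_injective S hreg ?_
        rw [← h2]
        exact (add_zero _).symm
      rw [← h1]
      by_cases hq0 : q.natDegree = 0
      · rw [Polynomial.divX_eq_zero_iff.mpr (Polynomial.eq_C_of_natDegree_eq_zero hq0), zero_mul,
          map_zero, zero_add]
      · rw [ih _ (by rw [Polynomial.natDegree_divX_eq_natDegree_tsub_one]; omega) h5, zero_mul,
          map_zero, zero_add]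
  exact fun q => key _ q (Nat.lt_succ_self _)

variable {𝒜} in
-- Adjoining `r ⊗ 1` to a Noether normalization of the Segre product gives `c + 1` algebraically
-- independent elements of `R ⊗ S`, which is integral over the image of a polynomial ring in `a + b`
-- variables.
theorem ringKrullDim_segreProduct_add_one_le [Nontrivial R] [Nontrivial S] [Algebra.FiniteType k R]
    [Algebra.FiniteType k S] [Algebra.FiniteType k (segreProduct 𝒜 ℬ)] {r : R}
    (hr : r ∈ (HomogeneousIdeal.irrelevant 𝒜).toIdeal) (hreg : IsSMulRegular R r) :
    ∃ a b c : ℕ, ringKrullDim R = a ∧ ringKrullDim S = b ∧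
      ringKrullDim (segreProduct 𝒜 ℬ) = c ∧ c + 1 ≤ a + b := by
  obtain ⟨a, g, ha, -, hg⟩ := exists_integral_injective k R
  obtain ⟨b, h, hb, -, hh⟩ := exists_integral_injective k S
  obtain ⟨c, e, hc, he, -⟩ := exists_integral_injective k (segreProduct 𝒜 ℬ)
  obtain ⟨G, hG⟩ := exists_isIntegral_tensorProduct hg hh
  let F : MvPolynomial (Fin (c + 1)) k →ₐ[k] R ⊗[k] S :=
    (((Polynomial.aeval (R := segreProduct 𝒜 ℬ) (r ⊗ₜ[k] (1 : S))).restrictScalars k).comp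
      (Polynomial.mapAlgHom e)).comp (MvPolynomial.finSuccEquiv k c).toAlgHom
  have hF : Function.Injective F :=
    ((injective_aeval_tmul_one ℬ hr hreg).comp (Polynomial.map_injective e.toRingHom he)).comp
      (MvPolynomial.finSuccEquiv k c).injective
  refine ⟨a, b, c, ha, hb, hc, ?_⟩
  simpa using card_le_card_of_isIntegral F hF G hG

end Segre

/-! ### Generalized `F`-depth through nil-supports -/

section Depth

variable {R : Type*} [CommRing R] {n : ℕ} {x : Fin n → R} {p : ℕ} [Fact p.Prime] [CharP R p]

theorem gFDepth_le {j : ℕ} (hj : ¬ IsGeneralizedNilpotent (localCohomologyFrobenius x p j)) :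
    gFDepth x p ≤ j := iInf₂_le j hj

theorem exists_gFDepth_eq {j : ℕ}
    (hj : ¬ IsGeneralizedNilpotent (localCohomologyFrobenius x p j)) :
    ∃ g : ℕ, gFDepth x p = g ∧ ¬ IsGeneralizedNilpotent (localCohomologyFrobenius x p g) ∧
      ∀ i, ¬ IsGeneralizedNilpotent (localCohomologyFrobenius x p i) → g ≤ i := by
  classical
  have h : ∃ j, ¬ IsGeneralizedNilpotent (localCohomologyFrobenius x p j) := ⟨j, hj⟩
  refine ⟨Nat.find h, le_antisymm (gFDepth_le (Nat.find_spec h)) ?_, Nat.find_spec h,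
    fun i hi => Nat.find_min' h hi⟩
  exact le_iInf₂ fun i hi => by exact_mod_cast Nat.find_min' h hi

theorem exists_of_gFDepth_ne_top (h : gFDepth x p ≠ ⊤) :
    ∃ g : ℕ, gFDepth x p = g ∧ ¬ IsGeneralizedNilpotent (localCohomologyFrobenius x p g) := by
  by_cases hj : ∃ j, ¬ IsGeneralizedNilpotent (localCohomologyFrobenius x p j)
  · obtain ⟨j, hj⟩ := hj
    obtain ⟨g, hg, hg', -⟩ := exists_gFDepth_eq hj
    exact ⟨g, hg, hg'⟩
  · push Not at hj
    exact absurd (by rw [gFDepth]; simp [hj]) h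

variable {k : Type*} [Field k] [Algebra k R] {𝒜 : ℕ → Submodule k R} [GradedAlgebra 𝒜]

theorem isGeneralizedNilpotent_iff_nilSupport [IsNoetherianRing R]
    (hx : GeneratesMaximalIdeal 𝒜 x) (h0 : ∀ a ∈ 𝒜 0, ∃ c : k, algebraMap k R c = a) {j : ℕ} :
    IsGeneralizedNilpotent (localCohomologyFrobenius x p j) ↔
      ∀ d < 0, d ∉ nilSupportLocalCohomology p 𝒜 x j := by
  obtain ⟨δ, hδ, hxδ⟩ := exists_pos_degree hx
  rw [isGeneralizedNilpotent_iff (hδ := homog_family hxδ) (homog_zero_algebraMap 𝒜)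
    (fun i => by exact_mod_cast hδ i) (fun _ h _ => eq_zero_of_homog_neg 𝒜 h)
    (exists_sub_algebraMap_mem hx h0)]
  exact forall₂_congr fun d _ => by rw [mem_nilSupport_iff 𝒜 hxδ, not_not]

theorem nilSupport_le_zero [IsNoetherianRing R] (hx : GeneratesMaximalIdeal 𝒜 x)
    (h0 : ∀ a ∈ 𝒜 0, ∃ c : k, algebraMap k R c = a) {j : ℕ} {d : ℤ}
    (hd : d ∈ nilSupportLocalCohomology p 𝒜 x j) : d ≤ 0 := by
  obtain ⟨δ, hδ, hxδ⟩ := exists_pos_degree hx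
  rw [mem_nilSupport_iff 𝒜 hxδ] at hd
  by_contra! hcon
  exact hd (nilDeg_of_pos (homog_zero_algebraMap 𝒜) (fun i => by exact_mod_cast hδ i)
    (exists_sub_algebraMap_mem hx h0) j hcon)

/-- A cochain of cohomological degree `0` lives at `∅` only, where it is a ring element of negative
degree. -/
theorem notMem_nilSupport_zero (hx : GeneratesMaximalIdeal 𝒜 x) {d : ℤ} (hd : d < 0) :
    d ∉ nilSupportLocalCohomology p 𝒜 x 0 := by
  obtain ⟨δ, hδ, hxδ⟩ := exists_pos_degree hx
  rw [mem_nilSupport_iff 𝒜 hxδ, not_not]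
  intro c _ hc _
  have h : c = 0 := by
    funext s
    by_cases hs : s = ∅
    · subst hs
      exact hc.apply_empty (homog_family hxδ) (fun _ h _ => eq_zero_of_homog_neg 𝒜 h) hd
    · exact hc.card s (by simpa using hs)
  rw [h]
  exact Nilp.of_mem (zero_mem _)

theorem exists_mem_nilSupport [Nontrivial R] (hx : GeneratesMaximalIdeal 𝒜 x)
    (h : 1 ≤ gradedDepth 𝒜) :
    ∃ (j : ℕ) (d : ℤ), d < 0 ∧ d ∈ nilSupportLocalCohomology p 𝒜 x j := by
  obtain ⟨δ, hδ, hxδ⟩ := exists_pos_degree hx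
  obtain ⟨j, d, hd, hjd⟩ := exists_not_nilDeg (p := p) (hδ := homog_family hxδ)
    (fun i => by exact_mod_cast hδ i) (fun _ h _ => eq_zero_of_homog_neg 𝒜 h)
    (exists_not_isNilpotent hx h)
  exact ⟨j, d, hd, (mem_nilSupport_iff 𝒜 hxδ p).mpr hjd⟩

end Depth

end SegreF

end

/-! ### The theorem -/

theorem mainTheorem5 {k : Type*} [Field k] {R S : Type*} [CommRing R] [CommRing S] [Algebra k R]
    [Algebra k S] (p : ℕ) [Fact p.Prime] [CharP R p] [CharP S p]
    (𝒜 : ℕ → Submodule k R) [GradedAlgebra 𝒜] (ℬ : ℕ → Submodule k S) [GradedAlgebra ℬ]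
    (hR : SegreF.IsStandardGraded 𝒜) (hS : SegreF.IsStandardGraded ℬ)
    (hFR : (frobenius R p).Finite) (hFS : (frobenius S p).Finite)
    (hdR : 2 ≤ SegreF.gradedDepth 𝒜) (hdS : 2 ≤ SegreF.gradedDepth ℬ)
    {l m n : ℕ} (x : Fin l → R) (hx : SegreF.GeneratesMaximalIdeal 𝒜 x)
    (y : Fin m → S) (hy : SegreF.GeneratesMaximalIdeal ℬ y)
    (z : Fin n → SegreF.segreProduct 𝒜 ℬ)
    (hz : SegreF.GeneratesMaximalIdeal (SegreF.segreGrading 𝒜 ℬ) z) :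
    (∃ gR gS : ℕ, SegreF.gFDepth x p = gR ∧ SegreF.gFDepth y p = gS ∧
      (gR + gS : ℕ∞) ≤ SegreF.gFDepth z p + 1 ∧
      (SegreF.gFDepth z p + 1 = gR + gS ↔
        ¬ SegreF.nilSupportLocalCohomology p 𝒜 x gR ∩
          SegreF.nilSupportLocalCohomology p ℬ y gS ⊆ {0})) ∧
    (SegreF.IsGeneralizedWeaklyFNilpotent x p → SegreF.IsGeneralizedWeaklyFNilpotent y p →
      SegreF.IsGeneralizedWeaklyFNilpotent z p) := by
  have := hR.isNoetherianRing
  have := hS.isNoetherianRing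
  have : Nontrivial R := CharP.nontrivial_of_char_ne_one (Fact.out (p := p.Prime)).ne_one
  have : Nontrivial S := CharP.nontrivial_of_char_ne_one (Fact.out (p := p.Prime)).ne_one
  have h0R := SegreF.exists_algebraMap_eq_of_isStandardGraded hR
  have h0S := SegreF.exists_algebraMap_eq_of_isStandardGraded hS
  have h0T := SegreF.exists_algebraMap_eq_of_mem_segreGrading h0R h0S
  have := SegreF.finiteType_of_generatesMaximalIdeal hx h0R
  have := SegreF.finiteType_of_generatesMaximalIdeal hy h0S
  have := SegreF.finiteType_of_generatesMaximalIdeal hz h0T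
  have : IsNoetherianRing (SegreF.segreProduct 𝒜 ℬ) := Algebra.FiniteType.isNoetherianRing k _
  have hnR := fun j => SegreF.isGeneralizedNilpotent_iff_nilSupport (p := p) (j := j) hx h0R
  have hnS := fun j => SegreF.isGeneralizedNilpotent_iff_nilSupport (p := p) (j := j) hy h0S
  have hnT := fun j => SegreF.isGeneralizedNilpotent_iff_nilSupport (p := p) (j := j) hz h0T
  obtain ⟨i, d, hd, hid⟩ :=
    SegreF.exists_mem_nilSupport (p := p) hx (one_le_two.trans hdR)
  obtain ⟨gR, hgR, hgR', hgRmin⟩ := SegreF.exists_gFDepth_eq (x := x) (p := p) (j := i)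
    fun h => (hnR i).mp h d hd hid
  obtain ⟨i', d', hd', hid'⟩ :=
    SegreF.exists_mem_nilSupport (p := p) hy (one_le_two.trans hdS)
  obtain ⟨gS, hgS, hgS', hgSmin⟩ := SegreF.exists_gFDepth_eq (x := y) (p := p) (j := i')
    fun h => (hnS i').mp h d' hd' hid'
  -- A failure for `T` in degree `j` splits, by the Künneth formula, into failures for `R` and `S`
  -- in a common negative degree; minimality of `gR` and `gS` then bounds `a` and `b` below.
  have key : ∀ j : ℕ, ¬ SegreF.IsGeneralizedNilpotent (SegreF.localCohomologyFrobenius z p j) →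
      ∃ (a b : ℕ) (e : ℤ), e < 0 ∧ a + b = j + 1 ∧ gR ≤ a ∧ gS ≤ b ∧
        e ∈ SegreF.nilSupportLocalCohomology p 𝒜 x a ∧
        e ∈ SegreF.nilSupportLocalCohomology p ℬ y b := by
    intro j hj
    rw [hnT] at hj
    push Not at hj
    obtain ⟨e, he, hje⟩ := hj
    obtain ⟨a, b, hab, ha, hb⟩ := (SegreF.mem_nilSupport_segreProduct_iff p hx hy hz he).mp hje
    exact ⟨a, b, e, he, hab, hgRmin a fun h => (hnR a).mp h e he ha,
      hgSmin b fun h => (hnS b).mp h e he hb, ha, hb⟩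
  have hle : (gR + gS : ℕ∞) ≤ SegreF.gFDepth z p + 1 := by
    by_cases htop : SegreF.gFDepth z p = ⊤
    · rw [htop, top_add]
      exact le_top
    · obtain ⟨j, hj, hj'⟩ := SegreF.exists_of_gFDepth_ne_top htop
      obtain ⟨a, b, -, -, hab, ha, hb, -⟩ := key j hj'
      rw [hj]
      exact_mod_cast (add_le_add ha hb).trans hab.le
  refine ⟨⟨gR, gS, hgR, hgS, hle, fun h hsub => ?_, fun h => le_antisymm ?_ hle⟩,
    fun hwR hwS j hj => ?_⟩
  · have htop : SegreF.gFDepth z p ≠ ⊤ := by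
      intro htop
      rw [htop, top_add] at h
      exact absurd h.symm (by exact_mod_cast ENat.natCast_ne_top (gR + gS))
    obtain ⟨j, hj, hj'⟩ := SegreF.exists_of_gFDepth_ne_top htop
    obtain ⟨a, b, e, he, hab, ha, hb, hea, heb⟩ := key j hj'
    rw [hj] at h
    -- Equality leaves no room: `a` and `b` must be the minimal indices, so `e` is a negative common
    -- element of the two nil-supports.
    have h1 : j + 1 = gR + gS := by exact_mod_cast h
    obtain rfl : a = gR := by omega
    obtain rfl : b = gS := by omega
    exact he.ne (hsub ⟨hea, heb⟩)
  · rw [Set.not_subset] at h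
    obtain ⟨e, ⟨heR, heS⟩, he0⟩ := h
    have he : e < 0 := lt_of_le_of_ne (SegreF.nilSupport_le_zero hx h0R heR) he0
    -- The index `gR + gS - 1` makes sense because `H^0` has no nil-support in negative degrees, so
    -- `gR` is not `0`.
    obtain ⟨j, hj⟩ : ∃ j, gR + gS = j + 1 := by
      refine Nat.exists_eq_succ_of_ne_zero fun h => ?_
      obtain rfl : gR = 0 := by omega
      exact SegreF.notMem_nilSupport_zero hx he heR
    have h1 : SegreF.gFDepth z p ≤ j := SegreF.gFDepth_le fun h => (hnT j).mp h e he
      ((SegreF.mem_nilSupport_segreProduct_iff p hx hy hz he).mpr ⟨gR, gS, hj, heR, heS⟩)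
    have h2 : ((gR : ℕ∞) + gS) = j + 1 := by exact_mod_cast hj
    rw [h2]
    exact add_le_add_left h1 1
  -- By hypothesis `gR` and `gS` are at least the dimensions of `R` and `S`. A failure for `T` in
  -- degree `j` gives `j + 1 ≥ dim R + dim S ≥ dim T + 1`.
  · obtain ⟨r, hr, hreg⟩ := SegreF.exists_isSMulRegular (one_le_two.trans hdR)
    obtain ⟨a, b, c, ha, hb, hc, habc⟩ :=
      SegreF.ringKrullDim_segreProduct_add_one_le (S := S) ℬ hr hreg
    by_contra hcon
    obtain ⟨a', b', -, -, hab, ha', hb', -⟩ := key j hcon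
    have h1 : a ≤ gR := by
      by_contra! h
      exact hgR' (hwR gR (by rw [ha]; exact_mod_cast h))
    have h2 : b ≤ gS := by
      by_contra! h
      exact hgS' (hwS gS (by rw [hb]; exact_mod_cast h))
    rw [hc] at hj
    have h3 : j < c := by exact_mod_cast hj
    omega
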